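/- Let $n\ge 0$ and let $0<\zeta_1^0<\dots<\zeta_n^0$ and $b_1^0,\dots,b_n^0>0$ be given ("spectral data"). For real numbers $\zeta_j,b_j$ ($1\le j\le n$) and $k\in\mathbb Z$ put $$T_k=\sum_{|I|=k}\frac{\Delta_I^2}{\zeta_I\Gamma_I}b_I,\qquad U_k=\sum_{|I|=k}\frac{\Delta_I^2}{\Gamma_I}b_I,\qquad V_k=\sum_{|I|=k}\frac{\Delta_I^2}{\Gamma_I}\zeta_I b_I,$$ where $I$ runs over the $k$-element subsets of $\{1,\dots,n\}$ (so that $T_k=U_k=V_k=0$ for $k<0$ or $k>n$), $b_I=\prod_{j\in I}b_j$, $\zeta_I=\prod_{j\in I}\zeta_j$, $\Delta_I=\prod_{i<j,\ i,j\in I}(\zeta_j-\zeta_i)$, $\Gamma_I=\prod_{i<j,\ i,j\in I}(\zeta_j+\zeta_i)$, and let $$W_k=V_kU_k-V_{k-1}U_{k+1},\qquad Z_k=T_kU_k-T_{k+1}U_{k-1}.$$ Write $k'=n+1-k$ and define, for $1\le k\le n$, $$x_{k'}=\tfrac12\log\frac{Z_k}{W_{k-1}},\quad m_{k'}=\frac{\sqrt{Z_kW_{k-1}}}{U_kU_{k-1}},\qquad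 r_k=\frac{U_k}{U_{k-1}},\quad s_k=\frac{V_{k-1}}{U_k};$$ the last two formulas also define $s_0=0$ and $r_{n+1}=0$. When $\zeta_j,b_j$ depend on $t$, all these quantities are functions of $t$. 1. (Negative flow.) If $\zeta_j(t),b_j(t)$, $t\in\mathbb R$, satisfy $\dot\zeta_j=0$, $\dot b_j=b_j/\zeta_j$, $\zeta_j(0)=\zeta_j^0$, $b_j(0)=b_j^0$, then for all $t\in\mathbb R$ and $1\le k\le n$ the quantities $Z_k,W_{k-1},U_k,U_{k-1}$ are positive, one has $x_1(t)<\dots<x_n(t)$ and $m_k(t)>0$, and $\{x_k(t),m_k(t)\}_{k=1}^n$ satisfies the Novikov peakon equations $$\dot x_k=u(x_k)^2,\qquad \dot m_k=-m_k\,u(x_k)\,\langle u_x\rangle(x_k),\qquad u(t,x)=\sum_{j=1}^n m_j(t)e^{-|x-x_j(t)|},$$ where $\langle f\rangle(a)$ is the average of the left and right limits of $f$ at $a$. 2. (Positive flow.) If instead $\zeta_j(t),b_j(t)$, $t\in\mathbb R$, satisfy $\dot\zeta_j=0$, $\dot b_j=\zeta_jb_j$, with the same initial values, then for all $t\in\mathbb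 R$ one has $U_k>0$ for $0\le k\le n$, and $r_k\ne0$ and $s_{k-1}\neq s_k$ for $1\le k\le n$, and $\{r_k(t),s_k(t)\}_{k=1}^n$ satisfies the finite modified B-Toda lattice $$\dot r_k=\frac{r_k(\dot s_{k-1}+\dot s_k)}{s_{k-1}-s_k},\qquad \dot s_k=\frac{r_{k+1}}{r_k}(s_{k-1}-s_{k+1}),\qquad 1\le k\le n,$$ with the boundary conditions $s_0=r_{n+1}=0$ and $r_{n+1}s_{n+1}\ne0$. Here the product $r_{n+1}s_{n+1}$ (with $s_{n+1}$ formally infinite) stands for $V_n/U_n$, in accordance with $r_ks_k=V_{k-1}/U_{k-1}$, so that, when $n\ge1$, the equation for $k=n$ reads $\dot s_n=(r_{n+1}s_{n-1}-V_n/U_n)/r_n$. 3. (Map of initial data.) The values $r_k(0),s_k(0)$ obtained from $(\zeta^0,b^0)$ are given by the following explicit functions of the values $x_j(0),m_j(0)$ obtained from $(\zeta^0,b^0)$: for $1\le k\le n$, $$r_k(0)=\frac{e^{x_n(0)}}{m_n(0)}\prod_{j=1}^{k-1}\frac{1}{2\,m_{j'}(0)\,m_{j'-1}(0)\cosh x_{j'}(0)\cosh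 x_{j'-1}(0)\,\bigl(\tanh x_{j'}(0)-\tanh x_{j'-1}(0)\bigr)},$$ $$s_k(0)=\sum_{j=1}^{k}m_{j'}(0)\,e^{-x_{j'}(0)}.$$ -/

import Mathlib

open scoped Topology

namespace NovikovBToda

noncomputable section

/-! ### Spectral data and the associated sums

The eigenvalues and residues are indexed by `Fin n` (playing the role of `{1, …, n}`); all derived
sequences carry an integer index, so that the conventions `T_k = U_k = V_k = 0` for `k < 0` and
`k > n` hold by definition (there is no subset of that size). -/

/-- `b_I = ∏_{j ∈ I} b_j`. -/
def prodOver {n : ℕ} (b : Fin n → ℝ) (I : Finset (Fin n)) : ℝ :=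
  ∏ j ∈ I, b j

/-- `Δ_I = ∏_{i < j in I} (ζ_j - ζ_i)`. -/
def vdm {n : ℕ} (ζ : Fin n → ℝ) (I : Finset (Fin n)) : ℝ :=
  ∏ i ∈ I, ∏ j ∈ I with i < j, (ζ j - ζ i)

/-- `Γ_I = ∏_{i < j in I} (ζ_j + ζ_i)`. -/
def gam {n : ℕ} (ζ : Fin n → ℝ) (I : Finset (Fin n)) : ℝ :=
  ∏ i ∈ I, ∏ j ∈ I with i < j, (ζ j + ζ i)

/-- `∑_{|I| = k} (Δ_I² / Γ_I) ζ_I^l b_I`, the sum over the `k`-element subsets `I` of the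
index set. -/
def spectralSum {n : ℕ} (l : ℤ) (ζ b : Fin n → ℝ) (k : ℤ) : ℝ :=
  ∑ I : Finset (Fin n) with (I.card : ℤ) = k,
    vdm ζ I ^ 2 / gam ζ I * prodOver ζ I ^ l * prodOver b I

/-- `T_k = ∑_{|I| = k} Δ_I² / (ζ_I Γ_I) b_I`. -/
def T {n : ℕ} (ζ b : Fin n → ℝ) (k : ℤ) : ℝ := spectralSum (-1) ζ b k

/-- `U_k = ∑_{|I| = k} Δ_I² / Γ_I b_I`. -/
def U {n : ℕ} (ζ b : Fin n → ℝ) (k : ℤ) : ℝ := spectralSum 0 ζ b k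

/-- `V_k = ∑_{|I| = k} Δ_I² / Γ_I ζ_I b_I`. -/
def V {n : ℕ} (ζ b : Fin n → ℝ) (k : ℤ) : ℝ := spectralSum 1 ζ b k

/-- `W_k = V_k U_k - V_{k-1} U_{k+1}`. -/
def W {n : ℕ} (ζ b : Fin n → ℝ) (k : ℤ) : ℝ :=
  V ζ b k * U ζ b k - V ζ b (k - 1) * U ζ b (k + 1)

/-- `Z_k = T_k U_k - T_{k+1} U_{k-1}`. -/
def Z {n : ℕ} (ζ b : Fin n → ℝ) (k : ℤ) : ℝ :=
  T ζ b k * U ζ b k - T ζ b (k + 1) * U ζ b (k - 1)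

/-! ### The variables of the two systems -/

/-- The peakon positions: `x_{k'} = (1/2) log (Z_k / W_{k-1})` with `k' = n + 1 - k`. -/
def peakonX {n : ℕ} (ζ b : Fin n → ℝ) (i : ℤ) : ℝ :=
  1 / 2 * Real.log (Z ζ b (n + 1 - i) / W ζ b (n + 1 - i - 1))

/-- The peakon momenta: `m_{k'} = √(Z_k W_{k-1}) / (U_k U_{k-1})` with `k' = n + 1 - k`. -/
def peakonM {n : ℕ} (ζ b : Fin n → ℝ) (i : ℤ) : ℝ :=
  Real.sqrt (Z ζ b (n + 1 - i) * W ζ b (n + 1 - i - 1)) /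
    (U ζ b (n + 1 - i) * U ζ b (n + 1 - i - 1))

/-- `r_k = U_k / U_{k-1}`. -/
def todaR {n : ℕ} (ζ b : Fin n → ℝ) (k : ℤ) : ℝ := U ζ b k / U ζ b (k - 1)

/-- `s_k = V_{k-1} / U_k`. -/
def todaS {n : ℕ} (ζ b : Fin n → ℝ) (k : ℤ) : ℝ := V ζ b (k - 1) / U ζ b k

/-- The boundary product `r_{n+1} s_{n+1}`. From `r_k = U_k / U_{k-1}` and `s_k = V_{k-1} / U_k`
one has `r_k s_k = V_{k-1} / U_{k-1}`; at `k = n + 1`, where `r_{n+1} = 0` and `s_{n+1}` is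
infinite, the product is read in this form. -/
def todaBoundary {n : ℕ} (ζ b : Fin n → ℝ) : ℝ := V ζ b n / U ζ b n

/-! ### The two linear flows on the spectral data -/

/-- `ζ̇_j = 0`, `ḃ_j = b_j / ζ_j`. -/
def IsNegativeFlow {n : ℕ} (ζ b : ℝ → Fin n → ℝ) : Prop :=
  ∀ (t : ℝ) (j : Fin n),
    HasDerivAt (fun τ => ζ τ j) 0 t ∧ HasDerivAt (fun τ => b τ j) (b t j / ζ t j) t

/-- `ζ̇_j = 0`, `ḃ_j = ζ_j b_j`. -/
def IsPositiveFlow {n : ℕ} (ζ b : ℝ → Fin n → ℝ) : Prop :=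
  ∀ (t : ℝ) (j : Fin n),
    HasDerivAt (fun τ => ζ τ j) 0 t ∧ HasDerivAt (fun τ => b τ j) (ζ t j * b t j) t

/-! ### The Novikov peakon equations -/

/-- The multipeakon profile `u(y) = ∑_{k=1}^n m_k e^{-|y - x_k|}`. -/
def peakonProfile (n : ℕ) (x m : ℤ → ℝ) (y : ℝ) : ℝ :=
  ∑ k ∈ Finset.Icc (1 : ℤ) n, m k * Real.exp (-|y - x k|)

/-- `a = ⟨f⟩(p)`: the one-sided limits of `f` at `p` exist and `a` is their average. -/
def IsAverageAt (f : ℝ → ℝ) (p a : ℝ) : Prop :=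
  ∃ l r : ℝ, Filter.Tendsto f (𝓝[<] p) (𝓝 l) ∧ Filter.Tendsto f (𝓝[>] p) (𝓝 r) ∧
    a = (l + r) / 2

/-- The Novikov peakon equations
`ẋ_k = u(x_k)²`, `ṁ_k = - m_k u(x_k) ⟨u_x⟩(x_k)` for `1 ≤ k ≤ n`, at all times. -/
def IsNovikovPeakon (n : ℕ) (x m : ℝ → ℤ → ℝ) : Prop :=
  ∀ t : ℝ, ∀ k ∈ Finset.Icc (1 : ℤ) n,
    HasDerivAt (fun τ => x τ k) (peakonProfile n (x t) (m t) (x t k) ^ 2) t ∧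
    ∃ a : ℝ, IsAverageAt (deriv (peakonProfile n (x t) (m t))) (x t k) a ∧
      HasDerivAt (fun τ => m τ k) (-(m t k) * peakonProfile n (x t) (m t) (x t k) * a) t

/-! ### The finite modified B-Toda lattice -/

/-- The finite modified B-Toda lattice
`ṙ_k = r_k (ṡ_{k-1} + ṡ_k) / (s_{k-1} - s_k)`, `ṡ_k = (r_{k+1} / r_k) (s_{k-1} - s_{k+1})`,
`1 ≤ k ≤ n`, with `s_0 = r_{n+1} = 0` and `r_{n+1} s_{n+1} ≠ 0`. The function `c` is the
(finite, nonzero) value of the product `r_{n+1} s_{n+1}`; it enters only in the equation for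
`ṡ_n`, which reads `ṡ_n = (r_{n+1} s_{n-1} - r_{n+1} s_{n+1}) / r_n`. -/
structure IsModifiedBToda (n : ℕ) (r s : ℝ → ℤ → ℝ) (c : ℝ → ℝ) : Prop where
  s_zero : ∀ t, s t 0 = 0
  r_last : ∀ t, r t (n + 1) = 0
  boundary_ne_zero : ∀ t, c t ≠ 0
  r_ne_zero : ∀ t, ∀ k ∈ Finset.Icc (1 : ℤ) n, r t k ≠ 0
  s_sub_ne_zero : ∀ t, ∀ k ∈ Finset.Icc (1 : ℤ) n, s t (k - 1) - s t k ≠ 0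
  r_eq : ∀ t, ∀ k ∈ Finset.Icc (1 : ℤ) n,
    HasDerivAt (fun τ => r τ k)
      (r t k * (deriv (fun τ => s τ (k - 1)) t + deriv (fun τ => s τ k) t) /
        (s t (k - 1) - s t k)) t
  s_eq : ∀ t, ∀ k ∈ Finset.Icc (1 : ℤ) n, k < n →
    HasDerivAt (fun τ => s τ k) (r t (k + 1) / r t k * (s t (k - 1) - s t (k + 1))) t
  s_last_eq : ∀ t, 1 ≤ n →
    HasDerivAt (fun τ => s τ n) ((r t (n + 1) * s t (n - 1) - c t) / r t n) t

/-! ### The map from peakon data to lattice data -/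

/-- `e^{x_n} / m_n * ∏_{j=1}^{k-1}
1 / (2 m_{j'} m_{j'-1} cosh x_{j'} cosh x_{j'-1} (tanh x_{j'} - tanh x_{j'-1}))`,
with `j' = n + 1 - j`. -/
def rMap (n : ℕ) (x m : ℤ → ℝ) (k : ℤ) : ℝ :=
  Real.exp (x n) / m n *
    ∏ j ∈ Finset.Icc (1 : ℤ) (k - 1),
      1 / (2 * m (n + 1 - j) * m (n + 1 - j - 1) *
        Real.cosh (x (n + 1 - j)) * Real.cosh (x (n + 1 - j - 1)) *
        (Real.tanh (x (n + 1 - j)) - Real.tanh (x (n + 1 - j - 1))))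

/-- `∑_{j=1}^k m_{j'} e^{-x_{j'}}`, with `j' = n + 1 - j`. -/
def sMap (n : ℕ) (x m : ℤ → ℝ) (k : ℤ) : ℝ :=
  ∑ j ∈ Finset.Icc (1 : ℤ) k, m (n + 1 - j) * Real.exp (-x (n + 1 - j))

end

end NovikovBToda

/-!
Everything rests on one bilinear form. Put `ε(x, y) = (y - x) / (y + x)`. For functions
`Φ_1, …, Φ_m` on the spectrum let `[Φ_1, …, Φ_m] = ∑_p ∏ Φ_i(p_i) ∏_{i<j} ε(ζ_{p_i}, ζ_{p_j})`
(`bracket`). By Schur's identity `∏_{i<j} ε(q_i, q_j)` is a Pfaffian, so that brackets expand along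
their first entry like Pfaffians (`schurProd_cons_expand`, `bracket_cons_expand`); and that of
`b ζ^a, …, b ζ^(a+m-1)` is `∑_{|I|=m} Δ_I² / Γ_I ζ_I^a b_I` (`bracket_consec`). Thus `T_k`, `U_k`,
`V_k` are Pfaffians.

The matrix with entries `(mass x * mass y + skewForm x y) / 2` is a skew matrix plus a matrix of
rank one. Its minors with (almost) equal row and column sets are therefore quadratic in the brackets
(`minor_cons_cons`, `massMinor_cons_cons_cons`). For the functions `b ζ^a` its entries are the
bimoments `I_{a,c} = ∑ b_p b_q ζ_p^a ζ_q^c / (ζ_p + ζ_q)` of the Cauchy kernel. Hence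
`W_m = 2^m det (I_{1+i,1+j})`, `Z_m = 2^m det (I_{i,j})` and `U_m² = 2^m det (I_{i,1+j})`, and
several bordered bimoment determinants have similar expressions.

*Positivity and order.* The Cauchy kernel is positive semidefinite, so `W_m, Z_m ≥ 0`. The
Desnanot–Jacobi identity reads `Z_{m+1} W_{m+1} - Z_{m+2} W_m = U_{m+1}⁴` (`Z_mul_W_sub`). As
`U_{m+1} > 0`, it makes `W_m` and `Z_m` positive and the positions `x_k` increasing.

*Dynamics.* Under either flow `I_{a,c}` has a derivative of rank one in `(a, c)`: with moments
`α_a = ∑ b_p ζ_p^a` it is `α_{a-1} α_{c-1}` for the negative and `α_a α_c` for the positive flow,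
because `I_{a+1,c} + I_{a,c+1} = α_a α_c`. The derivative of a Schur complement is then a product of
two Schur complements (`hasDerivAt_schurCompl`), that is, of two bordered determinants over `W_m²`.
This gives the derivatives of `Z_{m+1} / W_m` and `U_{m+1} U_m / W_m` under the negative flow, and
of `U_{m+1}² / W_m` and `U_m² / W_m` under the positive flow. These quotients determine the
positions and momenta of the peakons, respectively `r_{m+1}` and `s_{m+1} - s_m`.

*Closing the systems.* Since `m e^{-x}` and `m e^x` are the increments of `V_{m-1} / U_m` and
`-T_{m+1} / U_m`, the sums that give `u` and `⟨u_x⟩` at a peakon, and `s_k` as a function of the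
peakon data, telescope. The formula for `r_k` follows from the relation between `Z` and `W` above.
-/

namespace NovikovBToda

open Finset

/-! ### Moving an entry of a tuple to the front -/

/-- Moving the `j`-th entry of a tuple to the front is precomposition with a cycle. -/
lemma cons_succAbove_eq_comp_cycleRange {α : Type*} {m : ℕ} (q : Fin (m + 1) → α)
    (j : Fin (m + 1)) :
    (Fin.cons (q j) (fun i => q (j.succAbove i)) : Fin (m + 1) → α) =
      fun i => q (j.cycleRange.symm i) := by
  funext i
  refine Fin.cases ?_ (fun i => ?_) i
  · simp
  · simp [Fin.cycleRange_symm_succ]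

lemma sign_cycleRange_symm {m : ℕ} (j : Fin (m + 1)) :
    ((Equiv.Perm.sign j.cycleRange.symm : ℤˣ) : ℝ) = (-1) ^ (j : ℕ) := by
  rw [Equiv.Perm.sign_symm, Fin.sign_cycleRange]; simp

lemma neg_one_pow_mul_self (m : ℕ) : ((-1 : ℝ) ^ m) * (-1) ^ m = 1 := by rw [← mul_pow]; simp

lemma cons_cons_succAbove_succ {α : Type*} {m : ℕ} (y : α) (S : Fin (m + 1) → α)
    (j : Fin (m + 1)) :
    (fun i => (Fin.cons y S : Fin (m + 2) → α) (j.succ.succAbove i)) =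
      Fin.cons y (fun i => S (j.succAbove i)) := by
  funext i
  refine Fin.cases ?_ (fun i => ?_) i
  · simp
  · rw [Fin.succ_succAbove_succ]; simp

/-! ### The Schur product and its expansion -/

/-- The factor `ε(x, y) = (y - x) / (y + x)`. -/
noncomputable def schurFactor (x y : ℝ) : ℝ := (y - x) / (y + x)

/-- The product `∏_{i < j} (q_j - q_i) / (q_j + q_i)`, which by Schur's identity is the Pfaffian of
the factors. -/
noncomputable def schurProd {m : ℕ} (q : Fin m → ℝ) : ℝ :=
  ∏ i, ∏ j ∈ Ioi i, schurFactor (q i) (q j)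

lemma schurFactor_antisymm (x y : ℝ) : schurFactor x y = -schurFactor y x := by
  unfold schurFactor; rw [← neg_div, neg_sub, add_comm]

lemma schurFactor_self (x : ℝ) : schurFactor x x = 0 := by simp [schurFactor]

lemma schurProd_comp_perm {m : ℕ} (q : Fin m → ℝ) (π : Equiv.Perm (Fin m)) :
    schurProd (fun i => q (π i)) = (Equiv.Perm.sign π : ℤˣ) * schurProd q :=
  Equiv.Perm.prod_Ioi_comp_eq_sign_mul_prod (f := fun i j => schurFactor (q i) (q j)) π
    fun _ _ => schurFactor_antisymm _ _

lemma schurProd_cons {m : ℕ} (p : ℝ) (q : Fin m → ℝ) :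
    schurProd (Fin.cons p q : Fin (m + 1) → ℝ) = (∏ j, schurFactor p (q j)) * schurProd q := by
  simp [schurProd, Fin.prod_univ_succ, Fin.prod_Ioi_succ]

lemma schurProd_cons_zero {m : ℕ} (q : Fin m → ℝ) (hq : ∀ i, 0 < q i) :
    schurProd (Fin.cons 0 q : Fin (m + 1) → ℝ) = schurProd q := by
  rw [schurProd_cons, prod_eq_one, one_mul]
  intro i _
  have := (hq i).ne'
  simp [schurFactor, this]

lemma schurProd_eq_zero {m : ℕ} {q : Fin m → ℝ} {i j : Fin m} (hij : i ≠ j) (h : q i = q j) :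
    schurProd q = 0 := by
  wlog hlt : i < j generalizing i j
  · exact this hij.symm h.symm (lt_of_le_of_ne (not_lt.mp hlt) hij.symm)
  exact prod_eq_zero (mem_univ i) (prod_eq_zero (mem_Ioi.mpr hlt) (by rw [h, schurFactor_self]))

lemma schurProd_eq_front {m : ℕ} (q : Fin (m + 1) → ℝ) (j : Fin (m + 1)) :
    schurProd q = (-1) ^ (j : ℕ) * ((∏ i, schurFactor (q j) (q (j.succAbove i))) *
      schurProd fun i => q (j.succAbove i)) := by
  have h := schurProd_cons (q j) fun i => q (j.succAbove i)
  rw [cons_succAbove_eq_comp_cycleRange, schurProd_comp_perm, sign_cycleRange_symm] at h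
  rw [← h, ← mul_assoc, ← mul_pow]; simp

lemma prod_erase_some {ι : Type*} [Fintype ι] [DecidableEq ι] (f : Option ι → ℝ) (x : ι) :
    ∏ i ∈ univ.erase (some x), f i = f none * ∏ i ∈ univ.erase x, f (some i) := by
  have h : univ.erase (some x) = insert none ((univ.erase x).map Function.Embedding.some) := by
    ext i; cases i <;> simp
  rw [h, prod_insert (by simp), prod_map]; rfl

lemma prod_erase_none {ι : Type*} [Fintype ι] [DecidableEq ι] (f : Option ι → ℝ) :
    ∏ i ∈ univ.erase none, f i = ∏ i, f (some i) := by
  have h : univ.erase none = (univ : Finset ι).map Function.Embedding.some := by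
    ext i; cases i <;> simp
  rw [h, prod_map]; rfl

/-- The partial fraction identity behind Schur's expansion: the leading coefficient of
`(z - p) ∏ (z + q_i)` computed by Lagrange interpolation at the nodes `0`, `-p` and `q_j`. -/
lemma sum_schurFactor_mul_prod {m : ℕ} (hm : Odd m) (p : ℝ) (hp : 0 < p) (q : Fin m → ℝ)
    (hq : ∀ i, 0 < q i) (hinj : Function.Injective q) :
    ∑ j, schurFactor p (q j) * ∏ i ∈ univ.erase j, (q j + q i) / (q j - q i) =
      ∏ j, schurFactor p (q j) := by
  classical
  set v : Option (Option (Fin m)) → ℝ := fun o => o.elim 0 fun o' => o'.elim (-p) q with hv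
  set P : Polynomial ℝ := (Polynomial.X - Polynomial.C p) *
    ∏ i, (Polynomial.X + Polynomial.C (q i)) with hP
  have hvinj : Set.InjOn v (univ : Finset (Option (Option (Fin m)))) := by
    rintro (_ | _ | i) _ (_ | _ | j) _ h <;> simp only [hv, Option.elim] at h
    · rfl
    · linarith
    · linarith [hq j]
    · linarith
    · rfl
    · linarith [hq j]
    · linarith [hq i]
    · linarith [hq i]
    · rw [hinj h]
  have hmonic : (∏ i, (Polynomial.X + Polynomial.C (q i))).Monic :=
    Polynomial.monic_prod_of_monic _ _ fun i _ => Polynomial.monic_X_add_C _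
  have hdeg : P.degree = (m + 1 : ℕ) := by
    rw [hP, Polynomial.degree_mul, Polynomial.degree_X_sub_C, Polynomial.degree_prod]
    simp [add_comm]
  have hlead : P.leadingCoeff = 1 := by
    rw [hP, Polynomial.leadingCoeff_mul, hmonic.leadingCoeff,
      (Polynomial.monic_X_sub_C p).leadingCoeff, one_mul]
  have key := Lagrange.leadingCoeff_eq_sum hvinj (P := P) (by rw [hdeg]; simp)
  rw [hlead] at key
  simp only [Fintype.sum_option, prod_erase_some, prod_erase_none, Fintype.prod_option] at key
  have ev : ∀ z, P.eval z = (z - p) * ∏ i, (z + q i) := by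
    intro z; simp [hP, Polynomial.eval_prod]
  simp only [ev, hv, Option.elim] at key
  have h0 : ((0 : ℝ) - p) * ∏ i, (0 + q i) = p * ∏ i, (0 - q i) := by
    have : ∏ i, (0 - q i) = -∏ i, q i := by
      simp only [zero_sub, prod_neg]
      simp [hm.neg_one_pow]
    rw [this]; simp
  have hqprod : ∏ i, (0 - q i) ≠ 0 :=
    prod_ne_zero_iff.mpr fun i _ => by have := hq i; simp; linarith
  have hpprod : ∏ i, (-p - q i) = -∏ i, (q i + p) := by
    have : ∀ i, -p - q i = -(q i + p) := fun i => by ring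
    simp only [this, prod_neg]
    simp [hm.neg_one_pow]
  have hpprod0 : ∏ i, (q i + p) ≠ 0 :=
    prod_ne_zero_iff.mpr fun i _ => by have := hq i; linarith
  have e1 : (0 - p) * ∏ i, (0 + q i) = (0 - -p) * ∏ i, (0 - q i) := by rw [h0]; ring
  have t1 : ((0 - p) * ∏ i, (0 + q i)) / ((0 - -p) * ∏ i, (0 - q i)) = 1 := by
    rw [e1, div_self]
    exact mul_ne_zero (by linarith) hqprod
  have t2 : ((-p - p) * ∏ i, (-p + q i)) / ((-p - 0) * ∏ i, (-p - q i)) =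
      -2 * ∏ j, schurFactor p (q j) := by
    rw [hpprod]
    simp only [schurFactor, prod_div_distrib]
    have : ∏ i, (-p + q i) = ∏ i, (q i - p) := prod_congr rfl fun i _ => by ring
    rw [this, show (-p - 0) * -∏ i, (q i + p) = p * ∏ i, (q i + p) by ring]
    have := hp.ne'
    field_simp
    ring
  have t3 : ∀ j, ((q j - p) * ∏ i, (q j + q i)) /
      ((q j - 0) * ((q j - -p) * ∏ i ∈ univ.erase j, (q j - q i))) =
      2 * (schurFactor p (q j) * ∏ i ∈ univ.erase j, (q j + q i) / (q j - q i)) := by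
    intro j
    have hj := (hq j).ne'
    have hj' := hq j
    have : ∏ i ∈ univ.erase j, (q j - q i) ≠ 0 :=
      prod_ne_zero_iff.mpr fun i hi => sub_ne_zero.mpr fun h => (ne_of_mem_erase hi) (hinj h.symm)
    rw [← mul_prod_erase univ (fun i => q j + q i) (mem_univ j), prod_div_distrib, schurFactor]
    have : q j + p ≠ 0 := by linarith
    have : q j - -p ≠ 0 := by linarith
    field_simp
    ring
  rw [t1, t2, sum_congr rfl fun j _ => t3 j, ← mul_sum] at key
  linarith

lemma prod_succAbove_eq_prod_erase {m : ℕ} (j : Fin (m + 1)) (f : Fin (m + 1) → ℝ) :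
    ∏ i, f (j.succAbove i) = ∏ i ∈ univ.erase j, f i := by
  refine (prod_map univ j.succAboveEmb f).symm.trans ?_
  congr 1
  ext i
  simp [Fin.exists_succAbove_eq_iff]

lemma schurProd_cons_of_injective {m : ℕ} (hm : Odd (m + 1)) (p : ℝ) (hp : 0 < p)
    (q : Fin (m + 1) → ℝ) (hq : ∀ i, 0 < q i) (hinj : Function.Injective q) :
    schurProd (Fin.cons p q : Fin (m + 2) → ℝ) =
      ∑ j : Fin (m + 1),
        (-1) ^ (j : ℕ) * schurFactor p (q j) * schurProd fun i => q (j.succAbove i) := by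
  rw [schurProd_cons, ← sum_schurFactor_mul_prod hm p hp q hq hinj, sum_mul]
  refine sum_congr rfl fun j _ => ?_
  rw [schurProd_eq_front q j, ← prod_succAbove_eq_prod_erase]
  have h1 : (∏ i, (q j + q (j.succAbove i)) / (q j - q (j.succAbove i))) *
      ∏ i, schurFactor (q j) (q (j.succAbove i)) = 1 := by
    rw [← prod_mul_distrib]
    have : ∀ i, (q j + q (j.succAbove i)) / (q j - q (j.succAbove i)) *
        schurFactor (q j) (q (j.succAbove i)) = -1 := by
      intro i
      have h1 : q j - q (j.succAbove i) ≠ 0 :=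
        sub_ne_zero.mpr fun h => Fin.succAbove_ne j i (hinj h).symm
      have h2 : q (j.succAbove i) + q j ≠ 0 := by
        have := hq j; have := hq (j.succAbove i); linarith
      rw [schurFactor]
      field_simp
      ring
    simp only [this, prod_const, card_univ, Fintype.card_fin]
    exact Even.neg_one_pow (by rcases hm with ⟨a, ha⟩; exact ⟨a, by omega⟩)
  linear_combination ((-1) ^ (j : ℕ) * schurFactor p (q j) * schurProd fun i =>
    q (j.succAbove i)) * h1

lemma schurFactor_continuousAt {f g : ℝ → ℝ} {a : ℝ} (hf : ContinuousAt f a)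
    (hg : ContinuousAt g a) (h : 0 < g a + f a) :
    ContinuousAt (fun t => schurFactor (f t) (g t)) a :=
  (hg.sub hf).div (hg.add hf) h.ne'

lemma schurProd_continuousAt {m : ℕ} {q : ℝ → Fin m → ℝ} {a : ℝ}
    (hq : ∀ i, ContinuousAt (fun t => q t i) a) (hpos : ∀ i j, i ≠ j → 0 < q a i + q a j) :
    ContinuousAt (fun t => schurProd (q t)) a := by
  unfold schurProd
  refine tendsto_finsetProd _ fun i _ => tendsto_finsetProd _ fun j hj => ?_
  exact schurFactor_continuousAt (hq i) (hq j) (hpos j i (mem_Ioi.mp hj).ne')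

/-- Coinciding or vanishing entries are reached from distinct positive ones by a limit. -/
lemma schurProd_cons_of_odd {m : ℕ} (hm : Odd (m + 1)) (p : ℝ) (hp : 0 ≤ p)
    (q : Fin (m + 1) → ℝ) (hq : ∀ i, 0 ≤ q i) (hpq : ∀ i, 0 < p + q i)
    (hqq : ∀ i j, i ≠ j → 0 < q i + q j) :
    schurProd (Fin.cons p q : Fin (m + 2) → ℝ) =
      ∑ j : Fin (m + 1),
        (-1) ^ (j : ℕ) * schurFactor p (q j) * schurProd fun i => q (j.succAbove i) := by
  set P : ℝ → ℝ := fun t => p + t with hP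
  set Q : ℝ → Fin (m + 1) → ℝ := fun t i => q i + t * ((i : ℕ) + 1 : ℝ) with hQ
  set F : ℝ → ℝ := fun t => (∏ j, schurFactor (P t) (Q t j)) * schurProd (Q t) -
    ∑ j : Fin (m + 1), (-1) ^ (j : ℕ) * schurFactor (P t) (Q t j) *
      schurProd fun i => Q t (j.succAbove i) with hF
  have hPc : ContinuousAt P 0 := by fun_prop
  have hQc : ∀ i, ContinuousAt (fun t => Q t i) 0 := fun i => by fun_prop
  have hP0 : P 0 = p := by simp [hP]
  have hQ0 : Q 0 = q := by funext i; simp [hQ]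
  have hpq' : ∀ j, 0 < Q 0 j + P 0 := fun j => by rw [hP0, hQ0, add_comm]; exact hpq j
  have hcont : ContinuousAt F 0 := by
    refine ContinuousAt.sub (ContinuousAt.mul ?_ ?_) ?_
    · exact tendsto_finsetProd _ fun j _ => schurFactor_continuousAt hPc (hQc j) (hpq' j)
    · exact schurProd_continuousAt hQc (by rw [hQ0]; exact hqq)
    · refine tendsto_finsetSum _ fun j _ => ?_
      refine ContinuousAt.mul (continuousAt_const.mul
        (schurFactor_continuousAt hPc (hQc j) (hpq' j))) ?_
      refine schurProd_continuousAt (fun i => hQc _) fun i k hik => ?_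
      rw [hQ0]; exact hqq _ _ fun h => hik (Fin.succAbove_right_injective h)
  have hdist : ∀ᶠ t in 𝓝[>] (0 : ℝ), Function.Injective (Q t) := by
    have : ∀ i j, i ≠ j → ∀ᶠ t in 𝓝[>] (0 : ℝ), Q t i ≠ Q t j := by
      intro i j hij
      by_cases h : q i = q j
      · filter_upwards [self_mem_nhdsWithin] with t ht heq
        simp only [hQ, h] at heq
        have h1 : t * (((i : ℕ) : ℝ) - ((j : ℕ) : ℝ)) = 0 := by linarith
        rcases mul_eq_zero.mp h1 with h2 | h2
        · exact (ne_of_gt ht) h2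
        · exact hij (Fin.ext (by exact_mod_cast sub_eq_zero.mp h2))
      · refine Filter.Eventually.filter_mono nhdsWithin_le_nhds ?_
        refine ((hQc i).sub (hQc j)).eventually_ne (y := 0) ?_ |>.mono fun t ht => sub_ne_zero.mp ht
        change Q 0 i - Q 0 j ≠ 0
        rw [hQ0]; exact sub_ne_zero.mpr h
    have h2 : ∀ᶠ t in 𝓝[>] (0 : ℝ), ∀ i j, i ≠ j → Q t i ≠ Q t j :=
      Filter.eventually_all.mpr fun i => Filter.eventually_all.mpr fun j => by
        by_cases hij : i = j
        · simp [hij]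
        · filter_upwards [this i j hij] with t ht _ using ht
    filter_upwards [h2] with t ht i j hij
    by_contra hne
    exact ht i j hne hij
  have hzero : ∀ᶠ t in 𝓝[>] (0 : ℝ), F t = 0 := by
    filter_upwards [hdist, self_mem_nhdsWithin] with t hinj ht
    have ht : 0 < t := ht
    have := schurProd_cons_of_injective hm (P t) (by simp only [hP]; linarith) (Q t)
      (fun i => by simp only [hQ]; have := hq i; positivity) hinj
    rw [schurProd_cons] at this
    simp only [hF, this, sub_self]
  have hlim : F 0 = 0 :=
    tendsto_nhds_unique (hcont.tendsto.mono_left nhdsWithin_le_nhds)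
      ((Filter.tendsto_congr' hzero).mpr tendsto_const_nhds)
  simp only [hF, hP0, hQ0] at hlim
  rw [schurProd_cons]
  linarith

/-- Expansion of the Schur product along its first entry, for any parity. The even case is the odd
one with an additional entry `0`. -/
lemma schurProd_cons_expand {m : ℕ} (p : ℝ) (hp : 0 ≤ p) (q : Fin (m + 1) → ℝ)
    (hq : ∀ i, 0 < q i) :
    schurProd (Fin.cons p q : Fin (m + 2) → ℝ) =
      (∑ j : Fin (m + 1), (-1) ^ (j : ℕ) * schurFactor p (q j) *
        schurProd fun i => q (j.succAbove i)) +
        if Even (m + 1) then schurProd q else 0 := by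
  have hp' : ∀ i, 0 < p + q i := fun i => by linarith [hq i]
  have hqq : ∀ i j, i ≠ j → 0 < q i + q j := fun i j _ => by linarith [hq i, hq j]
  split_ifs with hm
  swap
  · rw [add_zero]
    exact schurProd_cons_of_odd (Nat.not_even_iff_odd.mp hm) p hp q (fun i => (hq i).le) hp' hqq
  have hpos : ∀ p : ℝ, 0 < p → schurProd (Fin.cons p q : Fin (m + 2) → ℝ) =
      (∑ j : Fin (m + 1), (-1) ^ (j : ℕ) * schurFactor p (q j) *
        schurProd fun i => q (j.succAbove i)) + schurProd q := by
    intro p hp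
    have hp' : ∀ i, 0 < p + q i := fun i => by linarith [hq i]
    have hodd := schurProd_cons_of_odd (m := m + 1) hm.add_one p hp.le
      (Fin.cons 0 q) (fun i => Fin.cases (by simp) (fun i => by simpa using (hq i).le) i)
      (fun i => Fin.cases (by simpa using hp) (fun i => by simpa using hp' i) i)
      (fun i j => Fin.cases (Fin.cases (by simp) (fun j _ => by simpa using hq j) j)
        (fun i => Fin.cases (fun _ => by simpa using hq i)
          (fun j h => by simpa using by linarith [hq i, hq j]) j) i)
    have h0 : schurFactor p 0 = -1 := by
      simp [schurFactor, hp.ne']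
    rw [schurProd_cons, Fin.prod_univ_succ, Fin.sum_univ_succ] at hodd
    simp only [Fin.cons_zero, Fin.cons_succ, h0, schurProd_cons_zero q hq, cons_cons_succAbove_succ,
      Fin.zero_succAbove, Fin.val_zero, Fin.val_succ, pow_zero, one_mul] at hodd
    rw [schurProd_cons]
    have h2 : ∀ j : Fin (m + 1), schurProd (Fin.cons 0 fun i => q (j.succAbove i) :
        Fin (m + 1) → ℝ) = schurProd fun i => q (j.succAbove i) := fun j =>
      schurProd_cons_zero _ fun i => hq _
    simp only [h2, pow_succ] at hodd
    simp only [mul_neg, mul_one, neg_mul, sum_neg_distrib, one_mul] at hodd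
    linarith
  rcases hp.eq_or_lt with rfl | hp
  swap
  · exact hpos p hp
  -- both sides are continuous in `p` at `0`
  have hc : ∀ j, ContinuousAt (fun t => schurFactor t (q j)) 0 := fun j =>
    schurFactor_continuousAt continuousAt_id continuousAt_const (by simpa using hq j)
  have hl : ContinuousAt (fun t => (∏ j, schurFactor t (q j)) * schurProd q) 0 :=
    ContinuousAt.mul (tendsto_finsetProd _ fun j _ => hc j) continuousAt_const
  have hr : ContinuousAt (fun t => (∑ j : Fin (m + 1), (-1) ^ (j : ℕ) * schurFactor t (q j) *
      schurProd fun i => q (j.succAbove i)) + schurProd q) 0 :=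
    ContinuousAt.add (tendsto_finsetSum _ fun j _ =>
      (continuousAt_const.mul (hc j)).mul continuousAt_const) continuousAt_const
  rw [schurProd_cons]
  refine tendsto_nhds_unique (hl.tendsto.mono_left (nhdsWithin_le_nhds (s := Set.Ioi 0)))
    ((hr.tendsto.mono_left nhdsWithin_le_nhds).congr' ?_)
  filter_upwards [self_mem_nhdsWithin] with t ht
  rw [← hpos t ht, schurProd_cons]

/-- The alternating sum of the Schur products with one entry removed; this is the expansion
along an additional entry `0`. -/
lemma sum_schurProd_succAbove {m : ℕ} (q : Fin (m + 1) → ℝ) (hq : ∀ i, 0 < q i) :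
    ∑ j : Fin (m + 1), (-1) ^ (j : ℕ) * schurProd (fun i => q (j.succAbove i)) =
      if Even (m + 1) then 0 else schurProd q := by
  have h := schurProd_cons_expand 0 le_rfl q hq
  have h1 : ∀ j, schurFactor 0 (q j) = 1 := fun j => by
    have := (hq j).ne'; simp [schurFactor, this]
  simp only [schurProd_cons_zero q hq, h1, mul_one] at h
  split_ifs at h ⊢ <;> linarith

/-! ### Brackets -/

section Bracket

variable {ι : Type*} [Fintype ι]

/-- The bracket `[Φ_1, …, Φ_m] = ∑_p ∏_i Φ_i(p_i) ∏_{i < j} ε(ζ_{p_i}, ζ_{p_j})` of functions on the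
spectrum. It is a (bordered, for odd `m`) Pfaffian of the values `skewForm` and `mass`. -/
noncomputable def bracket (ζ : ι → ℝ) {m : ℕ} (Φ : Fin m → ι → ℝ) : ℝ :=
  ∑ p : Fin m → ι, (∏ i, Φ i (p i)) * schurProd fun i => ζ (p i)

/-- The sum of the values of a function on the spectrum. -/
def mass (x : ι → ℝ) : ℝ := ∑ p, x p

/-- The skew form `∑_{p, q} x_p y_q ε(ζ_p, ζ_q)`. -/
noncomputable def skewForm (ζ x y : ι → ℝ) : ℝ :=
  ∑ p, ∑ q, x p * y q * schurFactor (ζ p) (ζ q)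

/-- The bilinear form whose skew part is half of `skewForm` and whose symmetric part is the rank
one form `mass x * mass y / 2`. -/
noncomputable def pairing (ζ x y : ι → ℝ) : ℝ := (mass x * mass y + skewForm ζ x y) / 2

lemma skewForm_antisymm (ζ x y : ι → ℝ) : skewForm ζ x y = -skewForm ζ y x := by
  unfold skewForm
  rw [sum_comm, ← sum_neg_distrib]
  refine sum_congr rfl fun p _ => ?_
  rw [← sum_neg_distrib]
  refine sum_congr rfl fun q _ => ?_
  rw [schurFactor_antisymm (ζ q)]; ring

lemma sum_fin_succ_fun [DecidableEq ι] {m : ℕ} (F : (Fin (m + 1) → ι) → ℝ) :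
    ∑ p, F p = ∑ a, ∑ q : Fin m → ι, F (Fin.cons a q) := by
  rw [← (Fin.consEquiv fun _ : Fin (m + 1) => ι).sum_comp, Fintype.sum_prod_type]
  rfl

lemma sum_fin_insertNth [DecidableEq ι] {m : ℕ} (j : Fin (m + 1)) (F : (Fin (m + 1) → ι) → ℝ) :
    ∑ p, F p = ∑ a, ∑ q : Fin m → ι, F (j.insertNth (α := fun _ => ι) a q) := by
  rw [← (Fin.insertNthEquiv (fun _ : Fin (m + 1) => ι) j).sum_comp, Fintype.sum_prod_type]
  rfl

lemma bracket_zero (ζ : ι → ℝ) (Φ : Fin 0 → ι → ℝ) : bracket ζ Φ = 1 := by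
  simp [bracket, schurProd]

lemma bracket_comp_perm (ζ : ι → ℝ) {m : ℕ} (Φ : Fin m → ι → ℝ) (π : Equiv.Perm (Fin m)) :
    bracket ζ (fun i => Φ (π i)) = (Equiv.Perm.sign π : ℤˣ) * bracket ζ Φ := by
  classical
  unfold bracket
  rw [← (Equiv.arrowCongr π.symm (Equiv.refl ι)).sum_comp, mul_sum]
  refine sum_congr rfl fun p _ => ?_
  have h1 := schurProd_comp_perm (fun i => ζ (p i)) π
  have h2 := Equiv.prod_comp π fun i => Φ i (p i)
  simp only [Equiv.arrowCongr_apply, Equiv.coe_refl, Equiv.symm_symm, Function.comp, id] at *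
  rw [h1, h2]; ring

/-- A bracket is linear in its first entry, which acts on the others by the factors `ε`. -/
lemma bracket_cons (ζ : ι → ℝ) {m : ℕ} (x : ι → ℝ) (Φ : Fin m → ι → ℝ) :
    bracket ζ (Fin.cons x Φ : Fin (m + 1) → ι → ℝ) =
      ∑ a, x a * bracket ζ fun i p => Φ i p * schurFactor (ζ a) (ζ p) := by
  classical
  unfold bracket
  rw [sum_fin_succ_fun]
  refine sum_congr rfl fun a _ => ?_
  rw [mul_sum]
  refine sum_congr rfl fun q _ => ?_
  have : (fun i => ζ ((Fin.cons a q : Fin (m + 1) → ι) i)) = Fin.cons (ζ a) fun i => ζ (q i) := by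
    funext i; refine Fin.cases ?_ (fun i => ?_) i <;> simp
  rw [this, schurProd_cons, Fin.prod_univ_succ]
  simp only [Fin.cons_zero, Fin.cons_succ, prod_mul_distrib]
  ring

lemma bracket_cons_cons_swap (ζ : ι → ℝ) {m : ℕ} (x y : ι → ℝ) (Φ : Fin m → ι → ℝ) :
    bracket ζ (Fin.cons x (Fin.cons y Φ : Fin (m + 1) → ι → ℝ) : Fin (m + 2) → ι → ℝ) =
      -bracket ζ (Fin.cons y (Fin.cons x Φ : Fin (m + 1) → ι → ℝ) : Fin (m + 2) → ι → ℝ) := by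
  have key : ∀ x y : ι → ℝ,
      bracket ζ (Fin.cons x (Fin.cons y Φ : Fin (m + 1) → ι → ℝ) : Fin (m + 2) → ι → ℝ) =
      ∑ a, ∑ b, x a * y b * schurFactor (ζ a) (ζ b) * bracket ζ fun i p =>
        Φ i p * (schurFactor (ζ a) (ζ p) * schurFactor (ζ b) (ζ p)) := by
    intro x y
    rw [bracket_cons]
    refine sum_congr rfl fun a _ => ?_
    have : (fun (i : Fin (m + 1)) p => (Fin.cons y Φ : Fin (m + 1) → ι → ℝ) i p *
        schurFactor (ζ a) (ζ p)) = Fin.cons (fun p => y p * schurFactor (ζ a) (ζ p))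
          fun i p => Φ i p * schurFactor (ζ a) (ζ p) := by
      funext i; refine Fin.cases ?_ (fun i => ?_) i <;> simp
    rw [this, bracket_cons, mul_sum]
    refine sum_congr rfl fun b _ => ?_
    simp only [mul_assoc]
  rw [key, key, sum_comm, ← sum_neg_distrib]
  refine sum_congr rfl fun a _ => ?_
  rw [← sum_neg_distrib]
  refine sum_congr rfl fun b _ => ?_
  rw [schurFactor_antisymm (ζ b)]
  simp only [mul_comm (schurFactor (ζ b) _)]
  ring

lemma bracket_cons_cons_self (ζ : ι → ℝ) {m : ℕ} (x : ι → ℝ) (Φ : Fin m → ι → ℝ) :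
    bracket ζ (Fin.cons x (Fin.cons x Φ : Fin (m + 1) → ι → ℝ) : Fin (m + 2) → ι → ℝ) = 0 := by
  linarith [bracket_cons_cons_swap ζ x x Φ]

lemma bracket_front (ζ : ι → ℝ) {m : ℕ} (S : Fin (m + 1) → ι → ℝ) (j : Fin (m + 1)) :
    bracket ζ (Fin.cons (S j) (fun i => S (j.succAbove i)) : Fin (m + 1) → ι → ℝ) =
      (-1) ^ (j : ℕ) * bracket ζ S := by
  rw [cons_succAbove_eq_comp_cycleRange, bracket_comp_perm, sign_cycleRange_symm]

/-- A linear relation between brackets that persists under multiplication of all entries by a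
function persists under addition of a first entry. -/
lemma bracket_cons_congr (ζ : ι → ℝ) {m : ℕ} (c : ℝ) (Φ Ψ : Fin m → ι → ℝ) (x : ι → ℝ)
    (h : ∀ w : ι → ℝ, bracket ζ (fun i p => Φ i p * w p) = c * bracket ζ fun i p => Ψ i p * w p) :
    bracket ζ (Fin.cons x Φ : Fin (m + 1) → ι → ℝ) =
      c * bracket ζ (Fin.cons x Ψ : Fin (m + 1) → ι → ℝ) := by
  rw [bracket_cons, bracket_cons, mul_sum]
  refine sum_congr rfl fun a _ => ?_
  rw [h]; ring

lemma bracket_front_mul (ζ : ι → ℝ) {m : ℕ} (S : Fin (m + 1) → ι → ℝ) (j : Fin (m + 1))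
    (w : ι → ℝ) :
    bracket ζ (fun i p => (Fin.cons (S j) (fun i => S (j.succAbove i)) : Fin (m + 1) → ι → ℝ) i p *
      w p) = (-1) ^ (j : ℕ) * bracket ζ fun i p => S i p * w p := by
  rw [← bracket_front]
  congr 1
  funext i; refine Fin.cases ?_ (fun i => ?_) i <;> simp

lemma bracket_cons_front (ζ : ι → ℝ) {m : ℕ} (x : ι → ℝ) (S : Fin (m + 1) → ι → ℝ)
    (j : Fin (m + 1)) :
    bracket ζ (Fin.cons x (Fin.cons (S j) (fun i => S (j.succAbove i)) : Fin (m + 1) → ι → ℝ) :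
      Fin (m + 2) → ι → ℝ) =
      (-1) ^ (j : ℕ) * bracket ζ (Fin.cons x S : Fin (m + 2) → ι → ℝ) :=
  bracket_cons_congr ζ _ _ _ x (bracket_front_mul ζ S j)

lemma bracket_cons_cons_front (ζ : ι → ℝ) {m : ℕ} (x y : ι → ℝ) (S : Fin (m + 1) → ι → ℝ)
    (j : Fin (m + 1)) :
    bracket ζ (Fin.cons x (Fin.cons y (Fin.cons (S j) (fun i => S (j.succAbove i)) :
      Fin (m + 1) → ι → ℝ) : Fin (m + 2) → ι → ℝ) : Fin (m + 3) → ι → ℝ) =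
      (-1) ^ (j : ℕ) *
        bracket ζ (Fin.cons x (Fin.cons y S : Fin (m + 2) → ι → ℝ) : Fin (m + 3) → ι → ℝ) := by
  refine bracket_cons_congr ζ _ _ _ x fun w => ?_
  have h : ∀ Ψ : Fin (m + 1) → ι → ℝ,
      (fun (i : Fin (m + 2)) p => (Fin.cons y Ψ : Fin (m + 2) → ι → ℝ) i p * w p) =
      Fin.cons (fun p => y p * w p) fun i p => Ψ i p * w p := by
    intro Ψ; funext i; refine Fin.cases ?_ (fun i => ?_) i <;> simp
  rw [h, h]
  refine bracket_cons_congr ζ _ _ _ _ fun v => ?_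
  simp only [mul_assoc]
  exact bracket_front_mul ζ S j fun p => w p * v p

lemma bracket_cons_zero (ζ : ι → ℝ) (x : ι → ℝ) (Φ : Fin 0 → ι → ℝ) :
    bracket ζ (Fin.cons x Φ : Fin 1 → ι → ℝ) = mass x := by
  rw [bracket_cons]; simp [bracket_zero, mass]

/-- Expansion of a bracket along its first entry. -/
lemma bracket_cons_expand (ζ : ι → ℝ) (hζ : ∀ i, 0 < ζ i) {m : ℕ} (x : ι → ℝ)
    (Φ : Fin (m + 1) → ι → ℝ) :
    bracket ζ (Fin.cons x Φ : Fin (m + 2) → ι → ℝ) =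
      (∑ j : Fin (m + 1), (-1) ^ (j : ℕ) * skewForm ζ x (Φ j) *
        bracket ζ fun i => Φ (j.succAbove i)) +
      if Even (m + 1) then mass x * bracket ζ Φ else 0 := by
  classical
  have h1 : bracket ζ (Fin.cons x Φ : Fin (m + 2) → ι → ℝ) =
      ∑ a, ∑ q : Fin (m + 1) → ι, x a * (∏ i, Φ i (q i)) *
        ((∑ j : Fin (m + 1), (-1) ^ (j : ℕ) * schurFactor (ζ a) (ζ (q j)) *
          schurProd fun i => ζ (q (j.succAbove i))) +
        if Even (m + 1) then schurProd (fun i => ζ (q i)) else 0) := by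
    unfold bracket
    rw [sum_fin_succ_fun]
    refine sum_congr rfl fun a _ => sum_congr rfl fun q _ => ?_
    rw [← schurProd_cons_expand (ζ a) (hζ a).le _ fun i => hζ (q i)]
    have : (fun i => ζ ((Fin.cons a q : Fin (m + 2) → ι) i)) =
        Fin.cons (ζ a) fun i => ζ (q i) := by
      funext i; refine Fin.cases ?_ (fun i => ?_) i <;> simp
    rw [this, Fin.prod_univ_succ]
    simp only [Fin.cons_zero, Fin.cons_succ]
  rw [h1]
  simp only [mul_add, sum_add_distrib]
  congr 1
  · simp only [mul_sum]
    refine (sum_congr rfl fun a _ => sum_comm).trans (sum_comm.trans ?_)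
    refine sum_congr rfl fun j _ => ?_
    simp only [skewForm, mul_sum, sum_mul]
    refine sum_congr rfl fun a _ => ?_
    rw [sum_fin_insertNth j]
    refine sum_congr rfl fun c _ => ?_
    rw [bracket, mul_sum]
    refine sum_congr rfl fun q _ => ?_
    rw [Fin.prod_univ_succAbove _ j]
    simp only [Fin.insertNth_apply_same, Fin.insertNth_apply_succAbove]
    ring
  · split_ifs
    · simp only [mass, bracket, sum_mul, mul_sum]
      rw [sum_comm]
      refine sum_congr rfl fun a _ => sum_congr rfl fun q _ => ?_
      ring
    · simp

/-- The alternating sum of the brackets with one entry removed, weighted by the masses. -/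
lemma sum_mass_mul_bracket (ζ : ι → ℝ) (hζ : ∀ i, 0 < ζ i) {m : ℕ} (Φ : Fin (m + 1) → ι → ℝ) :
    ∑ j : Fin (m + 1), (-1) ^ (j : ℕ) * mass (Φ j) * bracket ζ (fun i => Φ (j.succAbove i)) =
      if Even (m + 1) then 0 else bracket ζ Φ := by
  classical
  have h1 : ∀ j : Fin (m + 1), (-1) ^ (j : ℕ) * mass (Φ j) *
      bracket ζ (fun i => Φ (j.succAbove i)) = ∑ q : Fin (m + 1) → ι, (∏ i, Φ i (q i)) *
        ((-1) ^ (j : ℕ) * schurProd fun i => ζ (q (j.succAbove i))) := by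
    intro j
    rw [sum_fin_insertNth j]
    simp only [mass, bracket, mul_sum, sum_mul]
    rw [sum_comm]
    refine sum_congr rfl fun c _ => sum_congr rfl fun q _ => ?_
    rw [Fin.prod_univ_succAbove _ j]
    simp only [Fin.insertNth_apply_same, Fin.insertNth_apply_succAbove]
    ring
  rw [sum_congr rfl fun j _ => h1 j, sum_comm]
  simp only [← mul_sum]
  have h2 : ∀ q : Fin (m + 1) → ι, _ := fun q =>
    sum_schurProd_succAbove (fun i => ζ (q i)) fun i => hζ (q i)
  simp only [h2]
  split_ifs <;> simp [bracket]

end Bracket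

/-! ### Minors of the bilinear form as quadratic expressions in the brackets -/

section Minors

variable {ι : Type*} [Fintype ι]

/-- The minor of `pairing` with rows `X` and columns `Y`. -/
noncomputable def minor (ζ : ι → ℝ) {m : ℕ} (X Y : Fin m → ι → ℝ) : ℝ :=
  (Matrix.of fun i j => pairing ζ (X i) (Y j)).det

/-- The minor of `pairing` with rows `X` and columns `Y`, preceded by a column of masses. -/
noncomputable def massMinor (ζ : ι → ℝ) {m : ℕ} (X : Fin (m + 1) → ι → ℝ)
    (Y : Fin m → ι → ℝ) : ℝ :=
  (Matrix.of fun i j =>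
    (Fin.cons (mass (X i)) fun j => pairing ζ (X i) (Y j) : Fin (m + 1) → ℝ) j).det

lemma minor_front_left (ζ : ι → ℝ) {m : ℕ} (S Y : Fin (m + 1) → ι → ℝ) (j : Fin (m + 1)) :
    minor ζ (Fin.cons (S j) (fun i => S (j.succAbove i)) : Fin (m + 1) → ι → ℝ) Y =
      (-1) ^ (j : ℕ) * minor ζ S Y := by
  rw [cons_succAbove_eq_comp_cycleRange, ← sign_cycleRange_symm]
  exact Matrix.det_permute j.cycleRange.symm (Matrix.of fun i k => pairing ζ (S i) (Y k))

lemma minor_front_right (ζ : ι → ℝ) {m : ℕ} (X S : Fin (m + 1) → ι → ℝ) (j : Fin (m + 1)) :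
    minor ζ X (Fin.cons (S j) (fun i => S (j.succAbove i)) : Fin (m + 1) → ι → ℝ) =
      (-1) ^ (j : ℕ) * minor ζ X S := by
  rw [cons_succAbove_eq_comp_cycleRange, ← sign_cycleRange_symm]
  exact Matrix.det_permute' j.cycleRange.symm (Matrix.of fun i k => pairing ζ (X i) (S k))

lemma massMinor_expand (ζ : ι → ℝ) {m : ℕ} (X : Fin (m + 1) → ι → ℝ) (Y : Fin m → ι → ℝ) :
    massMinor ζ X Y = ∑ i : Fin (m + 1), (-1) ^ (i : ℕ) * mass (X i) *
      minor ζ (fun k => X (i.succAbove k)) Y := by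
  rw [massMinor, Matrix.det_succ_column_zero]
  rfl

lemma massMinor_front_right (ζ : ι → ℝ) {m : ℕ} (X : Fin (m + 2) → ι → ℝ)
    (S : Fin (m + 1) → ι → ℝ) (j : Fin (m + 1)) :
    massMinor ζ X (Fin.cons (S j) (fun i => S (j.succAbove i)) : Fin (m + 1) → ι → ℝ) =
      (-1) ^ (j : ℕ) * massMinor ζ X S := by
  rw [massMinor_expand, massMinor_expand, mul_sum]
  refine sum_congr rfl fun i _ => ?_
  rw [minor_front_right]; ring

lemma minor_cons_cons_expand (ζ : ι → ℝ) {m : ℕ} (x y : ι → ℝ) (S : Fin (m + 1) → ι → ℝ) :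
    minor ζ (Fin.cons x S : Fin (m + 2) → ι → ℝ) (Fin.cons y S : Fin (m + 2) → ι → ℝ) =
      pairing ζ x y * minor ζ S S - ∑ j : Fin (m + 1), (-1) ^ (j : ℕ) * pairing ζ x (S j) *
        minor ζ S (Fin.cons y fun i => S (j.succAbove i) : Fin (m + 1) → ι → ℝ) := by
  have h : ∀ j : Fin (m + 1),
      (Fin.cons y fun i => S (j.succAbove i) : Fin (m + 1) → ι → ℝ) =
      fun i => (Fin.cons y S : Fin (m + 2) → ι → ℝ) (j.succ.succAbove i) :=
    fun j => (cons_cons_succAbove_succ y S j).symm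
  simp only [h]
  rw [minor, Matrix.det_succ_row_zero, Fin.sum_univ_succ, sub_eq_add_neg, ← sum_neg_distrib]
  congr 1
  · simp [minor, Matrix.submatrix]
  · refine sum_congr rfl fun j _ => ?_
    simp only [Fin.val_succ, pow_succ, mul_neg, mul_one, neg_mul, Matrix.of_apply, Fin.cons_zero,
      Fin.cons_succ]
    rfl

/-- Minors of `pairing` whose row and column sets differ in one element. The induction on `S`
expands the determinant along its first row; the sums that arise are expansions of brackets. -/
theorem minor_cons_cons (ζ : ι → ℝ) (hζ : ∀ i, 0 < ζ i) {m : ℕ} (x y : ι → ℝ)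
    (S : Fin m → ι → ℝ) :
    2 ^ (m + 1) * minor ζ (Fin.cons x S : Fin (m + 1) → ι → ℝ)
        (Fin.cons y S : Fin (m + 1) → ι → ℝ) =
      bracket ζ (Fin.cons x S : Fin (m + 1) → ι → ℝ) *
        bracket ζ (Fin.cons y S : Fin (m + 1) → ι → ℝ) +
      bracket ζ S *
        bracket ζ (Fin.cons x (Fin.cons y S : Fin (m + 1) → ι → ℝ) : Fin (m + 2) → ι → ℝ) := by
  induction m generalizing x y with
  | zero =>
    rw [bracket_cons_zero, bracket_cons_zero, bracket_zero, bracket_cons_expand ζ hζ]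
    simp [minor, bracket_zero, pairing]
    ring
  | succ m ih =>
    -- equal extra row and column: the second bracket vanishes and the minor is a square
    have hdiag : 2 ^ (m + 1) * minor ζ S S = bracket ζ S ^ 2 := by
      have h := ih (S 0) (S 0) fun i => S i.succ
      rw [bracket_cons_cons_self] at h
      have hS : (Fin.cons (S 0) fun i => S i.succ : Fin (m + 1) → ι → ℝ) = S :=
        Fin.cons_self_tail S
      rw [hS] at h
      rw [h]; ring
    have hoff : ∀ j : Fin (m + 1), 2 ^ (m + 1) *
        minor ζ S (Fin.cons y fun i => S (j.succAbove i) : Fin (m + 1) → ι → ℝ) =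
        bracket ζ S *
          bracket ζ (Fin.cons y fun i => S (j.succAbove i) : Fin (m + 1) → ι → ℝ) -
        bracket ζ (fun i => S (j.succAbove i)) *
          bracket ζ (Fin.cons y S : Fin (m + 2) → ι → ℝ) := by
      intro j
      have h := ih (S j) y fun i => S (j.succAbove i)
      rw [bracket_cons_cons_swap, minor_front_left, bracket_front, bracket_cons_front] at h
      have hs := neg_one_pow_mul_self (j : ℕ)
      linear_combination (-1) ^ (j : ℕ) * h - (2 ^ (m + 1) *
        minor ζ S (Fin.cons y fun i => S (j.succAbove i) : Fin (m + 1) → ι → ℝ) -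
        bracket ζ S *
          bracket ζ (Fin.cons y fun i => S (j.succAbove i) : Fin (m + 1) → ι → ℝ) +
        bracket ζ (fun i => S (j.succAbove i)) *
          bracket ζ (Fin.cons y S : Fin (m + 2) → ι → ℝ)) * hs
    have a1 := sum_mass_mul_bracket ζ hζ S
    have a2 := sum_mass_mul_bracket ζ hζ (Fin.cons y S : Fin (m + 2) → ι → ℝ)
    have a3 := bracket_cons_expand ζ hζ x S
    have a4 := bracket_cons_expand ζ hζ x (Fin.cons y S : Fin (m + 2) → ι → ℝ)
    rw [Fin.sum_univ_succ] at a2 a4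
    simp only [Fin.val_zero, pow_zero, one_mul, Fin.cons_zero, Fin.zero_succAbove, Fin.cons_succ,
      Fin.val_succ, cons_cons_succAbove_succ, pow_succ, mul_neg, mul_one, neg_mul,
      sum_neg_distrib] at a2 a4
    have hexp : 2 ^ (m + 1 + 1) * minor ζ (Fin.cons x S : Fin (m + 2) → ι → ℝ)
        (Fin.cons y S : Fin (m + 2) → ι → ℝ) =
        2 * pairing ζ x y * (2 ^ (m + 1) * minor ζ S S) - ∑ j : Fin (m + 1), (-1) ^ (j : ℕ) *
          (2 * pairing ζ x (S j)) * (2 ^ (m + 1) *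
            minor ζ S (Fin.cons y fun i => S (j.succAbove i) : Fin (m + 1) → ι → ℝ)) := by
      rw [minor_cons_cons_expand, mul_sub, mul_sum]
      congr 1
      · ring
      · exact sum_congr rfl fun j _ => by ring
    rw [hexp, hdiag]
    simp only [hoff]
    have hsum : ∑ j : Fin (m + 1), (-1) ^ (j : ℕ) * (2 * pairing ζ x (S j)) * (bracket ζ S *
          bracket ζ (Fin.cons y fun i => S (j.succAbove i) : Fin (m + 1) → ι → ℝ) -
        bracket ζ (fun i => S (j.succAbove i)) *
          bracket ζ (Fin.cons y S : Fin (m + 2) → ι → ℝ)) =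
        mass x * bracket ζ S * (∑ j : Fin (m + 1), (-1) ^ (j : ℕ) * mass (S j) *
          bracket ζ (Fin.cons y fun i => S (j.succAbove i) : Fin (m + 1) → ι → ℝ)) -
        mass x * bracket ζ (Fin.cons y S : Fin (m + 2) → ι → ℝ) *
          (∑ j : Fin (m + 1), (-1) ^ (j : ℕ) * mass (S j) *
            bracket ζ (fun i => S (j.succAbove i))) +
        bracket ζ S * (∑ j : Fin (m + 1), (-1) ^ (j : ℕ) * skewForm ζ x (S j) *
          bracket ζ (Fin.cons y fun i => S (j.succAbove i) : Fin (m + 1) → ι → ℝ)) -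
        bracket ζ (Fin.cons y S : Fin (m + 2) → ι → ℝ) *
          (∑ j : Fin (m + 1), (-1) ^ (j : ℕ) * skewForm ζ x (S j) *
            bracket ζ (fun i => S (j.succAbove i))) := by
      simp only [mul_sum, ← sum_add_distrib, ← sum_sub_distrib]
      exact sum_congr rfl fun j _ => by rw [pairing]; ring
    rw [hsum, pairing]
    by_cases hm : Even (m + 1)
    · have hm' : ¬Even (m + 1 + 1) := by rw [Nat.even_add_one]; simpa using hm
      simp only [hm, hm', if_true, if_false] at a1 a2 a3 a4
      linear_combination mass x * bracket ζ S * a2 +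
        mass x * bracket ζ (Fin.cons y S : Fin (m + 2) → ι → ℝ) * a1 - bracket ζ S * a4 -
        bracket ζ (Fin.cons y S : Fin (m + 2) → ι → ℝ) * a3
    · have hm' : Even (m + 1 + 1) := Nat.even_add_one.mpr hm
      simp only [hm, hm', if_true, if_false] at a1 a2 a3 a4
      linear_combination mass x * bracket ζ S * a2 +
        mass x * bracket ζ (Fin.cons y S : Fin (m + 2) → ι → ℝ) * a1 - bracket ζ S * a4 -
        bracket ζ (Fin.cons y S : Fin (m + 2) → ι → ℝ) * a3

lemma cons_tail_eq {α : Type*} {m : ℕ} (S : Fin (m + 1) → α) :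
    (Fin.cons (S 0) fun i => S i.succ : Fin (m + 1) → α) = S := Fin.cons_self_tail S

lemma massMinor_zero (ζ : ι → ℝ) (X : Fin 1 → ι → ℝ) (Y : Fin 0 → ι → ℝ) :
    massMinor ζ X Y = mass (X 0) := by
  simp [massMinor]

lemma massMinor_cons_cons_expand (ζ : ι → ℝ) {m : ℕ} (x x' y : ι → ℝ)
    (S : Fin (m + 1) → ι → ℝ) :
    massMinor ζ (Fin.cons x (Fin.cons x' S : Fin (m + 2) → ι → ℝ) : Fin (m + 3) → ι → ℝ)
        (Fin.cons y S : Fin (m + 2) → ι → ℝ) =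
      -(pairing ζ x y * massMinor ζ (Fin.cons x' S : Fin (m + 2) → ι → ℝ) S) +
      pairing ζ x' y * massMinor ζ (Fin.cons x S : Fin (m + 2) → ι → ℝ) S -
      ∑ j : Fin (m + 1), (-1) ^ (j : ℕ) * pairing ζ (S j) y *
        massMinor ζ (Fin.cons x (Fin.cons x' fun i => S (j.succAbove i) :
          Fin (m + 1) → ι → ℝ) : Fin (m + 2) → ι → ℝ) S := by
  have hcol : ∀ (c p : ℝ) (f : Fin (m + 1) → ℝ),
      (fun j => (Fin.cons c (Fin.cons p f : Fin (m + 2) → ℝ) : Fin (m + 3) → ℝ)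
        ((Fin.succ 0 : Fin (m + 3)).succAbove j)) = Fin.cons c f := by
    intro c p f
    rw [cons_cons_succAbove_succ]
    rfl
  have hrow : ∀ j : Fin (m + 1),
      (fun i => (Fin.cons x (Fin.cons x' S : Fin (m + 2) → ι → ℝ) : Fin (m + 3) → ι → ℝ)
        (j.succ.succ.succAbove i)) = Fin.cons x (Fin.cons x' fun i => S (j.succAbove i) :
          Fin (m + 1) → ι → ℝ) := by
    intro j
    rw [cons_cons_succAbove_succ, cons_cons_succAbove_succ]
  have hrow1 : (fun i => (Fin.cons x (Fin.cons x' S : Fin (m + 2) → ι → ℝ) :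
      Fin (m + 3) → ι → ℝ) ((Fin.succ 0 : Fin (m + 3)).succAbove i)) = Fin.cons x S := by
    rw [cons_cons_succAbove_succ]; rfl
  have hcons : ∀ v : ι → ℝ, (fun j => pairing ζ v ((Fin.cons y S : Fin (m + 2) → ι → ℝ) j)) =
      Fin.cons (pairing ζ v y) fun j => pairing ζ v (S j) := by
    intro v; funext j; refine Fin.cases ?_ (fun j => ?_) j <;> simp
  have hsub : ∀ i : Fin (m + 3),
      ((Matrix.of fun i j => (Fin.cons
        (mass ((Fin.cons x (Fin.cons x' S : Fin (m + 2) → ι → ℝ) : Fin (m + 3) → ι → ℝ) i))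
        fun j => pairing ζ ((Fin.cons x (Fin.cons x' S : Fin (m + 2) → ι → ℝ) :
          Fin (m + 3) → ι → ℝ) i) ((Fin.cons y S : Fin (m + 2) → ι → ℝ) j) :
            Fin (m + 3) → ℝ) j).submatrix i.succAbove (Fin.succ 0 : Fin (m + 3)).succAbove).det =
      massMinor ζ (fun k => (Fin.cons x (Fin.cons x' S : Fin (m + 2) → ι → ℝ) :
        Fin (m + 3) → ι → ℝ) (i.succAbove k)) S := by
    intro i
    unfold massMinor
    congr 1
    ext k j
    simp only [Matrix.submatrix_apply, Matrix.of_apply, hcons]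
    exact congrFun (hcol _ _ _) j
  rw [massMinor, Matrix.det_succ_column _ (Fin.succ 0)]
  simp only [hsub]
  rw [Fin.sum_univ_succ, Fin.sum_univ_succ]
  simp only [hrow, hrow1, Fin.zero_succAbove, Fin.cons_succ, Fin.cons_zero, Matrix.of_apply,
    Fin.val_zero, Fin.val_succ]
  rw [sub_eq_add_neg, ← sum_neg_distrib, ← add_assoc]
  congr 1
  · ring
  · exact sum_congr rfl fun j _ => by ring

lemma bracket_cons_cons_cons_self (ζ : ι → ℝ) {m : ℕ} (u x : ι → ℝ) (Φ : Fin m → ι → ℝ) :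
    bracket ζ (Fin.cons u (Fin.cons x (Fin.cons x Φ : Fin (m + 1) → ι → ℝ) :
      Fin (m + 2) → ι → ℝ) : Fin (m + 3) → ι → ℝ) = 0 := by
  rw [bracket_cons, sum_eq_zero]
  intro a _
  have := bracket_cons_cons_self ζ (fun p => x p * schurFactor (ζ a) (ζ p))
    fun i p => Φ i p * schurFactor (ζ a) (ζ p)
  convert mul_zero (u a) using 2
  rw [← this]
  congr 1
  funext i
  refine Fin.cases (by simp) (fun i => Fin.cases (by simp) (fun i => by simp) i) i

/-- Minors of `pairing` bordered by a column of masses. -/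
theorem massMinor_cons_cons_cons (ζ : ι → ℝ) (hζ : ∀ i, 0 < ζ i) {m : ℕ} (x x' y : ι → ℝ)
    (S : Fin m → ι → ℝ) :
    2 ^ (m + 1) * massMinor ζ
        (Fin.cons x (Fin.cons x' S : Fin (m + 1) → ι → ℝ) : Fin (m + 2) → ι → ℝ)
        (Fin.cons y S : Fin (m + 1) → ι → ℝ) =
      (-1) ^ m * (bracket ζ S * bracket ζ (Fin.cons x (Fin.cons x' (Fin.cons y S :
          Fin (m + 1) → ι → ℝ) : Fin (m + 2) → ι → ℝ) : Fin (m + 3) → ι → ℝ) -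
        bracket ζ (Fin.cons x (Fin.cons x' S : Fin (m + 1) → ι → ℝ) : Fin (m + 2) → ι → ℝ) *
          bracket ζ (Fin.cons y S : Fin (m + 1) → ι → ℝ)) := by
  induction m generalizing x x' y with
  | zero =>
    have e : ∀ u v : ι → ℝ, bracket ζ (Fin.cons u (Fin.cons v S : Fin 1 → ι → ℝ) :
        Fin 2 → ι → ℝ) = skewForm ζ u v := by
      intro u v
      rw [bracket_cons_expand ζ hζ]
      simp [bracket_zero]
    have e3 : bracket ζ (Fin.cons x (Fin.cons x' (Fin.cons y S : Fin 1 → ι → ℝ) :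
        Fin 2 → ι → ℝ) : Fin 3 → ι → ℝ) = skewForm ζ x x' * mass y - skewForm ζ x y * mass x' +
        mass x * skewForm ζ x' y := by
      have h0 : (fun i : Fin 1 => (Fin.cons x' (Fin.cons y S : Fin 1 → ι → ℝ) :
          Fin 2 → ι → ℝ) ((Fin.succ 0).succAbove i)) = Fin.cons x' S := by
        rw [cons_cons_succAbove_succ]; congr 1
      rw [bracket_cons_expand ζ hζ, Fin.sum_univ_two, e]
      simp only [Fin.val_zero, Fin.zero_succAbove, Fin.cons_zero, Fin.cons_succ, pow_zero,
        bracket_cons_zero, ← Fin.succ_zero_eq_one, h0]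
      norm_num
      ring
    have e2 : massMinor ζ (Fin.cons x (Fin.cons x' S : Fin 1 → ι → ℝ) : Fin 2 → ι → ℝ)
        (Fin.cons y S : Fin 1 → ι → ℝ) = mass x * pairing ζ x' y - mass x' * pairing ζ x y := by
      rw [massMinor, Matrix.det_fin_two]
      change mass x * pairing ζ x' y - pairing ζ x y * mass x' = _
      ring
    rw [bracket_zero, bracket_cons_zero, e, e2, e3, pairing, pairing]
    ring
  | succ m ih =>
    have hP : ∀ u : ι → ℝ, 2 ^ (m + 1) * massMinor ζ (Fin.cons u S : Fin (m + 2) → ι → ℝ) S =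
        -(-1) ^ m * bracket ζ (Fin.cons u S : Fin (m + 2) → ι → ℝ) * bracket ζ S := by
      intro u
      have h := ih u (S 0) (S 0) fun i => S i.succ
      rw [bracket_cons_cons_cons_self, cons_tail_eq] at h
      rw [h]; ring
    have hj : ∀ j : Fin (m + 1), 2 ^ (m + 1) * massMinor ζ (Fin.cons x (Fin.cons x' fun i =>
        S (j.succAbove i) : Fin (m + 1) → ι → ℝ) : Fin (m + 2) → ι → ℝ) S =
        (-1) ^ m * (bracket ζ (fun i => S (j.succAbove i)) * bracket ζ (Fin.cons x
            (Fin.cons x' S : Fin (m + 2) → ι → ℝ) : Fin (m + 3) → ι → ℝ) -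
          bracket ζ (Fin.cons x (Fin.cons x' fun i => S (j.succAbove i) :
            Fin (m + 1) → ι → ℝ) : Fin (m + 2) → ι → ℝ) * bracket ζ S) := by
      intro j
      have h := ih x x' (S j) fun i => S (j.succAbove i)
      rw [massMinor_front_right, bracket_front, bracket_cons_cons_front] at h
      have hs : ((-1 : ℝ) ^ (j : ℕ)) ≠ 0 := by positivity
      refine mul_left_cancel₀ hs ?_
      linear_combination h
    have a1 := sum_mass_mul_bracket ζ hζ S
    have a3 := bracket_cons_expand ζ hζ y S
    have a5 := sum_mass_mul_bracket ζ hζ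
      (Fin.cons x (Fin.cons x' S : Fin (m + 2) → ι → ℝ) : Fin (m + 3) → ι → ℝ)
    have a6 := bracket_cons_expand ζ hζ y
      (Fin.cons x (Fin.cons x' S : Fin (m + 2) → ι → ℝ) : Fin (m + 3) → ι → ℝ)
    rw [Fin.sum_univ_succ, Fin.sum_univ_succ] at a5 a6
    have hrow1 : (fun i => (Fin.cons x (Fin.cons x' S : Fin (m + 2) → ι → ℝ) :
        Fin (m + 3) → ι → ℝ) ((Fin.succ 0 : Fin (m + 3)).succAbove i)) = Fin.cons x S := by
      rw [cons_cons_succAbove_succ]; rfl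
    have hrow : ∀ j : Fin (m + 1),
        (fun i => (Fin.cons x (Fin.cons x' S : Fin (m + 2) → ι → ℝ) : Fin (m + 3) → ι → ℝ)
          (j.succ.succ.succAbove i)) = Fin.cons x (Fin.cons x' fun i => S (j.succAbove i) :
            Fin (m + 1) → ι → ℝ) := by
      intro j
      rw [cons_cons_succAbove_succ, cons_cons_succAbove_succ]
    have hbr : bracket ζ (Fin.cons y (Fin.cons x (Fin.cons x' S : Fin (m + 2) → ι → ℝ) :
        Fin (m + 3) → ι → ℝ) : Fin (m + 4) → ι → ℝ) = bracket ζ (Fin.cons x (Fin.cons x'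
        (Fin.cons y S : Fin (m + 2) → ι → ℝ) : Fin (m + 3) → ι → ℝ) : Fin (m + 4) → ι → ℝ) := by
      rw [bracket_cons_cons_swap, ← neg_one_mul]
      refine (bracket_cons_congr ζ (-1) _ _ x fun w => ?_).symm
      have h : ∀ u v : ι → ℝ, (fun (i : Fin (m + 3)) p => (Fin.cons u
          (Fin.cons v S : Fin (m + 2) → ι → ℝ) : Fin (m + 3) → ι → ℝ) i p * w p) =
          Fin.cons (fun p => u p * w p) (Fin.cons (fun p => v p * w p) (fun i p => S i p * w p) :
            Fin (m + 2) → ι → ℝ) := by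
        intro u v; funext i
        refine Fin.cases (by simp) (fun i => Fin.cases (by simp) (fun i => by simp) i) i
      rw [h, h, bracket_cons_cons_swap]; ring
    simp only [Fin.val_zero, pow_zero, one_mul, Fin.cons_zero, Fin.zero_succAbove, Fin.cons_succ,
      Fin.val_succ, hrow, hrow1, zero_add, pow_succ, mul_neg, mul_one, neg_mul, neg_neg,
      hbr] at a5 a6
    have hexp := massMinor_cons_cons_expand ζ x x' y S
    have hsum : 2 ^ (m + 1) * ∑ j : Fin (m + 1), (-1) ^ (j : ℕ) * pairing ζ (S j) y *
        massMinor ζ (Fin.cons x (Fin.cons x' fun i => S (j.succAbove i) :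
          Fin (m + 1) → ι → ℝ) : Fin (m + 2) → ι → ℝ) S =
        (-1) ^ m / 2 * (mass y * bracket ζ (Fin.cons x
            (Fin.cons x' S : Fin (m + 2) → ι → ℝ) : Fin (m + 3) → ι → ℝ) *
          (∑ j : Fin (m + 1), (-1) ^ (j : ℕ) * mass (S j) *
            bracket ζ (fun i => S (j.succAbove i))) -
        mass y * bracket ζ S * (∑ j : Fin (m + 1), (-1) ^ (j : ℕ) * mass (S j) *
          bracket ζ (Fin.cons x (Fin.cons x' fun i => S (j.succAbove i) :
            Fin (m + 1) → ι → ℝ) : Fin (m + 2) → ι → ℝ)) -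
        bracket ζ (Fin.cons x (Fin.cons x' S : Fin (m + 2) → ι → ℝ) : Fin (m + 3) → ι → ℝ) *
          (∑ j : Fin (m + 1), (-1) ^ (j : ℕ) * skewForm ζ y (S j) *
            bracket ζ (fun i => S (j.succAbove i))) +
        bracket ζ S * (∑ j : Fin (m + 1), (-1) ^ (j : ℕ) * skewForm ζ y (S j) *
          bracket ζ (Fin.cons x (Fin.cons x' fun i => S (j.succAbove i) :
            Fin (m + 1) → ι → ℝ) : Fin (m + 2) → ι → ℝ))) := by
      simp only [mul_sum, ← sum_add_distrib, ← sum_sub_distrib]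
      refine sum_congr rfl fun j _ => ?_
      rw [pairing, skewForm_antisymm ζ (S j) y]
      linear_combination (-1) ^ (j : ℕ) * ((mass (S j) * mass y + -skewForm ζ y (S j)) / 2) * hj j
    have hx := hP x
    have hx' := hP x'
    rw [skewForm_antisymm ζ y x, skewForm_antisymm ζ y x'] at a6
    rw [pairing, pairing] at hexp
    have hpar : Even (m + 2 + 1) ↔ Even (m + 1) := by
      rw [show m + 2 + 1 = m + 1 + 1 + 1 from rfl, Nat.even_add_one, Nat.even_add_one, not_not]
    simp only [hpar] at a5 a6
    by_cases hm : Even (m + 1)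
    · simp only [hm, if_true] at a1 a3 a5 a6
      linear_combination 2 ^ (m + 2) * hexp - 2 * hsum -
        (mass x * mass y + skewForm ζ x y) * hx' + (mass x' * mass y + skewForm ζ x' y) * hx -
        (-1) ^ m * bracket ζ (Fin.cons x (Fin.cons x' S : Fin (m + 2) → ι → ℝ) :
          Fin (m + 3) → ι → ℝ) * (mass y * a1 + a3) +
        (-1) ^ m * bracket ζ S * (mass y * a5 + a6)
    · simp only [hm, if_false] at a1 a3 a5 a6
      linear_combination 2 ^ (m + 2) * hexp - 2 * hsum -
        (mass x * mass y + skewForm ζ x y) * hx' + (mass x' * mass y + skewForm ζ x' y) * hx -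
        (-1) ^ m * bracket ζ (Fin.cons x (Fin.cons x' S : Fin (m + 2) → ι → ℝ) :
          Fin (m + 3) → ι → ℝ) * (mass y * a1 + a3) +
        (-1) ^ m * bracket ζ S * (mass y * a5 + a6)

/-- Minors of `pairing` with rows `x, S` and columns `S`, bordered by a column of masses. -/
theorem massMinor_cons (ζ : ι → ℝ) (hζ : ∀ i, 0 < ζ i) {m : ℕ} (x : ι → ℝ)
    (S : Fin m → ι → ℝ) :
    2 ^ m * massMinor ζ (Fin.cons x S : Fin (m + 1) → ι → ℝ) S =
      (-1) ^ m * bracket ζ (Fin.cons x S : Fin (m + 1) → ι → ℝ) * bracket ζ S := by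
  cases m with
  | zero => rw [massMinor_zero, bracket_cons_zero, bracket_zero]; simp
  | succ m =>
    have h := massMinor_cons_cons_cons ζ hζ x (S 0) (S 0) fun i => S i.succ
    rw [bracket_cons_cons_cons_self, cons_tail_eq] at h
    rw [h]; ring

end Minors

/-! ### Spectral sums as brackets of consecutive powers -/

section Spectral

variable {n : ℕ}

/-- The function `b ζ^a` on the spectrum. -/
noncomputable def specPow (ζ b : Fin n → ℝ) (a : ℤ) : Fin n → ℝ := fun p => b p * ζ p ^ a

/-- The functions `b ζ^a, b ζ^(a+1), …, b ζ^(a+m-1)`. -/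
noncomputable def consec (ζ b : Fin n → ℝ) (a : ℤ) (m : ℕ) : Fin m → Fin n → ℝ :=
  fun i => specPow ζ b (a + (i : ℕ))

lemma sum_fun_eq_sum_perm {m : ℕ} (F : (Fin m → Fin n) → ℝ)
    (hF : ∀ p, ¬Function.Injective p → F p = 0) :
    ∑ p, F p = ∑ I : Finset (Fin n), if h : I.card = m then
      ∑ π : Equiv.Perm (Fin m), F fun i => I.orderEmbOfFin h (π i) else 0 := by
  rw [← sum_fiberwise univ (fun p : Fin m → Fin n => univ.image p) F]
  refine sum_congr rfl fun I _ => ?_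
  split_ifs with h
  · symm
    refine sum_bij (fun π _ => fun i => I.orderEmbOfFin h (π i)) ?_ ?_ ?_ fun _ _ => rfl
    · intro π _
      simp only [mem_filter, mem_univ, true_and]
      ext x
      have hr := I.range_orderEmbOfFin h
      simp only [mem_image, mem_univ, true_and]
      constructor
      · rintro ⟨i, rfl⟩; exact I.orderEmbOfFin_mem h _
      · intro hx
        obtain ⟨i, hi⟩ : x ∈ Set.range (I.orderEmbOfFin h) := by rw [hr]; exact hx
        exact ⟨π.symm i, by simpa using hi⟩
    · intro π _ σ _ hπ
      ext i
      have := congrFun hπ i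
      simpa using congrArg Fin.val ((I.orderEmbOfFin h).injective this)
    · intro p hp
      have hp : univ.image p = I := by simpa using hp
      have hinj : Function.Injective p := by
        rw [← card_image_iff.trans (by simp [Set.injOn_univ] : Set.InjOn p (univ : Finset (Fin m)) ↔
          Function.Injective p), hp, h]; simp
      have hmem : ∀ i, p i ∈ I := fun i => hp ▸ mem_image_of_mem p (mem_univ i)
      have hb : Function.Bijective fun i => (I.orderIsoOfFin h).symm ⟨p i, hmem i⟩ := by
        rw [Fintype.bijective_iff_injective_and_card]
        refine ⟨fun i j hij => hinj ?_, rfl⟩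
        simpa using hij
      refine ⟨Equiv.ofBijective _ hb, mem_univ _, ?_⟩
      funext i
      simp [← coe_orderIsoOfFin_apply]
  · refine sum_eq_zero fun p hp => hF p fun hinj => h ?_
    have hp : univ.image p = I := by simpa using hp
    rw [← hp, card_image_of_injective _ hinj]; simp

lemma prod_pairs_orderEmb {m : ℕ} (I : Finset (Fin n)) (h : I.card = m)
    (f : Fin n → Fin n → ℝ) :
    ∏ i, ∏ j ∈ Ioi i, f (I.orderEmbOfFin h i) (I.orderEmbOfFin h j) =
      ∏ i ∈ I, ∏ j ∈ I with i < j, f i j := by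
  have hI : univ.map (I.orderEmbOfFin h).toEmbedding = I := map_orderEmbOfFin_univ I h
  conv_rhs => rw [← hI]
  rw [prod_map]
  refine prod_congr rfl fun i _ => ?_
  have : {j ∈ univ.map (I.orderEmbOfFin h).toEmbedding | (I.orderEmbOfFin h).toEmbedding i < j} =
      (Ioi i).map (I.orderEmbOfFin h).toEmbedding := by
    ext x
    simp only [mem_filter, mem_map, mem_univ, true_and, mem_Ioi]
    constructor
    · rintro ⟨⟨j, rfl⟩, hj⟩; exact ⟨j, by simpa using hj, rfl⟩
    · rintro ⟨j, hj, rfl⟩; exact ⟨⟨j, rfl⟩, by simpa using hj⟩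
  rw [this, prod_map]
  rfl

/-- The Schur product and the Vandermonde determinant of the powers combine to
`Δ_I² / Γ_I`. -/
lemma bracket_consec (ζ b : Fin n → ℝ) (hζ : ∀ i, 0 < ζ i) (a : ℤ) (m : ℕ) :
    bracket ζ (consec ζ b a m) = spectralSum a ζ b m := by
  rw [bracket, sum_fun_eq_sum_perm, spectralSum, sum_filter]
  swap
  · intro p hp
    simp only [Function.Injective, not_forall] at hp
    obtain ⟨i, j, hij, hne⟩ := hp
    rw [schurProd_eq_zero hne (by simp only [hij]), mul_zero]
  refine sum_congr rfl fun I _ => ?_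
  by_cases h : I.card = m
  swap
  · rw [dif_neg h, if_neg (by exact_mod_cast h)]
  rw [dif_pos h, if_pos (by exact_mod_cast h)]
  set o := I.orderEmbOfFin h with ho
  have hI : univ.map o.toEmbedding = I := map_orderEmbOfFin_univ I h
  have hprod : ∀ f : Fin n → ℝ, ∏ i, f (o i) = ∏ i ∈ I, f i := by
    intro f; conv_rhs => rw [← hI, prod_map]
    rfl
  have h1 : ∀ π : Equiv.Perm (Fin m),
      (∏ i, consec ζ b a m i (o (π i))) * schurProd (fun i => ζ (o (π i))) =
      ((∏ i ∈ I, b i) * (∏ i ∈ I, ζ i) ^ a * schurProd fun i => ζ (o i)) *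
        (((Equiv.Perm.sign π : ℤˣ) : ℝ) * ∏ i, ζ (o (π i)) ^ (i : ℕ)) := by
    intro π
    rw [schurProd_comp_perm (fun i => ζ (o i)) π, ← hprod, ← hprod, ← prod_zpow,
      ← Equiv.prod_comp π fun i => b (o i), ← Equiv.prod_comp π fun i => ζ (o i) ^ a]
    have : ∀ i, consec ζ b a m i (o (π i)) =
        b (o (π i)) * ζ (o (π i)) ^ a * ζ (o (π i)) ^ (i : ℕ) := by
      intro i
      rw [consec, specPow, zpow_add₀ (hζ _).ne', zpow_natCast, mul_assoc]
    simp only [this, prod_mul_distrib]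
    ring
  have h2 : ∑ π : Equiv.Perm (Fin m),
      (((Equiv.Perm.sign π : ℤˣ) : ℝ) * ∏ i, ζ (o (π i)) ^ (i : ℕ)) = vdm ζ I := by
    have := Matrix.det_vandermonde fun i => ζ (o i)
    rw [Matrix.det_apply'] at this
    simp only [Matrix.vandermonde_apply] at this
    rw [this, vdm, ← prod_pairs_orderEmb I h fun i j => ζ j - ζ i]
  have h3 : schurProd (fun i => ζ (o i)) = vdm ζ I / gam ζ I := by
    rw [vdm, gam, ← prod_div_distrib]
    simp only [← prod_div_distrib]
    rw [← prod_pairs_orderEmb I h fun i j => (ζ j - ζ i) / (ζ j + ζ i)]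
    rfl
  rw [sum_congr rfl fun π _ => h1 π, ← mul_sum, h2, h3, prodOver, prodOver]
  ring

lemma spectralSum_pos (ζ b : Fin n → ℝ) (hζ : ∀ i, 0 < ζ i) (hmono : StrictMono ζ)
    (hb : ∀ i, 0 < b i) (a : ℤ) {m : ℕ} (hm : m ≤ n) : 0 < spectralSum a ζ b m := by
  have hne : ({I : Finset (Fin n) | (I.card : ℤ) = m} : Finset _).Nonempty := by
    obtain ⟨I, -, hI⟩ := exists_subset_card_eq (s := (univ : Finset (Fin n))) (by simpa using hm)
    exact ⟨I, by simp [hI]⟩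
  refine sum_pos (fun I _ => ?_) hne
  have h1 : 0 < vdm ζ I := prod_pos fun i _ => prod_pos fun j hj =>
    sub_pos.mpr (hmono (mem_filter.mp hj).2)
  have h2 : 0 < gam ζ I := prod_pos fun i _ => prod_pos fun j _ => add_pos (hζ j) (hζ i)
  have h3 : 0 < prodOver ζ I := prod_pos fun i _ => hζ i
  have h4 : 0 < prodOver b I := prod_pos fun i _ => hb i
  positivity

lemma spectralSum_eq_zero_of_lt (ζ b : Fin n → ℝ) (a : ℤ) {k : ℤ} (hk : (n : ℤ) < k) :
    spectralSum a ζ b k = 0 := by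
  rw [spectralSum, filter_eq_empty_iff.mpr, sum_empty]
  intro I _ h
  have := card_le_univ I
  simp only [Fintype.card_fin] at this
  omega

lemma spectralSum_eq_zero_of_neg (ζ b : Fin n → ℝ) (a : ℤ) {k : ℤ} (hk : k < 0) :
    spectralSum a ζ b k = 0 := by
  rw [spectralSum, filter_eq_empty_iff.mpr, sum_empty]
  intro I _ h
  omega

lemma spectralSum_zero (ζ b : Fin n → ℝ) (a : ℤ) : spectralSum a ζ b 0 = 1 := by
  have : ({I : Finset (Fin n) | (I.card : ℤ) = 0} : Finset _) = {∅} := by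
    ext I; simp
  rw [spectralSum, this, sum_singleton]
  simp [vdm, gam, prodOver]

end Spectral

/-! ### Bimoment determinants -/

section Bimoments

variable {n : ℕ}

/-- The moments `∑_p b_p ζ_p^a`. -/
noncomputable def moment (ζ b : Fin n → ℝ) (a : ℤ) : ℝ := ∑ p, b p * ζ p ^ a

/-- The bimoments `∑_{p, q} b_p b_q ζ_p^a ζ_q^c / (ζ_p + ζ_q)` of the Cauchy kernel. -/
noncomputable def bimoment (ζ b : Fin n → ℝ) (a c : ℤ) : ℝ :=
  ∑ p, ∑ q, b p * b q * (ζ p ^ a * ζ q ^ c) / (ζ p + ζ q)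

/-- The matrix of the bimoments with exponents `a + i` and `c + j`. -/
noncomputable def gramMat (ζ b : Fin n → ℝ) (a c : ℤ) (m : ℕ) : Matrix (Fin m) (Fin m) ℝ :=
  Matrix.of fun i j => bimoment ζ b (a + (i : ℕ)) (c + (j : ℕ))

/-- The matrix with upper left entry `d`, first row `r` and first column `c` around `G`. -/
def bordered {m : ℕ} (G : Matrix (Fin m) (Fin m) ℝ) (d : ℝ) (r c : Fin m → ℝ) :
    Matrix (Fin (m + 1)) (Fin (m + 1)) ℝ :=
  Matrix.of (Fin.cons (Fin.cons d r : Fin (m + 1) → ℝ) fun i => Fin.cons (c i) (G i))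

lemma bimoment_comm (ζ b : Fin n → ℝ) (a c : ℤ) : bimoment ζ b a c = bimoment ζ b c a := by
  unfold bimoment
  rw [sum_comm]
  refine sum_congr rfl fun p _ => sum_congr rfl fun q _ => ?_
  rw [add_comm]; ring

lemma mass_specPow (ζ b : Fin n → ℝ) (a : ℤ) : mass (specPow ζ b a) = moment ζ b a := rfl

lemma pairing_specPow (ζ b : Fin n → ℝ) (hζ : ∀ i, 0 < ζ i) (a c : ℤ) :
    pairing ζ (specPow ζ b a) (specPow ζ b c) = bimoment ζ b a (c + 1) := by
  simp only [pairing, mass, skewForm, sum_mul_sum, ← sum_add_distrib, sum_div, bimoment]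
  refine sum_congr rfl fun p _ => sum_congr rfl fun q _ => ?_
  have h1 : ζ p + ζ q ≠ 0 := by linarith [hζ p, hζ q] |> ne_of_gt
  have h2 : ζ q + ζ p ≠ 0 := by rwa [add_comm]
  rw [specPow, specPow, schurFactor, zpow_add_one₀ (hζ q).ne']
  field_simp
  ring

lemma consec_succ (ζ b : Fin n → ℝ) (a : ℤ) (m : ℕ) :
    consec ζ b a (m + 1) = Fin.cons (specPow ζ b a) (consec ζ b (a + 1) m) := by
  funext i
  refine Fin.cases (by simp [consec]) (fun i => ?_) i
  simp only [consec, Fin.cons_succ, Fin.val_succ]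
  congr 1; push_cast; ring

lemma cons_consec_eq_front (ζ b : Fin n → ℝ) (a : ℤ) (m : ℕ) :
    (Fin.cons (specPow ζ b (a + m)) (consec ζ b a m) : Fin (m + 1) → Fin n → ℝ) =
      Fin.cons (consec ζ b a (m + 1) (Fin.last m))
        fun i => consec ζ b a (m + 1) ((Fin.last m).succAbove i) := by
  funext i
  refine Fin.cases (by simp [consec]) (fun i => ?_) i
  simp [consec]

lemma bracket_cons_consec (ζ b : Fin n → ℝ) (a : ℤ) (m : ℕ) :
    bracket ζ (Fin.cons (specPow ζ b (a + m)) (consec ζ b a m) : Fin (m + 1) → Fin n → ℝ) =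
      (-1) ^ m * bracket ζ (consec ζ b a (m + 1)) := by
  rw [cons_consec_eq_front, bracket_front]; simp

lemma minor_cons_consec_left (ζ b : Fin n → ℝ) (a : ℤ) (m : ℕ) (Y : Fin (m + 1) → Fin n → ℝ) :
    minor ζ (Fin.cons (specPow ζ b (a + m)) (consec ζ b a m) : Fin (m + 1) → Fin n → ℝ) Y =
      (-1) ^ m * minor ζ (consec ζ b a (m + 1)) Y := by
  rw [cons_consec_eq_front, minor_front_left]; simp

lemma minor_cons_consec_right (ζ b : Fin n → ℝ) (a : ℤ) (m : ℕ) (X : Fin (m + 1) → Fin n → ℝ) :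
    minor ζ X (Fin.cons (specPow ζ b (a + m)) (consec ζ b a m) : Fin (m + 1) → Fin n → ℝ) =
      (-1) ^ m * minor ζ X (consec ζ b a (m + 1)) := by
  rw [cons_consec_eq_front, minor_front_right]; simp

lemma massMinor_cons_consec_right (ζ ζ' b : Fin n → ℝ) (a : ℤ) (m : ℕ)
    (X : Fin (m + 2) → Fin n → ℝ) :
    massMinor ζ X (Fin.cons (specPow ζ' b (a + m)) (consec ζ' b a m) : Fin (m + 1) → Fin n → ℝ) =
      (-1) ^ m * massMinor ζ X (consec ζ' b a (m + 1)) := by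
  rw [cons_consec_eq_front, massMinor_front_right]; simp

lemma massMinor_front_left (ζ : Fin n → ℝ) {m : ℕ} (S : Fin (m + 1) → Fin n → ℝ)
    (Y : Fin m → Fin n → ℝ) (j : Fin (m + 1)) :
    massMinor ζ (Fin.cons (S j) (fun i => S (j.succAbove i)) : Fin (m + 1) → Fin n → ℝ) Y =
      (-1) ^ (j : ℕ) * massMinor ζ S Y := by
  rw [cons_succAbove_eq_comp_cycleRange, ← sign_cycleRange_symm]
  exact Matrix.det_permute j.cycleRange.symm (Matrix.of fun i k =>
    (Fin.cons (mass (S i)) fun k => pairing ζ (S i) (Y k) : Fin (m + 1) → ℝ) k)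

lemma massMinor_cons_consec_left (ζ b : Fin n → ℝ) (a : ℤ) (m : ℕ) (Y : Fin m → Fin n → ℝ) :
    massMinor ζ (Fin.cons (specPow ζ b (a + m)) (consec ζ b a m) : Fin (m + 1) → Fin n → ℝ) Y =
      (-1) ^ m * massMinor ζ (consec ζ b a (m + 1)) Y := by
  rw [cons_consec_eq_front, massMinor_front_left]; simp

lemma minor_consec (ζ b : Fin n → ℝ) (hζ : ∀ i, 0 < ζ i) (a c : ℤ) (m : ℕ) :
    minor ζ (consec ζ b a m) (consec ζ b c m) = (gramMat ζ b a (c + 1) m).det := by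
  unfold minor gramMat consec
  congr 2
  funext i j
  rw [pairing_specPow ζ b hζ]
  congr 1; ring

/-- The Gram determinants, with equal exponents of rows and columns. -/
lemma det_gramMat_same (ζ b : Fin n → ℝ) (hζ : ∀ i, 0 < ζ i) (a : ℤ) (m : ℕ) :
    2 ^ (m + 1) * (gramMat ζ b a a (m + 1)).det =
      spectralSum a ζ b (m + 1 : ℕ) * spectralSum (a - 1) ζ b (m + 1 : ℕ) -
        spectralSum a ζ b m * spectralSum (a - 1) ζ b (m + 2 : ℕ) := by
  have h := minor_cons_cons ζ hζ (specPow ζ b (a + m)) (specPow ζ b (a - 1)) (consec ζ b a m)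
  have h1 : (Fin.cons (specPow ζ b (a - 1)) (consec ζ b a m) : Fin (m + 1) → Fin n → ℝ) =
      consec ζ b (a - 1) (m + 1) := by rw [consec_succ, sub_add_cancel]
  have h2 : specPow ζ b (a + m) = specPow ζ b (a - 1 + (m + 1 : ℕ)) := by
    congr 1; push_cast; ring
  rw [h1, minor_cons_consec_left, minor_consec ζ b hζ, bracket_cons_consec, sub_add_cancel] at h
  rw [h2, bracket_cons_consec] at h
  simp only [bracket_consec ζ b hζ] at h
  have hs := neg_one_pow_mul_self m
  refine mul_left_cancel₀ (pow_ne_zero m (by norm_num : (-1 : ℝ) ≠ 0)) ?_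
  linear_combination h

/-- The bimoment determinants that are squares. -/
lemma det_gramMat_add_one (ζ b : Fin n → ℝ) (hζ : ∀ i, 0 < ζ i) (a : ℤ) (m : ℕ) :
    2 ^ m * (gramMat ζ b a (a + 1) m).det = spectralSum a ζ b m ^ 2 := by
  cases m with
  | zero => simp [spectralSum_zero]
  | succ m =>
    have h := minor_cons_cons ζ hζ (specPow ζ b a) (specPow ζ b a) (consec ζ b (a + 1) m)
    rw [bracket_cons_cons_self, ← consec_succ, minor_consec ζ b hζ, bracket_consec ζ b hζ] at h
    rw [h]; ring

lemma det_gramMat_add_two (ζ b : Fin n → ℝ) (hζ : ∀ i, 0 < ζ i) (a : ℤ) (m : ℕ) :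
    2 ^ (m + 1) * (gramMat ζ b a (a + 2) (m + 1)).det =
      spectralSum a ζ b (m + 1 : ℕ) * spectralSum (a + 1) ζ b (m + 1 : ℕ) +
        spectralSum (a + 1) ζ b m * spectralSum a ζ b (m + 2 : ℕ) := by
  have h := minor_cons_cons ζ hζ (specPow ζ b a) (specPow ζ b (a + 1 + m)) (consec ζ b (a + 1) m)
  have h2 : specPow ζ b (a + 1 + m) = specPow ζ b (a + (m + 1 : ℕ)) := by
    congr 1; push_cast; ring
  rw [bracket_cons_cons_swap, minor_cons_consec_right, ← consec_succ, minor_consec ζ b hζ,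
    bracket_cons_consec] at h
  rw [h2, bracket_cons_consec] at h
  simp only [bracket_consec ζ b hζ, add_assoc, one_add_one_eq_two] at h
  have hs := neg_one_pow_mul_self m
  refine mul_left_cancel₀ (pow_ne_zero m (by norm_num : (-1 : ℝ) ≠ 0)) ?_
  linear_combination h

lemma schurFactor_inv {x y : ℝ} (hx : 0 < x) (hy : 0 < y) :
    schurFactor x⁻¹ y⁻¹ = -schurFactor x y := by
  unfold schurFactor
  have : y + x ≠ 0 := by positivity
  have : x + y ≠ 0 := by positivity
  field_simp
  rw [add_comm x y]; field_simp; ring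

/-- Inverting the spectrum multiplies a bracket of `k` entries by `(-1) ^ (k (k - 1) / 2)`; here
`s` is this sign for `k = m`. -/
lemma exists_bracket_inv (m : ℕ) : ∃ s : ℝ, s * s = 1 ∧
    ∀ (ζ : Fin n → ℝ), (∀ i, 0 < ζ i) →
      (∀ Φ : Fin m → Fin n → ℝ, bracket (fun i => (ζ i)⁻¹) Φ = s * bracket ζ Φ) ∧
      (∀ Φ : Fin (m + 1) → Fin n → ℝ,
        bracket (fun i => (ζ i)⁻¹) Φ = (-1) ^ m * s * bracket ζ Φ) ∧
      (∀ Φ : Fin (m + 2) → Fin n → ℝ, bracket (fun i => (ζ i)⁻¹) Φ = -s * bracket ζ Φ) ∧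
      ∀ Φ : Fin (m + 3) → Fin n → ℝ,
        bracket (fun i => (ζ i)⁻¹) Φ = (-1) ^ (m + 1) * s * bracket ζ Φ := by
  have hs := neg_one_pow_mul_self m
  -- `s k` is the product of `-1` over the pairs of `k` indices
  obtain ⟨s, hs1, hs0⟩ : ∃ s : ℕ → ℝ, (∀ k, s (k + 1) = (-1) ^ k * s k) ∧
      ∀ k (q : Fin k → ℝ), (∀ i, 0 < q i) →
        schurProd (fun i => (q i)⁻¹) = s k * schurProd q := by
    refine ⟨fun k => ∏ i : Fin k, ∏ _j ∈ Ioi i, (-1 : ℝ), fun k => ?_, fun k q hq => ?_⟩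
    · change (∏ i : Fin (k + 1), ∏ _j ∈ Ioi i, (-1 : ℝ)) =
        (-1) ^ k * ∏ i : Fin k, ∏ _j ∈ Ioi i, (-1 : ℝ)
      rw [Fin.prod_univ_succ]
      congr 1
      · rw [Fin.prod_Ioi_zero (fun _ => (-1 : ℝ))]; simp
      · exact prod_congr rfl fun i _ => Fin.prod_Ioi_succ (fun _ => (-1 : ℝ)) i
    · unfold schurProd
      simp only [← prod_mul_distrib]
      refine prod_congr rfl fun i _ => prod_congr rfl fun j _ => ?_
      rw [schurFactor_inv (hq i) (hq j)]; ring
  have hb : ∀ (ζ : Fin n → ℝ), (∀ i, 0 < ζ i) → ∀ k (Φ : Fin k → Fin n → ℝ),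
      bracket (fun i => (ζ i)⁻¹) Φ = s k * bracket ζ Φ := by
    intro ζ hζ k Φ
    unfold bracket
    rw [mul_sum]
    refine sum_congr rfl fun p _ => ?_
    rw [hs0 k (fun i => ζ (p i)) fun i => hζ _]; ring
  have hsq : ∀ k, s k * s k = s 0 * s 0 := by
    intro k
    induction k with
    | zero => rfl
    | succ k ih => rw [hs1, ← ih]; linear_combination (s k * s k) * neg_one_pow_mul_self k
  have h0 : s 0 = 1 := by
    have := hs0 0 Fin.elim0 fun i => i.elim0
    simpa [schurProd] using this.symm
  refine ⟨s m, by rw [hsq, h0]; ring, fun ζ hζ =>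
    ⟨hb ζ hζ m, fun Φ => ?_, fun Φ => ?_, fun Φ => ?_⟩⟩
  · rw [hb ζ hζ, hs1]
  · rw [hb ζ hζ, hs1, hs1, pow_succ]
    linear_combination -(s m * bracket ζ Φ) * hs
  · rw [hb ζ hζ, hs1, hs1, hs1, pow_succ, pow_succ]
    linear_combination -((-1) ^ m * s m * bracket ζ Φ) * hs

/-- For the inverse spectrum, `pairing` has bimoments as values as well, with the raised exponent
in the other argument. -/
lemma pairing_inv_specPow (ζ b : Fin n → ℝ) (hζ : ∀ i, 0 < ζ i) (a c : ℤ) :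
    pairing (fun i => (ζ i)⁻¹) (specPow ζ b a) (specPow ζ b c) = bimoment ζ b (a + 1) c := by
  rw [bimoment_comm, ← pairing_specPow ζ b hζ, pairing, pairing, skewForm_antisymm ζ,
    mul_comm (mass _)]
  congr 2
  simp only [skewForm, ← sum_neg_distrib]
  refine sum_congr rfl fun p _ => sum_congr rfl fun q _ => ?_
  rw [schurFactor_inv (hζ p) (hζ q)]; ring

/-- `massMinor_cons_cons_cons` for the inverse spectrum, in terms of brackets for the original
one. -/
lemma massMinor_inv (ζ : Fin n → ℝ) (hζ : ∀ i, 0 < ζ i) {m : ℕ} (x x' y : Fin n → ℝ)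
    (S : Fin m → Fin n → ℝ) :
    2 ^ (m + 1) * massMinor (fun i => (ζ i)⁻¹)
        (Fin.cons x (Fin.cons x' S : Fin (m + 1) → Fin n → ℝ) : Fin (m + 2) → Fin n → ℝ)
        (Fin.cons y S : Fin (m + 1) → Fin n → ℝ) =
      bracket ζ (Fin.cons x (Fin.cons x' S : Fin (m + 1) → Fin n → ℝ) :
          Fin (m + 2) → Fin n → ℝ) *
        bracket ζ (Fin.cons y S : Fin (m + 1) → Fin n → ℝ) -
      bracket ζ S * bracket ζ (Fin.cons x (Fin.cons x' (Fin.cons y S :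
        Fin (m + 1) → Fin n → ℝ) : Fin (m + 2) → Fin n → ℝ) : Fin (m + 3) → Fin n → ℝ) := by
  obtain ⟨s, hs, h⟩ := exists_bracket_inv (n := n) m
  obtain ⟨h0, h1, h2, h3⟩ := h ζ hζ
  rw [massMinor_cons_cons_cons _ (fun i => inv_pos.mpr (hζ i)), h0, h1, h2, h3, pow_succ]
  have hm := neg_one_pow_mul_self m
  generalize ((-1 : ℝ) ^ m) = e at *
  generalize bracket ζ S = A
  generalize bracket ζ (Fin.cons x (Fin.cons x' S : Fin (m + 1) → Fin n → ℝ) :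
          Fin (m + 2) → Fin n → ℝ) = B
  generalize bracket ζ (Fin.cons y S : Fin (m + 1) → Fin n → ℝ) = C
  generalize bracket ζ (Fin.cons x (Fin.cons x' (Fin.cons y S :
        Fin (m + 1) → Fin n → ℝ) : Fin (m + 2) → Fin n → ℝ) : Fin (m + 3) → Fin n → ℝ) = D
  linear_combination (B * C - A * D) * (s * s * hm + hs)

end Bimoments

/-! ### Bordered Gram matrices -/

section Bordered

lemma det_bordered {m : ℕ} (G : Matrix (Fin m) (Fin m) ℝ) (hG : G.det ≠ 0) (d : ℝ)
    (r c : Fin m → ℝ) :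
    (bordered G d r c).det = G.det * (d - r ⬝ᵥ G⁻¹.mulVec c) := by
  let e : Fin 1 ⊕ Fin m ≃ Fin (m + 1) := finSumFinEquiv.trans (finCongr (add_comm 1 m))
  have e0 : ∀ i, e (Sum.inl i) = 0 := fun i => by ext; simp [e]
  have e1 : ∀ i, e (Sum.inr i) = Fin.succ i := fun i => by ext; simp [e]
  have h : (bordered G d r c).submatrix e e = Matrix.fromBlocks (Matrix.of fun _ _ => d)
      (Matrix.of fun _ j => r j) (Matrix.of fun i _ => c i) G := by
    ext i j
    rcases i with i | i <;> rcases j with j | j <;> simp [e0, e1, bordered]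
  have : Invertible G := Matrix.invertibleOfIsUnitDet G (Ne.isUnit hG)
  rw [← Matrix.det_submatrix_equiv_self e, h, Matrix.det_fromBlocks₂₂, Matrix.det_fin_one,
    Matrix.invOf_eq_nonsing_inv]
  congr 1
  simp only [Matrix.sub_apply, Matrix.of_apply, Matrix.mul_apply, dotProduct, Matrix.mulVec]
  congr 1
  simp only [sum_mul, mul_sum]
  rw [sum_comm]
  simp only [mul_assoc]

lemma det_bordered_one {m : ℕ} (G : Matrix (Fin m) (Fin m) ℝ) (r c : Fin m → ℝ) :
    (bordered G 1 r c).det = (Matrix.of fun i j => G i j - c i * r j).det := by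
  let e : Fin 1 ⊕ Fin m ≃ Fin (m + 1) := finSumFinEquiv.trans (finCongr (add_comm 1 m))
  have e0 : ∀ i, e (Sum.inl i) = 0 := fun i => by ext; simp [e]
  have e1 : ∀ i, e (Sum.inr i) = Fin.succ i := fun i => by ext; simp [e]
  have h : (bordered G 1 r c).submatrix e e = Matrix.fromBlocks 1
      (Matrix.of fun _ j => r j) (Matrix.of fun i _ => c i) G := by
    ext i j
    rcases i with i | i <;> rcases j with j | j <;>
      simp [e0, e1, bordered, Subsingleton.elim (_ : Fin 1) 0]
  rw [← Matrix.det_submatrix_equiv_self e, h, Matrix.det_fromBlocks_one₁₁]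
  congr 1
  ext i j
  simp [Matrix.mul_apply]

/-- The Desnanot–Jacobi identity for an invertible central block. -/
lemma det_bordered_bordered {m : ℕ} (G : Matrix (Fin m) (Fin m) ℝ) (hG : G.det ≠ 0)
    (d d₁ d₂ d' : ℝ) (r c r' c' : Fin m → ℝ) :
    (bordered (bordered G d' r' c') d (Fin.cons d₁ r) (Fin.cons d₂ c)).det * G.det =
      (bordered G d r c).det * (bordered G d' r' c').det -
        (bordered G d₁ r c').det * (bordered G d₂ r' c).det := by
  let e : Fin 2 ⊕ Fin m ≃ Fin (m + 2) := finSumFinEquiv.trans (finCongr (add_comm 2 m))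
  have e0 : e (Sum.inl 0) = 0 := by ext; simp [e]
  have e0' : e (Sum.inl 1) = Fin.succ 0 := by ext; simp [e]
  have e1 : ∀ i, e (Sum.inr i) = Fin.succ (Fin.succ i) := fun i => by
    ext; simp [e]
  have h : (bordered (bordered G d' r' c') d (Fin.cons d₁ r) (Fin.cons d₂ c)).submatrix e e =
      Matrix.fromBlocks !![d, d₁; d₂, d'] (Matrix.of ![r, r'])
        (Matrix.of fun i => ![c i, c' i]) G := by
    ext i j
    rcases i with i | i <;> rcases j with j | j
    · fin_cases i <;> fin_cases j <;> simp [e0, e0', bordered]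
    · fin_cases i <;> simp [e0, e0', e1, bordered]
    · fin_cases j <;> simp [e0, e0', e1, bordered]
    · simp [e1, bordered]
  have : Invertible G := Matrix.invertibleOfIsUnitDet G (Ne.isUnit hG)
  rw [← Matrix.det_submatrix_equiv_self e, h, Matrix.det_fromBlocks₂₂, Matrix.det_fin_two,
    Matrix.invOf_eq_nonsing_inv, det_bordered G hG, det_bordered G hG, det_bordered G hG,
    det_bordered G hG]
  have hm : ∀ i j : Fin 2, ((Matrix.of ![r, r']) * G⁻¹ * (Matrix.of fun i => ![c i, c' i])) i j =
      ![r, r'] i ⬝ᵥ G⁻¹.mulVec (fun k => ![c k, c' k] j) := by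
    intro i j
    simp only [Matrix.mul_apply, Matrix.of_apply, dotProduct, Matrix.mulVec, sum_mul, mul_sum]
    rw [sum_comm]
    simp only [mul_assoc]
  simp only [Matrix.sub_apply, hm]
  simp
  ring

variable {n : ℕ}

/-- The bimoments with exponents `0` and `1 + j`. -/
noncomputable def lowVec (ζ b : Fin n → ℝ) (m : ℕ) : Fin m → ℝ :=
  fun j => bimoment ζ b 0 (1 + (j : ℕ))

/-- The bimoments with exponents `1 + m` and `1 + j`. -/
noncomputable def highVec (ζ b : Fin n → ℝ) (m : ℕ) : Fin m → ℝ :=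
  fun j => bimoment ζ b (1 + m) (1 + (j : ℕ))

/-- The moments with exponents `a + j`. -/
noncomputable def momVec (ζ b : Fin n → ℝ) (a : ℤ) (m : ℕ) : Fin m → ℝ :=
  fun j => moment ζ b (a + (j : ℕ))

lemma bordered_last (ζ b : Fin n → ℝ) (a c : ℤ) (m : ℕ) :
    (bordered (gramMat ζ b a c m) (bimoment ζ b (a + m) (c + m))
      (fun j => bimoment ζ b (a + m) (c + (j : ℕ)))
      fun i => bimoment ζ b (a + (i : ℕ)) (c + m)).det = (gramMat ζ b a c (m + 1)).det := by
  have hc := cons_succAbove_eq_comp_cycleRange (fun i : Fin (m + 1) => (i : ℕ)) (Fin.last m)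
  rw [← Matrix.det_submatrix_equiv_self (Fin.last m).cycleRange.symm (gramMat ζ b a c (m + 1))]
  congr 1
  ext i j
  have hi := congrFun hc i
  have hj := congrFun hc j
  simp only [gramMat, Matrix.submatrix_apply, Matrix.of_apply, ← hi, ← hj, bordered]
  refine Fin.cases ?_ (fun i => ?_) i <;> refine Fin.cases ?_ (fun j => ?_) j <;> simp

lemma bordered_low_low (ζ b : Fin n → ℝ) (m : ℕ) :
    bordered (gramMat ζ b 1 1 m) (bimoment ζ b 0 0) (lowVec ζ b m) (lowVec ζ b m) =
      gramMat ζ b 0 0 (m + 1) := by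
  ext i j
  refine Fin.cases ?_ (fun i => ?_) i <;> refine Fin.cases ?_ (fun j => ?_) j <;>
    simp [bordered, gramMat, lowVec, add_comm, bimoment_comm ζ b _ 0]

lemma bordered_high_high (ζ b : Fin n → ℝ) (m : ℕ) :
    (bordered (gramMat ζ b 1 1 m) (bimoment ζ b (1 + m) (1 + m)) (highVec ζ b m)
      (highVec ζ b m)).det = (gramMat ζ b 1 1 (m + 1)).det := by
  rw [← bordered_last]
  congr 2
  funext i
  exact bimoment_comm _ _ _ _

lemma bordered_low_high (ζ b : Fin n → ℝ) (m : ℕ) :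
    (bordered (gramMat ζ b 1 1 m) (bimoment ζ b 0 (1 + m)) (lowVec ζ b m)
      (highVec ζ b m)).det = (-1) ^ m * (gramMat ζ b 0 1 (m + 1)).det := by
  have hc := cons_succAbove_eq_comp_cycleRange (fun i : Fin (m + 1) => (i : ℕ)) (Fin.last m)
  have hs := sign_cycleRange_symm (Fin.last m)
  rw [Fin.val_last] at hs
  rw [← hs, ← Matrix.det_permute']
  congr 1
  ext i j
  have hj := congrFun hc j
  simp only [gramMat, Matrix.submatrix_apply, Matrix.of_apply, ← hj, bordered, id]
  refine Fin.cases ?_ (fun i => ?_) i <;> refine Fin.cases ?_ (fun j => ?_) j <;>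
    simp [lowVec, highVec, bimoment_comm ζ b (m + 1 : ℤ), add_comm (1 : ℤ)]

lemma transpose_bordered {m : ℕ} (G : Matrix (Fin m) (Fin m) ℝ) (d : ℝ) (r c : Fin m → ℝ) :
    (bordered G d r c).transpose = bordered G.transpose d c r := by
  ext i j
  refine Fin.cases ?_ (fun i => ?_) i <;> refine Fin.cases ?_ (fun j => ?_) j <;>
    simp [bordered]

lemma transpose_gramMat (ζ b : Fin n → ℝ) (a c : ℤ) (m : ℕ) :
    (gramMat ζ b a c m).transpose = gramMat ζ b c a m := by
  ext i j
  simp [gramMat, bimoment_comm ζ b (a + _)]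

/-- The quadratic relation between consecutive Gram determinants. -/
lemma det_gramMat_condensation (ζ b : Fin n → ℝ) (m : ℕ) (hG : (gramMat ζ b 1 1 m).det ≠ 0) :
    (gramMat ζ b 0 0 (m + 2)).det * (gramMat ζ b 1 1 m).det =
      (gramMat ζ b 1 1 (m + 1)).det * (gramMat ζ b 0 0 (m + 1)).det -
        (gramMat ζ b 0 1 (m + 1)).det ^ 2 := by
  have h := det_bordered_bordered _ hG (bimoment ζ b (1 + m) (1 + m)) (bimoment ζ b 0 (1 + m))
    (bimoment ζ b 0 (1 + m)) (bimoment ζ b 0 0) (highVec ζ b m) (highVec ζ b m) (lowVec ζ b m)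
    (lowVec ζ b m)
  have ht : (bordered (gramMat ζ b 1 1 m) (bimoment ζ b 0 (1 + m)) (highVec ζ b m)
      (lowVec ζ b m)).det = (-1) ^ m * (gramMat ζ b 0 1 (m + 1)).det := by
    rw [← bordered_low_high, ← Matrix.det_transpose, transpose_bordered, transpose_gramMat]
  rw [bordered_low_low, bordered_high_high, bordered_low_high, ht] at h
  have hcons : (Fin.cons (bimoment ζ b 0 (1 + m)) (highVec ζ b m) : Fin (m + 1) → ℝ) =
      fun j : Fin (m + 1) => bimoment ζ b (0 + (m + 1 : ℕ)) (0 + (j : ℕ)) := by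
    funext j
    refine Fin.cases ?_ (fun j => ?_) j <;>
      simp [highVec, bimoment_comm ζ b 0, add_comm]
  have hcons' : (Fin.cons (bimoment ζ b 0 (1 + m)) (highVec ζ b m) : Fin (m + 1) → ℝ) =
      fun j : Fin (m + 1) => bimoment ζ b (0 + (j : ℕ)) (0 + (m + 1 : ℕ)) := by
    rw [hcons]; funext j; exact bimoment_comm _ _ _ _
  have hlast := bordered_last ζ b 0 0 (m + 1)
  rw [← hcons, ← hcons', show (0 : ℤ) + (m + 1 : ℕ) = 1 + m by push_cast; ring] at hlast
  rw [hlast] at h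
  rw [h]
  linear_combination -(gramMat ζ b 0 1 (m + 1)).det ^ 2 * neg_one_pow_mul_self m

lemma bimoment_succ_add (ζ b : Fin n → ℝ) (hζ : ∀ i, 0 < ζ i) (a c : ℤ) :
    bimoment ζ b (a + 1) c + bimoment ζ b a (c + 1) = moment ζ b a * moment ζ b c := by
  simp only [bimoment, moment, sum_mul_sum, ← sum_add_distrib]
  refine sum_congr rfl fun p _ => sum_congr rfl fun q _ => ?_
  have h1 : ζ p + ζ q ≠ 0 := by linarith [hζ p, hζ q] |> ne_of_gt
  rw [zpow_add_one₀ (hζ q).ne', zpow_add_one₀ (hζ p).ne']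
  field_simp

end Bordered

/-! ### Positivity of the Gram determinants -/

section Positivity

variable {n : ℕ}

/-- The Cauchy kernel is positive semidefinite, since `1 / (x + y)` is the integral of
`exp (-s x) * exp (-s y)`. -/
lemma cauchy_kernel_nonneg (ζ : Fin n → ℝ) (hζ : ∀ i, 0 < ζ i) (f : Fin n → ℝ) :
    0 ≤ ∑ p, ∑ q, f p * f q / (ζ p + ζ q) := by
  have hint : ∀ p q, MeasureTheory.IntegrableOn
      (fun s : ℝ => f p * f q * Real.exp (-(ζ p + ζ q) * s)) (Set.Ioi 0) := fun p q =>
    (integrableOn_exp_mul_Ioi (by linarith [hζ p, hζ q]) 0).const_mul _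
  have h : ∑ p, ∑ q, f p * f q / (ζ p + ζ q) =
      ∫ s in Set.Ioi (0 : ℝ), (∑ p, f p * Real.exp (-ζ p * s)) ^ 2 := by
    have h1 : ∀ s : ℝ, (∑ p, f p * Real.exp (-ζ p * s)) ^ 2 =
        ∑ p, ∑ q, f p * f q * Real.exp (-(ζ p + ζ q) * s) := by
      intro s
      rw [sq, sum_mul_sum]
      refine sum_congr rfl fun p _ => sum_congr rfl fun q _ => ?_
      rw [neg_add, add_mul, Real.exp_add]; ring
    simp only [h1]
    rw [MeasureTheory.integral_finsetSum _ fun p _ => MeasureTheory.integrable_finsetSum _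
      fun q _ => hint p q]
    refine sum_congr rfl fun p _ => ?_
    rw [MeasureTheory.integral_finsetSum _ fun q _ => hint p q]
    refine sum_congr rfl fun q _ => ?_
    have hpq : -(ζ p + ζ q) < 0 := by linarith [hζ p, hζ q]
    rw [MeasureTheory.integral_const_mul, integral_exp_mul_Ioi hpq]
    simp only [mul_zero, Real.exp_zero]
    rw [div_neg, neg_div, neg_neg, mul_one_div]
  rw [h]
  exact MeasureTheory.integral_nonneg fun s => sq_nonneg _

lemma det_gramMat_nonneg (ζ b : Fin n → ℝ) (hζ : ∀ i, 0 < ζ i) (a : ℤ) (m : ℕ) :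
    0 ≤ (gramMat ζ b a a m).det := by
  have hK : (Matrix.of fun p q => 1 / (ζ p + ζ q)).PosSemidef := by
    refine Matrix.PosSemidef.of_dotProduct_mulVec_nonneg ?_ fun x => ?_
    · ext p q
      simp [add_comm]
    · refine (cauchy_kernel_nonneg ζ hζ x).trans_eq ?_
      simp only [dotProduct, Matrix.mulVec, Matrix.of_apply, Pi.star_apply, star_trivial, mul_sum]
      exact sum_congr rfl fun p _ => sum_congr rfl fun q _ => by ring
  have hG : gramMat ζ b a a m =
      (Matrix.of fun p (i : Fin m) => b p * ζ p ^ (a + (i : ℕ))).conjTranspose *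
      (Matrix.of fun p q => 1 / (ζ p + ζ q)) *
      (Matrix.of fun p (i : Fin m) => b p * ζ p ^ (a + (i : ℕ))) := by
    ext i j
    simp only [gramMat, bimoment, Matrix.mul_apply, Matrix.of_apply, Matrix.conjTranspose_apply,
      star_trivial, sum_mul]
    rw [sum_comm]
    exact sum_congr rfl fun p _ => sum_congr rfl fun q _ => by ring
  rw [hG]
  exact (hK.conjTranspose_mul_mul_same _).det_nonneg

lemma det_gramMat_pos (ζ b : Fin n → ℝ) (hζ : ∀ i, 0 < ζ i) (hmono : StrictMono ζ)
    (hb : ∀ i, 0 < b i) {m : ℕ} (hm : m ≤ n) :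
    0 < (gramMat ζ b 1 1 m).det ∧ 0 < (gramMat ζ b 0 0 m).det := by
  induction m with
  | zero => simp
  | succ m ih =>
    have h1 := (ih (by omega)).1
    have h2 := det_gramMat_condensation ζ b m h1.ne'
    have h3 := det_gramMat_nonneg ζ b hζ 0 (m + 2)
    have h4 := det_gramMat_nonneg ζ b hζ 0 (m + 1)
    have h5 := det_gramMat_nonneg ζ b hζ 1 (m + 1)
    have h6 : (gramMat ζ b 0 1 (m + 1)).det ≠ 0 := by
      have := det_gramMat_add_one ζ b hζ 0 (m + 1)
      have hU := spectralSum_pos ζ b hζ hmono hb 0 hm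
      intro h0
      rw [zero_add, h0, mul_zero] at this
      exact (pow_pos hU 2).ne this
    -- a vanishing factor would leave a negative right-hand side
    have h7 : 0 < (gramMat ζ b 1 1 (m + 1)).det * (gramMat ζ b 0 0 (m + 1)).det := by
      have := mul_nonneg h3 h1.le
      have := sq_pos_of_ne_zero h6
      linarith
    exact ⟨lt_of_le_of_ne h5 fun h => by simp [← h] at h7,
      lt_of_le_of_ne h4 fun h => by simp [← h] at h7⟩

end Positivity

/-! ### The bordered determinants in terms of the spectral sums -/

section Formulas

variable {n : ℕ}

lemma W_eq_det (ζ b : Fin n → ℝ) (hζ : ∀ i, 0 < ζ i) (m : ℕ) :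
    W ζ b m = 2 ^ m * (gramMat ζ b 1 1 m).det := by
  cases m with
  | zero =>
    simp [W, V, U, spectralSum_zero, spectralSum_eq_zero_of_neg]
  | succ m =>
    have h := det_gramMat_same ζ b hζ 1 m
    rw [h, W, V, V, U, U, sub_self]
    push_cast
    ring_nf

lemma Z_eq_det (ζ b : Fin n → ℝ) (hζ : ∀ i, 0 < ζ i) (m : ℕ) :
    Z ζ b (m + 1) = 2 ^ (m + 1) * (gramMat ζ b 0 0 (m + 1)).det := by
  have h := det_gramMat_same ζ b hζ 0 m
  rw [h, Z, T, T, U, U, zero_sub, add_sub_cancel_right]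
  push_cast
  ring_nf

lemma U_sq_eq_det (ζ b : Fin n → ℝ) (hζ : ∀ i, 0 < ζ i) (m : ℕ) :
    U ζ b m ^ 2 = 2 ^ m * (gramMat ζ b 0 1 m).det := by
  have h := det_gramMat_add_one ζ b hζ 0 m
  rw [zero_add] at h
  rw [h, U]

lemma Z_mul_W_sub (ζ b : Fin n → ℝ) (hζ : ∀ i, 0 < ζ i) (m : ℕ)
    (hG : (gramMat ζ b 1 1 m).det ≠ 0) :
    Z ζ b (m + 1) * W ζ b (m + 1) - Z ζ b (m + 2) * W ζ b m = U ζ b (m + 1) ^ 4 := by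
  have h1 := Z_eq_det ζ b hζ m
  have h2 := W_eq_det ζ b hζ (m + 1)
  have h3 := Z_eq_det ζ b hζ (m + 1)
  have h4 := W_eq_det ζ b hζ m
  have h5 := U_sq_eq_det ζ b hζ (m + 1)
  have h6 := det_gramMat_condensation ζ b m hG
  push_cast at h2 h3 h5
  rw [add_assoc, one_add_one_eq_two] at h3
  rw [h1, h2, h3, h4, show U ζ b (m + 1) ^ 4 = (U ζ b (m + 1) ^ 2) ^ 2 by ring, h5]
  simp only [pow_succ]
  linear_combination (-(2 ^ m) ^ 2 * 4) * h6

/-- The bordered matrix of `U_{m+1} U_m`. -/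
lemma det_bordered_mom_low (ζ b : Fin n → ℝ) (hζ : ∀ i, 0 < ζ i) (m : ℕ) :
    2 ^ m * (bordered (gramMat ζ b 1 1 m) (moment ζ b 0) (lowVec ζ b m) (momVec ζ b 1 m)).det =
      (-1) ^ m * (U ζ b (m + 1) * U ζ b m) := by
  have h := massMinor_cons ζ hζ (specPow ζ b (0 + m)) (consec ζ b 0 m)
  rw [massMinor_cons_consec_left, bracket_cons_consec, bracket_consec ζ b hζ,
    bracket_consec ζ b hζ] at h
  have hm : bordered (gramMat ζ b 1 1 m) (moment ζ b 0) (lowVec ζ b m) (momVec ζ b 1 m) =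
      Matrix.of fun i j => (Fin.cons (mass (consec ζ b 0 (m + 1) i)) fun j =>
        pairing ζ (consec ζ b 0 (m + 1) i) (consec ζ b 0 m j) : Fin (m + 1) → ℝ) j := by
    ext i j
    refine Fin.cases ?_ (fun i => ?_) i <;> refine Fin.cases ?_ (fun j => ?_) j <;>
      simp [bordered, gramMat, lowVec, momVec, consec, mass_specPow, pairing_specPow ζ b hζ,
        add_comm (1 : ℤ)]
  rw [hm]
  change 2 ^ m * massMinor ζ (consec ζ b 0 (m + 1)) (consec ζ b 0 m) = _
  have hs := neg_one_pow_mul_self m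
  refine mul_left_cancel₀ (pow_ne_zero m (by norm_num : (-1 : ℝ) ≠ 0)) ?_
  rw [U, U]
  push_cast at h
  linear_combination h

lemma spectralSum_one (ζ b : Fin n → ℝ) (hζ : ∀ i, 0 < ζ i) (a : ℤ) :
    spectralSum a ζ b 1 = moment ζ b a := by
  have h := bracket_consec ζ b hζ a 1
  rw [consec_succ, bracket_cons_zero, mass_specPow] at h
  exact_mod_cast h.symm

/-- The bordered matrix of `T_{m+1} V_m - T_{m+2} V_{m-1}`, read as a minor for the inverse
spectrum. -/
lemma det_bordered_mom_neg_one_low (ζ b : Fin n → ℝ) (hζ : ∀ i, 0 < ζ i) (m : ℕ) :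
    2 ^ m *
      (bordered (gramMat ζ b 1 1 m) (moment ζ b (-1)) (lowVec ζ b m) (momVec ζ b 0 m)).det =
      T ζ b (m + 1) * V ζ b m - T ζ b (m + 2) * V ζ b (m - 1) := by
  cases m with
  | zero =>
    simp [bordered, T, V, spectralSum_zero, spectralSum_eq_zero_of_neg, spectralSum_one ζ b hζ]
  | succ m =>
    have h := massMinor_inv ζ hζ (specPow ζ b (-1)) (specPow ζ b 0) (specPow ζ b (1 + m))
      (consec ζ b 1 m)
    have h0 : (Fin.cons (specPow ζ b (-1)) (Fin.cons (specPow ζ b 0) (consec ζ b 1 m) :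
        Fin (m + 1) → Fin n → ℝ) : Fin (m + 2) → Fin n → ℝ) = consec ζ b (-1) (m + 2) := by
      rw [consec_succ ζ b (-1), consec_succ]; norm_num
    have h4 : bracket ζ (Fin.cons (specPow ζ b (-1)) (Fin.cons (specPow ζ b 0)
        (Fin.cons (specPow ζ b (1 + m)) (consec ζ b 1 m) : Fin (m + 1) → Fin n → ℝ) :
          Fin (m + 2) → Fin n → ℝ) : Fin (m + 3) → Fin n → ℝ) =
        (-1) ^ m * spectralSum (-1) ζ b (m + 3) := by
      have h5 : (Fin.cons (specPow ζ b (-1)) (Fin.cons (specPow ζ b 0)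
          (consec ζ b 1 (m + 1)) : Fin (m + 2) → Fin n → ℝ) : Fin (m + 3) → Fin n → ℝ) =
          consec ζ b (-1) (m + 3) := by
        rw [consec_succ ζ b (-1), show (-1 : ℤ) + 1 = 0 by norm_num, consec_succ ζ b 0, zero_add]
      rw [cons_consec_eq_front, bracket_cons_cons_front, h5, bracket_consec ζ b hζ, Fin.val_last]
      push_cast
      rfl
    rw [h4, h0, massMinor_cons_consec_right, bracket_cons_consec, bracket_consec ζ b hζ,
      bracket_consec ζ b hζ, bracket_consec ζ b hζ] at h
    have hm : bordered (gramMat ζ b 1 1 (m + 1)) (moment ζ b (-1)) (lowVec ζ b (m + 1))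
        (momVec ζ b 0 (m + 1)) = Matrix.of fun i j => (Fin.cons (mass (consec ζ b (-1) (m + 2) i))
        fun j => pairing (fun i => (ζ i)⁻¹) (consec ζ b (-1) (m + 2) i)
          (consec ζ b 1 (m + 1) j) : Fin (m + 2) → ℝ) j := by
      ext i j
      refine Fin.cases ?_ (fun i => ?_) i <;> refine Fin.cases ?_ (fun j => ?_) j <;>
        simp [bordered, gramMat, lowVec, momVec, consec, mass_specPow,
          pairing_inv_specPow ζ b hζ, add_comm (1 : ℤ)]
    rw [hm]
    change 2 ^ (m + 1) * massMinor (fun i => (ζ i)⁻¹) (consec ζ b (-1) (m + 2))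
      (consec ζ b 1 (m + 1)) = _
    refine mul_left_cancel₀ (pow_ne_zero m (by norm_num : (-1 : ℝ) ≠ 0)) ?_
    rw [T, T, V, V]
    push_cast at h ⊢
    rw [add_sub_cancel_right, show (m : ℤ) + 1 + 1 = m + 2 by ring,
      show (m : ℤ) + 1 + 2 = m + 3 by ring]
    simp only [show (m : ℤ) + 1 + 1 = m + 2 by ring] at h
    linear_combination h

/-- The bordered matrix of `V_m U_m + V_{m-1} U_{m+1}`; subtracting the rank one matrix of the
border from the bimoments `I_{i, j}` leaves `-I_{i+1, j-1}`. -/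
lemma det_bordered_mom_mom (ζ b : Fin n → ℝ) (hζ : ∀ i, 0 < ζ i) (m : ℕ) :
    2 ^ m * (bordered (gramMat ζ b 1 1 m) 1 (momVec ζ b 0 m) (momVec ζ b 1 m)).det =
      (-1) ^ m * (V ζ b m * U ζ b m + V ζ b (m - 1) * U ζ b (m + 1)) := by
  rw [det_bordered_one]
  have h : (Matrix.of fun i j => gramMat ζ b 1 1 m i j - momVec ζ b 1 m i * momVec ζ b 0 m j) =
      -(gramMat ζ b 0 2 m).transpose := by
    ext i j
    have := bimoment_succ_add ζ b hζ (1 + (i : ℕ)) (j : ℕ)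
    simp only [gramMat, momVec, Matrix.of_apply, Matrix.neg_apply, Matrix.transpose_apply, zero_add,
      bimoment_comm ζ b (j : ℕ)]
    rw [← this, add_comm (1 : ℤ) (j : ℕ), show (2 : ℤ) + (i : ℕ) = 1 + (i : ℕ) + 1 by ring]
    ring
  rw [h, Matrix.det_neg, Matrix.det_transpose, Fintype.card_fin]
  cases m with
  | zero => simp [U, V, spectralSum_zero, spectralSum_eq_zero_of_neg]
  | succ m =>
    have h2 := det_gramMat_add_two ζ b hζ 0 m
    rw [zero_add, zero_add] at h2
    rw [U, U, V, V]
    push_cast at h2 ⊢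
    rw [add_sub_cancel_right, show (m : ℤ) + 1 + 1 = m + 2 by ring]
    linear_combination (-1) ^ (m + 1) * h2

/-- The minor of `V_{m+1} U_m - V_{m-1} U_{m+2}` has the rows `b ζ, …, b ζ^(m+1)`, last one first,
and the columns `b, …, b ζ^(m-1)`. -/
lemma massMinor_cons_consec (ζ b : Fin n → ℝ) (hζ : ∀ i, 0 < ζ i) (m : ℕ) :
    2 ^ m * massMinor ζ (Fin.cons (specPow ζ b (1 + m)) (consec ζ b 1 m) :
        Fin (m + 1) → Fin n → ℝ) (consec ζ b 0 m) =
      V ζ b (m + 1) * U ζ b m - V ζ b (m - 1) * U ζ b (m + 2) := by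
  cases m with
  | zero =>
    rw [massMinor_zero, Fin.cons_zero, mass_specPow]
    simp [U, V, spectralSum_zero, spectralSum_eq_zero_of_neg, spectralSum_one ζ b hζ]
  | succ m =>
    -- interchange the first two rows of a minor or entries of a bracket by moving the last entry
    -- of `1 + (m + 1), 1, …, 1 + m` to the front
    have hfront : ∀ (a : ℤ) (l : ℕ) (u : Fin n → ℝ),
        (Fin.cons (specPow ζ b (a + l)) (Fin.cons u (consec ζ b a l) : Fin (l + 1) → Fin n → ℝ) :
          Fin (l + 2) → Fin n → ℝ) =
        Fin.cons ((Fin.cons u (consec ζ b a (l + 1)) : Fin (l + 2) → Fin n → ℝ)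
          (Fin.last l).succ) fun i => (Fin.cons u (consec ζ b a (l + 1)) :
            Fin (l + 2) → Fin n → ℝ) ((Fin.last l).succ.succAbove i) := by
      intro a l u
      rw [cons_cons_succAbove_succ]
      funext i
      refine Fin.cases (by simp [consec]) (fun i => Fin.cases (by simp) (fun i => ?_) i) i
      simp [consec]
    have hbr : ∀ (a : ℤ) (l : ℕ),
        bracket ζ (Fin.cons (specPow ζ b (a + l)) (Fin.cons (specPow ζ b (a + (l + 1 : ℕ)))
          (consec ζ b a l) : Fin (l + 1) → Fin n → ℝ) : Fin (l + 2) → Fin n → ℝ) =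
        spectralSum a ζ b (l + 2 : ℕ) := by
      intro a l
      rw [hfront, bracket_front, bracket_cons_consec, bracket_consec ζ b hζ, Fin.val_succ,
        Fin.val_last]
      linear_combination (spectralSum a ζ b (l + 2 : ℕ)) * neg_one_pow_mul_self (l + 1)
    have h := massMinor_cons_cons_cons ζ hζ (specPow ζ b (1 + m))
      (specPow ζ b (1 + (m + 1 : ℕ))) (specPow ζ b 0) (consec ζ b 1 m)
    have h0 : (Fin.cons (specPow ζ b 0) (consec ζ b 1 m) : Fin (m + 1) → Fin n → ℝ) =
        consec ζ b 0 (m + 1) := by rw [consec_succ]; norm_num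
    have h1 : bracket ζ (Fin.cons (specPow ζ b (1 + m)) (Fin.cons (specPow ζ b (1 + (m + 1 : ℕ)))
        (consec ζ b 0 (m + 1)) : Fin (m + 2) → Fin n → ℝ) : Fin (m + 3) → Fin n → ℝ) =
        spectralSum 0 ζ b (m + 1 + 2 : ℕ) := by
      rw [← hbr 0 (m + 1), show (1 : ℤ) + m = 0 + (m + 1 : ℕ) by push_cast; ring,
        show (1 : ℤ) + (m + 1 : ℕ) = 0 + (m + 1 + 1 : ℕ) by push_cast; ring]
    rw [h0, h1, hbr, hfront, massMinor_front_left, bracket_consec ζ b hζ, bracket_consec ζ b hζ,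
      Fin.val_succ, Fin.val_last] at h
    have hs := neg_one_pow_mul_self m
    refine mul_left_cancel₀ (pow_ne_zero (m + 1) (by norm_num : (-1 : ℝ) ≠ 0)) ?_
    rw [U, U, V, V]
    push_cast at h ⊢
    rw [add_sub_cancel_right, show (m : ℤ) + 1 + 1 = m + 2 by ring]
    linear_combination h

lemma det_bordered_high_mom (ζ b : Fin n → ℝ) (hζ : ∀ i, 0 < ζ i) (m : ℕ) :
    2 ^ m *
      (bordered (gramMat ζ b 1 1 m) (moment ζ b (1 + m)) (highVec ζ b m) (momVec ζ b 1 m)).det =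
      V ζ b (m + 1) * U ζ b m - V ζ b (m - 1) * U ζ b (m + 2) := by
  rw [← massMinor_cons_consec ζ b hζ, massMinor]
  congr 2
  ext i j
  refine Fin.cases ?_ (fun i => ?_) i <;> refine Fin.cases ?_ (fun j => ?_) j <;>
    simp [bordered, gramMat, highVec, momVec, consec, mass_specPow, pairing_specPow ζ b hζ,
      add_comm (1 : ℤ)]

/-- The last unit vector. -/
def lastVec (m : ℕ) : Fin (m + 1) → ℝ := Pi.single (Fin.last m) 1

lemma det_bordered_lastVec {m : ℕ} (G : Matrix (Fin (m + 1)) (Fin (m + 1)) ℝ)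
    (r : Fin (m + 1) → ℝ) :
    (bordered G 0 r (lastVec m)).det = (-1) ^ (m + 1) *
      (Matrix.of (Fin.cons r fun i : Fin m => G i.castSucc)).det := by
  rw [Matrix.det_succ_column_zero, Fin.sum_univ_succ, sum_eq_single (Fin.last m)]
  · have h1 : bordered G 0 r (lastVec m) (Fin.last m).succ 0 = 1 := by simp [bordered, lastVec]
    have h0 : bordered G 0 r (lastVec m) 0 0 = 0 := by simp [bordered]
    rw [h1, h0, mul_zero, zero_mul, zero_add, mul_one, Fin.val_succ, Fin.val_last]
    congr 2
    ext i j
    simp only [Fin.succ_last, Fin.succAbove_last, Matrix.submatrix_apply, bordered,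
      Matrix.of_apply]
    refine Fin.cases (by simp) (fun i => ?_) i
    simp
  · intro i _ hi
    have : bordered G 0 r (lastVec m) i.succ 0 = 0 := by simp [bordered, lastVec, hi]
    rw [this]; simp
  · simp

lemma det_bordered_low_last (ζ b : Fin n → ℝ) (hζ : ∀ i, 0 < ζ i) (m : ℕ) :
    2 ^ (m + 1) * (bordered (gramMat ζ b 1 1 (m + 1)) 0 (lowVec ζ b (m + 1)) (lastVec m)).det =
      (-1) ^ (m + 1) * U ζ b (m + 1 : ℕ) ^ 2 := by
  rw [det_bordered_lastVec, U_sq_eq_det ζ b hζ]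
  have : (Matrix.of (Fin.cons (lowVec ζ b (m + 1)) fun i : Fin m =>
      gramMat ζ b 1 1 (m + 1) i.castSucc)) = gramMat ζ b 0 1 (m + 1) := by
    ext i j
    refine Fin.cases ?_ (fun i => ?_) i <;> simp [gramMat, lowVec, add_comm]
  rw [this]; ring

lemma det_bordered_mom_last (ζ b : Fin n → ℝ) (hζ : ∀ i, 0 < ζ i) (m : ℕ) :
    2 ^ m * (bordered (gramMat ζ b 1 1 (m + 1)) 0 (momVec ζ b 1 (m + 1)) (lastVec m)).det =
      -(V ζ b (m + 1) * U ζ b m - V ζ b (m - 1) * U ζ b (m + 2)) := by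
  have h : (Matrix.of (Fin.cons (momVec ζ b 1 (m + 1)) fun i : Fin m =>
      gramMat ζ b 1 1 (m + 1) i.castSucc)).det =
      massMinor ζ (consec ζ b 1 (m + 1)) (consec ζ b 0 m) := by
    rw [massMinor, ← Matrix.det_transpose]
    congr 1
    ext i j
    refine Fin.cases ?_ (fun j => ?_) j <;>
      simp [gramMat, momVec, consec, mass_specPow, pairing_specPow ζ b hζ, add_comm (1 : ℤ),
        bimoment_comm ζ b ((j : ℕ) + 1 : ℤ)]
  have h2 := massMinor_cons_consec ζ b hζ m
  rw [massMinor_cons_consec_left] at h2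
  rw [det_bordered_lastVec, h, ← h2]; ring

/-! ### Signs -/

lemma W_pos (ζ b : Fin n → ℝ) (hζ : ∀ i, 0 < ζ i) (hmono : StrictMono ζ) (hb : ∀ i, 0 < b i)
    {m : ℕ} (hm : m ≤ n) : 0 < W ζ b m := by
  rw [W_eq_det ζ b hζ]
  exact mul_pos (by positivity) (det_gramMat_pos ζ b hζ hmono hb hm).1

lemma Z_pos (ζ b : Fin n → ℝ) (hζ : ∀ i, 0 < ζ i) (hmono : StrictMono ζ) (hb : ∀ i, 0 < b i)
    {m : ℕ} (hm : m + 1 ≤ n) : 0 < Z ζ b (m + 1) := by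
  rw [Z_eq_det ζ b hζ]
  exact mul_pos (by positivity) (det_gramMat_pos ζ b hζ hmono hb hm).2

lemma U_pos (ζ b : Fin n → ℝ) (hζ : ∀ i, 0 < ζ i) (hmono : StrictMono ζ) (hb : ∀ i, 0 < b i)
    {m : ℕ} (hm : m ≤ n) : 0 < U ζ b m :=
  spectralSum_pos ζ b hζ hmono hb 0 hm

end Formulas

/-! ### Derivatives along the flows -/

section Derivatives

lemma hasDerivAt_of_eq {f g : ℝ → ℝ} {a c t : ℝ} (h : HasDerivAt f a t) (hf : ∀ τ, g τ = f τ)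
    (hc : c = a) : HasDerivAt g c t := by
  rw [hc, show g = f from funext hf]; exact h

/-- The Schur complement of `G` in `bordered G d r c`. -/
noncomputable def schurCompl {m : ℕ} (G : Matrix (Fin m) (Fin m) ℝ) (d : ℝ) (r c : Fin m → ℝ) :
    ℝ := d - r ⬝ᵥ G⁻¹.mulVec c

lemma schurCompl_comm {m : ℕ} {G : Matrix (Fin m) (Fin m) ℝ} (hG : G.transpose = G) (d : ℝ)
    (r c : Fin m → ℝ) : schurCompl G d r c = schurCompl G d c r := by
  rw [schurCompl, schurCompl, Matrix.dotProduct_mulVec, ← Matrix.mulVec_transpose,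
    Matrix.transpose_nonsing_inv, hG, dotProduct_comm]

open scoped Matrix.Norms.Operator in
lemma hasDerivAt_matrix_inv {m : ℕ} {G : ℝ → Matrix (Fin m) (Fin m) ℝ}
    {G' : Matrix (Fin m) (Fin m) ℝ} {t : ℝ}
    (hG : ∀ i j, HasDerivAt (fun τ => G τ i j) (G' i j) t) (hdet : (G t).det ≠ 0) (i j : Fin m) :
    HasDerivAt (fun τ => (G τ)⁻¹ i j) (-((G t)⁻¹ * G' * (G t)⁻¹) i j) t := by
  have hsum : ∀ A : Matrix (Fin m) (Fin m) ℝ,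
      A = ∑ i, ∑ j, A i j • Matrix.single i j (1 : ℝ) := by
    intro A
    conv_lhs => rw [Matrix.matrix_eq_sum_single A]
    simp
  have h1 : HasDerivAt G G' t := by
    have : HasDerivAt (fun τ => ∑ i, ∑ j, G τ i j • Matrix.single i j (1 : ℝ))
        (∑ i, ∑ j, G' i j • Matrix.single i j (1 : ℝ)) t :=
      HasDerivAt.fun_sum fun i _ => HasDerivAt.fun_sum fun j _ => (hG i j).smul_const _
    rw [← hsum] at this
    exact this.congr_of_eventuallyEq (Filter.Eventually.of_forall fun τ => hsum (G τ))
  obtain ⟨u, hu⟩ : IsUnit (G t) := (Matrix.isUnit_iff_isUnit_det _).mpr (Ne.isUnit hdet)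
  have h2 := hasFDerivAt_ringInverse (𝕜 := ℝ) u
  rw [hu] at h2
  have h3 := h2.comp_hasDerivAt t h1
  have h4 : ((↑u⁻¹ : Matrix (Fin m) (Fin m) ℝ)) = (G t)⁻¹ := by
    rw [← hu, Matrix.coe_units_inv]
  let L : Matrix (Fin m) (Fin m) ℝ →ₗ[ℝ] ℝ := Matrix.entryLinearMap ℝ ℝ i j
  have h5 := (LinearMap.toContinuousLinearMap L).hasFDerivAt.comp_hasDerivAt t h3
  refine hasDerivAt_of_eq h5 (fun τ => ?_) ?_
  · simp [L, Matrix.nonsing_inv_eq_ringInverse]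
  · simp only [L, h4, neg_apply, ContinuousLinearMap.mulLeftRight_apply]
    rfl

/-- A rank one derivative of the central block makes the derivative of a Schur complement a
product. -/
lemma hasDerivAt_schurCompl {m : ℕ} {G : ℝ → Matrix (Fin m) (Fin m) ℝ} {d : ℝ → ℝ}
    {r c : ℝ → Fin m → ℝ} {w : Fin m → ℝ} {ρ γ : ℝ} {t : ℝ}
    (hG : ∀ i j, HasDerivAt (fun τ => G τ i j) (w i * w j) t) (hdet : (G t).det ≠ 0)
    (hd : HasDerivAt d (ρ * γ) t) (hr : ∀ i, HasDerivAt (fun τ => r τ i) (ρ * w i) t)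
    (hc : ∀ i, HasDerivAt (fun τ => c τ i) (γ * w i) t) :
    HasDerivAt (fun τ => schurCompl (G τ) (d τ) (r τ) (c τ))
      (schurCompl (G t) ρ (r t) w * schurCompl (G t) γ w (c t)) t := by
  have hH := hasDerivAt_matrix_inv (G' := Matrix.of fun i j => w i * w j) hG hdet
  have h : HasDerivAt (fun τ => schurCompl (G τ) (d τ) (r τ) (c τ))
      (ρ * γ - ∑ i, (ρ * w i * (∑ j, (G t)⁻¹ i j * c t j) + r t i * ∑ j,
        (-((G t)⁻¹ * (Matrix.of fun i j => w i * w j) * (G t)⁻¹) i j * c t j +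
          (G t)⁻¹ i j * (γ * w j)))) t := by
    refine hd.sub (HasDerivAt.fun_sum fun i _ => ?_)
    have h0 : HasDerivAt (fun τ => ∑ j, (G τ)⁻¹ i j * c τ j) _ t :=
      HasDerivAt.fun_sum fun j _ => (hH i j).mul (hc j)
    exact (hr i).mul h0
  refine hasDerivAt_of_eq h (fun _ => rfl) ?_
  have e : (G t)⁻¹ * (Matrix.of fun i j => w i * w j) * (G t)⁻¹ =
      Matrix.vecMulVec ((G t)⁻¹.mulVec w) (Matrix.vecMul w (G t)⁻¹) := by
    rw [show (Matrix.of fun i j => w i * w j) = Matrix.vecMulVec w w from rfl,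
      Matrix.mul_vecMulVec, Matrix.vecMulVec_mul]
  rw [e]
  have h1 : ∀ i, ∑ j, (G t)⁻¹ i j * c t j = (G t)⁻¹.mulVec (c t) i := fun i => rfl
  have h2 : ∀ i, ∑ j, (-Matrix.vecMulVec ((G t)⁻¹.mulVec w) (Matrix.vecMul w (G t)⁻¹) i j * c t j +
      (G t)⁻¹ i j * (γ * w j)) = -((G t)⁻¹.mulVec w i * (w ⬝ᵥ (G t)⁻¹.mulVec (c t))) +
        γ * (G t)⁻¹.mulVec w i := by
    intro i
    rw [sum_add_distrib, Matrix.dotProduct_mulVec]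
    congr 1
    · simp only [Matrix.vecMulVec_apply, dotProduct, mul_sum, ← sum_neg_distrib]
      exact sum_congr rfl fun j _ => by ring
    · simp only [Matrix.mulVec, dotProduct, mul_sum]
      exact sum_congr rfl fun j _ => by ring
  simp only [h1, h2, sum_add_distrib, mul_add]
  have h3 : ∑ i, ρ * w i * (G t)⁻¹.mulVec (c t) i = ρ * (w ⬝ᵥ (G t)⁻¹.mulVec (c t)) := by
    simp only [dotProduct, mul_sum, mul_assoc]
  have h4 : ∑ i, r t i * -((G t)⁻¹.mulVec w i * (w ⬝ᵥ (G t)⁻¹.mulVec (c t))) =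
      -((r t ⬝ᵥ (G t)⁻¹.mulVec w) * (w ⬝ᵥ (G t)⁻¹.mulVec (c t))) := by
    generalize w ⬝ᵥ (G t)⁻¹.mulVec (c t) = y
    rw [dotProduct, sum_mul, ← sum_neg_distrib]
    exact sum_congr rfl fun j _ => by ring
  have h5 : ∑ i, r t i * (γ * (G t)⁻¹.mulVec w i) = γ * (r t ⬝ᵥ (G t)⁻¹.mulVec w) := by
    rw [dotProduct, mul_sum]
    exact sum_congr rfl fun j _ => by ring
  rw [h3, h4, h5, schurCompl, schurCompl]
  ring

variable {n : ℕ}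

lemma schurCompl_eq (ζ b : Fin n → ℝ) (hζ : ∀ i, 0 < ζ i) {m : ℕ} (hW : W ζ b m ≠ 0) (d : ℝ)
    (r c : Fin m → ℝ) :
    schurCompl (gramMat ζ b 1 1 m) d r c =
      2 ^ m * (bordered (gramMat ζ b 1 1 m) d r c).det / W ζ b m := by
  have h := W_eq_det ζ b hζ m
  have hG : (gramMat ζ b 1 1 m).det ≠ 0 := fun h0 => hW (by rw [h, h0, mul_zero])
  rw [det_bordered _ hG, h, schurCompl]
  field_simp

lemma hasDerivAt_moment {ζ : Fin n → ℝ} {b : ℝ → Fin n → ℝ} {t : ℝ} {e : ℤ}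
    (hζ : ∀ i, 0 < ζ i) (hb : ∀ j, HasDerivAt (fun τ => b τ j) (b t j * ζ j ^ e) t) (a : ℤ) :
    HasDerivAt (fun τ => moment ζ (b τ) a) (moment ζ (b t) (a + e)) t := by
  have : HasDerivAt (fun τ => moment ζ (b τ) a) (∑ p, b t p * ζ p ^ e * ζ p ^ a) t :=
    HasDerivAt.fun_sum fun p _ => (hb p).mul_const _
  refine hasDerivAt_of_eq this (fun _ => rfl) ?_
  refine sum_congr rfl fun p _ => ?_
  rw [zpow_add₀ (hζ p).ne']; ring

lemma hasDerivAt_bimoment {ζ : Fin n → ℝ} {b : ℝ → Fin n → ℝ} {t : ℝ} {e : ℤ}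
    (hζ : ∀ i, 0 < ζ i) (hb : ∀ j, HasDerivAt (fun τ => b τ j) (b t j * ζ j ^ e) t) (a c : ℤ) :
    HasDerivAt (fun τ => bimoment ζ (b τ) a c)
      (bimoment ζ (b t) (a + e) c + bimoment ζ (b t) a (c + e)) t := by
  have : HasDerivAt (fun τ => bimoment ζ (b τ) a c)
      (∑ p, ∑ q, (b t p * ζ p ^ e * b t q + b t p * (b t q * ζ q ^ e)) * (ζ p ^ a * ζ q ^ c) /
        (ζ p + ζ q)) t :=
    HasDerivAt.fun_sum fun p _ => HasDerivAt.fun_sum fun q _ =>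
      (((hb p).mul (hb q)).mul_const _).div_const _
  refine hasDerivAt_of_eq this (fun _ => rfl) ?_
  simp only [bimoment, ← sum_add_distrib]
  refine sum_congr rfl fun p _ => sum_congr rfl fun q _ => ?_
  rw [zpow_add₀ (hζ p).ne', zpow_add₀ (hζ q).ne', ← add_div]
  congr 1
  ring

lemma hasDerivAt_bimoment_neg {ζ : Fin n → ℝ} {b : ℝ → Fin n → ℝ} {t : ℝ}
    (hζ : ∀ i, 0 < ζ i) (hb : ∀ j, HasDerivAt (fun τ => b τ j) (b t j * ζ j ^ (-1 : ℤ)) t)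
    (a c : ℤ) :
    HasDerivAt (fun τ => bimoment ζ (b τ) a c)
      (moment ζ (b t) (a + -1) * moment ζ (b t) (c + -1)) t := by
  refine hasDerivAt_of_eq (hasDerivAt_bimoment hζ hb a c) (fun _ => rfl) ?_
  have := bimoment_succ_add ζ (b t) hζ (a + -1) (c + -1)
  rw [← this, add_comm]
  simp

lemma hasDerivAt_bimoment_pos {ζ : Fin n → ℝ} {b : ℝ → Fin n → ℝ} {t : ℝ}
    (hζ : ∀ i, 0 < ζ i) (hb : ∀ j, HasDerivAt (fun τ => b τ j) (b t j * ζ j ^ (1 : ℤ)) t)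
    (a c : ℤ) :
    HasDerivAt (fun τ => bimoment ζ (b τ) a c) (moment ζ (b t) a * moment ζ (b t) c) t := by
  refine hasDerivAt_of_eq (hasDerivAt_bimoment hζ hb a c) (fun _ => rfl) ?_
  exact (bimoment_succ_add ζ (b t) hζ a c).symm

/-- `Z_{m+1} / W_m` is twice the Schur complement with both borders `I_{0, 1+j}`. -/
lemma hasDerivAt_Z_div_W {ζ : Fin n → ℝ} {b : ℝ → Fin n → ℝ} {t : ℝ} (m : ℕ)
    (hζ : ∀ i, 0 < ζ i) (hb : ∀ j, HasDerivAt (fun τ => b τ j) (b t j * ζ j ^ (-1 : ℤ)) t)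
    (hW : ∀ τ, W ζ (b τ) m ≠ 0) :
    HasDerivAt (fun τ => Z ζ (b τ) (m + 1) / W ζ (b τ) m)
      (2 * ((T ζ (b t) (m + 1) * V ζ (b t) m - T ζ (b t) (m + 2) * V ζ (b t) (m - 1)) /
        W ζ (b t) m) ^ 2) t := by
  have hI := hasDerivAt_bimoment_neg (t := t) hζ hb
  have hG : (gramMat ζ (b t) 1 1 m).det ≠ 0 := fun h0 =>
    hW t (by rw [W_eq_det _ _ hζ, h0, mul_zero])
  have h := hasDerivAt_schurCompl (G := fun τ => gramMat ζ (b τ) 1 1 m)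
    (d := fun τ => bimoment ζ (b τ) 0 0) (r := fun τ => lowVec ζ (b τ) m)
    (c := fun τ => lowVec ζ (b τ) m) (w := momVec ζ (b t) 0 m) (ρ := moment ζ (b t) (-1))
    (γ := moment ζ (b t) (-1)) (t := t)
    (fun i j => hasDerivAt_of_eq (hI (1 + (i : ℕ)) (1 + (j : ℕ))) (fun _ => rfl) (by simp [momVec]))
    hG (hasDerivAt_of_eq (hI 0 0) (fun _ => rfl) (by simp))
    (fun i => hasDerivAt_of_eq (hI 0 (1 + (i : ℕ))) (fun _ => rfl) (by simp [momVec]))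
    (fun i => hasDerivAt_of_eq (hI 0 (1 + (i : ℕ))) (fun _ => rfl) (by simp [momVec]))
  rw [schurCompl_comm (transpose_gramMat ζ (b t) 1 1 m) _ (momVec ζ (b t) 0 m),
    schurCompl_eq _ _ hζ (hW t), det_bordered_mom_neg_one_low _ _ hζ] at h
  refine hasDerivAt_of_eq (h.const_mul 2) (fun τ => ?_) ?_
  · rw [schurCompl_eq _ _ hζ (hW τ), Z_eq_det _ _ hζ, bordered_low_low]
    ring
  · ring

/-- `U_{m+1} U_m / W_m` is, up to sign, the Schur complement with borders `I_{0, 1+j}` and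
`α_{1+j}`. -/
lemma hasDerivAt_U_mul_div_W {ζ : Fin n → ℝ} {b : ℝ → Fin n → ℝ} {t : ℝ} (m : ℕ)
    (hζ : ∀ i, 0 < ζ i) (hb : ∀ j, HasDerivAt (fun τ => b τ j) (b t j * ζ j ^ (-1 : ℤ)) t)
    (hW : ∀ τ, W ζ (b τ) m ≠ 0) :
    HasDerivAt (fun τ => U ζ (b τ) (m + 1) * U ζ (b τ) m / W ζ (b τ) m)
      ((T ζ (b t) (m + 1) * V ζ (b t) m - T ζ (b t) (m + 2) * V ζ (b t) (m - 1)) *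
        (V ζ (b t) m * U ζ (b t) m + V ζ (b t) (m - 1) * U ζ (b t) (m + 1)) /
        W ζ (b t) m ^ 2) t := by
  have hI := hasDerivAt_bimoment_neg (t := t) hζ hb
  have hα := hasDerivAt_moment (t := t) hζ hb
  have hG : (gramMat ζ (b t) 1 1 m).det ≠ 0 := fun h0 =>
    hW t (by rw [W_eq_det _ _ hζ, h0, mul_zero])
  have h := hasDerivAt_schurCompl (G := fun τ => gramMat ζ (b τ) 1 1 m)
    (d := fun τ => moment ζ (b τ) 0) (r := fun τ => lowVec ζ (b τ) m)
    (c := fun τ => momVec ζ (b τ) 1 m) (w := momVec ζ (b t) 0 m) (ρ := moment ζ (b t) (-1))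
    (γ := 1) (t := t)
    (fun i j => hasDerivAt_of_eq (hI (1 + (i : ℕ)) (1 + (j : ℕ))) (fun _ => rfl) (by simp [momVec]))
    hG (hasDerivAt_of_eq (hα 0) (fun _ => rfl) (by simp))
    (fun i => hasDerivAt_of_eq (hI 0 (1 + (i : ℕ))) (fun _ => rfl) (by simp [momVec]))
    (fun i => hasDerivAt_of_eq (hα (1 + (i : ℕ))) (fun _ => rfl) (by simp [momVec]))
  have hs := neg_one_pow_mul_self m
  rw [schurCompl_eq _ _ hζ (hW t), schurCompl_eq _ _ hζ (hW t), det_bordered_mom_neg_one_low _ _ hζ,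
    det_bordered_mom_mom _ _ hζ] at h
  refine hasDerivAt_of_eq (h.const_mul ((-1) ^ m)) (fun τ => ?_) ?_
  · rw [schurCompl_eq _ _ hζ (hW τ), det_bordered_mom_low _ _ hζ]
    linear_combination (-(U ζ (b τ) (m + 1) * U ζ (b τ) m / W ζ (b τ) m)) * hs
  · linear_combination (-((T ζ (b t) (m + 1) * V ζ (b t) m -
      T ζ (b t) (m + 2) * V ζ (b t) (m - 1)) *
        (V ζ (b t) m * U ζ (b t) m + V ζ (b t) (m - 1) * U ζ (b t) (m + 1)) /
        W ζ (b t) m ^ 2)) * hs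

/-- `U_{m+1}² / W_m` is, up to sign, twice the Schur complement with borders `I_{0, 1+j}` and
`I_{1+m, 1+j}`. -/
lemma hasDerivAt_U_sq_div_W {ζ : Fin n → ℝ} {b : ℝ → Fin n → ℝ} {t : ℝ} (m : ℕ)
    (hζ : ∀ i, 0 < ζ i) (hb : ∀ j, HasDerivAt (fun τ => b τ j) (b t j * ζ j ^ (1 : ℤ)) t)
    (hW : ∀ τ, W ζ (b τ) m ≠ 0) :
    HasDerivAt (fun τ => U ζ (b τ) (m + 1) ^ 2 / W ζ (b τ) m)
      (2 * (U ζ (b t) (m + 1) * U ζ (b t) m) *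
        (V ζ (b t) (m + 1) * U ζ (b t) m - V ζ (b t) (m - 1) * U ζ (b t) (m + 2)) /
        W ζ (b t) m ^ 2) t := by
  have hI := hasDerivAt_bimoment_pos (t := t) hζ hb
  have hG : (gramMat ζ (b t) 1 1 m).det ≠ 0 := fun h0 =>
    hW t (by rw [W_eq_det _ _ hζ, h0, mul_zero])
  have h := hasDerivAt_schurCompl (G := fun τ => gramMat ζ (b τ) 1 1 m)
    (d := fun τ => bimoment ζ (b τ) 0 (1 + m)) (r := fun τ => lowVec ζ (b τ) m)
    (c := fun τ => highVec ζ (b τ) m) (w := momVec ζ (b t) 1 m) (ρ := moment ζ (b t) 0)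
    (γ := moment ζ (b t) (1 + m)) (t := t)
    (fun i j => hI (1 + (i : ℕ)) (1 + (j : ℕ))) hG (hI 0 (1 + m))
    (fun i => hI 0 (1 + (i : ℕ))) (fun i => hI (1 + m) (1 + (i : ℕ)))
  have hs := neg_one_pow_mul_self m
  rw [schurCompl_comm (transpose_gramMat ζ (b t) 1 1 m) _ (momVec ζ (b t) 1 m),
    schurCompl_eq _ _ hζ (hW t), schurCompl_eq _ _ hζ (hW t), det_bordered_mom_low _ _ hζ,
    det_bordered_high_mom _ _ hζ] at h
  refine hasDerivAt_of_eq (h.const_mul (2 * (-1) ^ m)) (fun τ => ?_) ?_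
  · have hU := U_sq_eq_det ζ (b τ) hζ (m + 1)
    push_cast at hU
    rw [schurCompl_eq _ _ hζ (hW τ), bordered_low_high, hU, pow_succ]
    linear_combination (-(2 * 2 ^ m * (gramMat ζ (b τ) 0 1 (m + 1)).det / W ζ (b τ) m)) * hs
  · linear_combination (-(2 * (U ζ (b t) (m + 1) * U ζ (b t) m) *
        (V ζ (b t) (m + 1) * U ζ (b t) m - V ζ (b t) (m - 1) * U ζ (b t) (m + 2)) /
        W ζ (b t) m ^ 2)) * hs

/-- `U_m² / W_m` is, up to sign, the Schur complement with borders `I_{0, 1+j}` and the last unit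
vector. -/
lemma hasDerivAt_U_sq_div_W_self {ζ : Fin n → ℝ} {b : ℝ → Fin n → ℝ} {t : ℝ} (m : ℕ)
    (hζ : ∀ i, 0 < ζ i) (hb : ∀ j, HasDerivAt (fun τ => b τ j) (b t j * ζ j ^ (1 : ℤ)) t)
    (hW : ∀ τ, W ζ (b τ) m ≠ 0) :
    HasDerivAt (fun τ => U ζ (b τ) m ^ 2 / W ζ (b τ) m)
      (-(2 * (U ζ (b t) (m + 1) * U ζ (b t) m) *
        (V ζ (b t) m * U ζ (b t) (m - 1) - V ζ (b t) (m - 2) * U ζ (b t) (m + 1)) /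
        W ζ (b t) m ^ 2)) t := by
  cases m with
  | zero =>
    have h : ∀ τ, U ζ (b τ) (0 : ℕ) ^ 2 / W ζ (b τ) (0 : ℕ) = 1 := fun τ => by
      simp [W, U, V, spectralSum_zero, spectralSum_eq_zero_of_neg]
    refine hasDerivAt_of_eq (hasDerivAt_const t (1 : ℝ)) h ?_
    simp [U, V, spectralSum_eq_zero_of_neg]
  | succ m =>
    have hI := hasDerivAt_bimoment_pos (t := t) hζ hb
    have hG : (gramMat ζ (b t) 1 1 (m + 1)).det ≠ 0 := fun h0 =>
      hW t (by rw [W_eq_det _ _ hζ, h0, mul_zero])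
    have h := hasDerivAt_schurCompl (G := fun τ => gramMat ζ (b τ) 1 1 (m + 1))
      (d := fun _ => 0) (r := fun τ => lowVec ζ (b τ) (m + 1))
      (c := fun _ => lastVec m) (w := momVec ζ (b t) 1 (m + 1)) (ρ := moment ζ (b t) 0)
      (γ := 0) (t := t)
      (fun i j => hI (1 + (i : ℕ)) (1 + (j : ℕ))) hG
      (by rw [mul_zero]; exact hasDerivAt_const t 0)
      (fun i => hI 0 (1 + (i : ℕ))) (fun i => by rw [zero_mul]; exact hasDerivAt_const t _)
    have hs := neg_one_pow_mul_self m
    rw [schurCompl_eq _ _ hζ (hW t), schurCompl_eq _ _ hζ (hW t), det_bordered_mom_low _ _ hζ,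
      pow_succ (2 : ℝ) m, mul_right_comm, det_bordered_mom_last _ _ hζ] at h
    refine hasDerivAt_of_eq (h.const_mul ((-1) ^ (m + 1))) (fun τ => ?_) ?_
    · rw [schurCompl_eq _ _ hζ (hW τ), det_bordered_low_last _ _ hζ]
      rw [pow_succ]
      linear_combination (-(U ζ (b τ) (m + 1 : ℕ) ^ 2 / W ζ (b τ) (m + 1 : ℕ))) * hs
    · push_cast
      rw [show (m : ℤ) + 1 - 1 = m by ring, show (m : ℤ) + 1 - 2 = m - 1 by ring,
        show (m : ℤ) + 1 + 1 = m + 2 by ring, pow_succ]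
      linear_combination (2 * (U ζ (b t) (m + 2) * U ζ (b t) (m + 1)) *
        (V ζ (b t) (m + 1) * U ζ (b t) m - V ζ (b t) (m - 1) * U ζ (b t) (m + 2)) /
        W ζ (b t) (m + 1) ^ 2) * hs

end Derivatives

/-! ### The peakon and lattice variables at a fixed time -/

section Static

lemma sum_Icc_one_int (f : ℤ → ℝ) (k : ℕ) :
    ∑ j ∈ Icc (1 : ℤ) k, f j = ∑ l ∈ range k, f (l + 1) := by
  refine sum_nbij' (fun j => (j - 1).toNat) (fun l => (l : ℤ) + 1) ?_ ?_ ?_ ?_ ?_ <;>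
    intro a ha <;> simp only [mem_Icc, mem_range] at ha ⊢ <;> try omega
  congr 1; omega

lemma prod_Icc_one_int (f : ℤ → ℝ) (k : ℕ) :
    ∏ j ∈ Icc (1 : ℤ) k, f j = ∏ l ∈ range k, f (l + 1) := by
  refine prod_nbij' (fun j => (j - 1).toNat) (fun l => (l : ℤ) + 1) ?_ ?_ ?_ ?_ ?_ <;>
    intro a ha <;> simp only [mem_Icc, mem_range] at ha ⊢ <;> try omega
  congr 1; omega

lemma sum_Icc_one_int_reflect (f : ℤ → ℝ) (n : ℕ) :
    ∑ j ∈ Icc (1 : ℤ) n, f j = ∑ l ∈ range n, f (n - l) := by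
  refine sum_nbij' (fun j => (n - j).toNat) (fun l => (n : ℤ) - l) ?_ ?_ ?_ ?_ ?_ <;>
    intro a ha <;> simp only [mem_Icc, mem_range] at ha ⊢ <;> try omega
  congr 1; omega

variable {n : ℕ} {ζ b : Fin n → ℝ}

lemma U_zero (ζ b : Fin n → ℝ) : U ζ b 0 = 1 := spectralSum_zero ..

lemma V_neg (ζ b : Fin n → ℝ) {k : ℤ} (hk : k < 0) : V ζ b k = 0 :=
  spectralSum_eq_zero_of_neg ζ b 1 hk

lemma U_eq_zero_of_lt (ζ b : Fin n → ℝ) {k : ℤ} (hk : n < k) : U ζ b k = 0 :=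
  spectralSum_eq_zero_of_lt ζ b 0 hk

lemma W_zero (ζ b : Fin n → ℝ) : W ζ b 0 = 1 := by
  rw [W, V_neg ζ b (by norm_num : (0 : ℤ) - 1 < 0), U_zero, V, spectralSum_zero]; ring

lemma todaS_zero (ζ b : Fin n → ℝ) : todaS ζ b 0 = 0 := by
  rw [todaS, V_neg ζ b (by norm_num), zero_div]

lemma peakonX_sub (ζ b : Fin n → ℝ) (m : ℤ) :
    peakonX ζ b (n - m) = 1 / 2 * Real.log (Z ζ b (m + 1) / W ζ b m) := by
  rw [peakonX, show (n : ℤ) + 1 - (n - m) = m + 1 by ring, add_sub_cancel_right]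

lemma peakonM_sub (ζ b : Fin n → ℝ) (m : ℤ) :
    peakonM ζ b (n - m) =
      Real.sqrt (Z ζ b (m + 1) * W ζ b m) / (U ζ b (m + 1) * U ζ b m) := by
  rw [peakonM, show (n : ℤ) + 1 - (n - m) = m + 1 by ring, add_sub_cancel_right]

variable (hζ : ∀ i, 0 < ζ i) (hmono : StrictMono ζ) (hb : ∀ i, 0 < b i)

section
include hζ hmono hb

lemma U_succ_pos {m : ℕ} (hm : m < n) : 0 < U ζ b (m + 1) := by
  exact_mod_cast U_pos ζ b hζ hmono hb (Nat.succ_le_of_lt hm)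

lemma peakonM_pos {m : ℕ} (hm : m < n) : 0 < peakonM ζ b (n - m) := by
  rw [peakonM_sub]
  have := Z_pos ζ b hζ hmono hb hm
  have := W_pos ζ b hζ hmono hb hm.le
  have := U_pos ζ b hζ hmono hb hm.le
  have := U_succ_pos hζ hmono hb hm
  positivity

lemma exp_peakonX {m : ℕ} (hm : m < n) :
    Real.exp (peakonX ζ b (n - m)) = Real.sqrt (Z ζ b (m + 1) / W ζ b m) := by
  have := Z_pos ζ b hζ hmono hb hm
  have := W_pos ζ b hζ hmono hb hm.le
  rw [peakonX_sub, Real.sqrt_eq_rpow, Real.rpow_def_of_pos (by positivity), mul_comm]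

lemma exp_peakonX_sq {m : ℕ} (hm : m < n) :
    Real.exp (peakonX ζ b (n - m)) ^ 2 = Z ζ b (m + 1) / W ζ b m := by
  have := Z_pos ζ b hζ hmono hb hm
  have := W_pos ζ b hζ hmono hb hm.le
  rw [exp_peakonX hζ hmono hb hm, Real.sq_sqrt (by positivity)]

lemma peakonM_eq_exp_mul {m : ℕ} (hm : m < n) :
    peakonM ζ b (n - m) = Real.exp (peakonX ζ b (n - m)) *
      (W ζ b m / (U ζ b (m + 1) * U ζ b m)) := by
  have hZ := Z_pos ζ b hζ hmono hb hm
  have hW := W_pos ζ b hζ hmono hb hm.le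
  rw [peakonM_sub, exp_peakonX hζ hmono hb hm, ← mul_div_assoc]
  congr 1
  rw [Real.sqrt_eq_iff_mul_self_eq (by positivity) (by positivity), mul_mul_mul_comm,
    Real.mul_self_sqrt (by positivity)]
  field_simp

lemma peakonM_mul_exp_neg {m : ℕ} (hm : m < n) :
    peakonM ζ b (n - m) * Real.exp (-peakonX ζ b (n - m)) =
      W ζ b m / (U ζ b (m + 1) * U ζ b m) := by
  rw [peakonM_eq_exp_mul hζ hmono hb hm, mul_right_comm, ← Real.exp_add, add_neg_cancel,
    Real.exp_zero, one_mul]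

lemma peakonM_mul_exp {m : ℕ} (hm : m < n) :
    peakonM ζ b (n - m) * Real.exp (peakonX ζ b (n - m)) =
      Z ζ b (m + 1) / (U ζ b (m + 1) * U ζ b m) := by
  have hW := W_pos ζ b hζ hmono hb hm.le
  rw [peakonM_eq_exp_mul hζ hmono hb hm, mul_right_comm, ← sq, exp_peakonX_sq hζ hmono hb hm]
  field_simp

lemma todaS_succ_sub {m : ℕ} (hm : m < n) :
    todaS ζ b (m + 1) - todaS ζ b m = W ζ b m / (U ζ b (m + 1) * U ζ b m) := by
  have h1 := U_pos ζ b hζ hmono hb hm.le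
  have h2 := U_succ_pos hζ hmono hb hm
  rw [todaS, todaS, W, add_sub_cancel_right]
  field_simp

/-- The quotients `T_{m+1} / U_m` play the role of `s_m` for the increasing exponentials. -/
lemma T_div_U_sub {m : ℕ} (hm : m < n) :
    T ζ b (m + 1) / U ζ b m - T ζ b (m + 1 + 1) / U ζ b (m + 1) =
      Z ζ b (m + 1) / (U ζ b (m + 1) * U ζ b m) := by
  have h1 := U_pos ζ b hζ hmono hb hm.le
  have h2 := U_succ_pos hζ hmono hb hm
  rw [Z, add_sub_cancel_right]
  field_simp

lemma Z_mul_W_sub_of_lt {m : ℕ} (hm : m + 1 < n) :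
    Z ζ b (m + 1) * W ζ b (m + 1) - Z ζ b (m + 2) * W ζ b m = U ζ b (m + 1) ^ 4 :=
  Z_mul_W_sub ζ b hζ m (det_gramMat_pos ζ b hζ hmono hb (by omega)).1.ne'

lemma peakonX_lt {m : ℕ} (hm : m + 1 < n) :
    peakonX ζ b (n - (m + 1)) < peakonX ζ b (n - m) := by
  have hZ := Z_pos ζ b hζ hmono hb hm
  have hW := W_pos ζ b hζ hmono hb hm.le
  have hW' := W_pos ζ b hζ hmono hb (m := m) (by omega)
  have hU := U_succ_pos hζ hmono hb (m := m) (by omega)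
  have h := Z_mul_W_sub_of_lt hζ hmono hb hm
  push_cast at hZ hW
  rw [peakonX_sub, peakonX_sub]
  refine mul_lt_mul_of_pos_left (Real.log_lt_log (by positivity) ?_) (by norm_num)
  rw [div_lt_div_iff₀ hW hW', show (m : ℤ) + 1 + 1 = m + 2 by ring]
  have : 0 < U ζ b (m + 1) ^ 4 := by positivity
  linarith

lemma peakonX_strictMonoOn : StrictMonoOn (peakonX ζ b) (Set.Icc (1 : ℤ) n) := by
  refine strictMonoOn_of_lt_add_one Set.ordConnected_Icc fun a _ ha ha' => ?_
  obtain ⟨m, hm⟩ := Int.eq_ofNat_of_zero_le (show 0 ≤ n - (a + 1) by linarith [ha'.2])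
  have h := peakonX_lt hζ hmono hb (m := m) (by have := ha.1; omega)
  rwa [show (n : ℤ) - (m + 1) = a by omega, show (n : ℤ) - m = a + 1 by omega] at h

lemma todaS_eq_sMap {k : ℕ} (hk : k ≤ n) :
    todaS ζ b k = sMap n (peakonX ζ b) (peakonM ζ b) k := by
  rw [sMap, sum_Icc_one_int]
  have h := sum_range_sub (fun l : ℕ => todaS ζ b l) k
  rw [Nat.cast_zero, todaS_zero, sub_zero] at h
  rw [← h]
  refine sum_congr rfl fun l hl => ?_
  have hl' : l < n := (mem_range.mp hl).trans_le hk
  rw [show (n : ℤ) + 1 - (l + 1) = n - l by ring, peakonM_mul_exp_neg hζ hmono hb hl',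
    ← todaS_succ_sub hζ hmono hb hl', Nat.cast_succ]

/-- The denominator is the difference of `m_l e^{x_l} * m_{l+1} e^{-x_{l+1}}` and
`m_l e^{-x_l} * m_{l+1} e^{x_{l+1}}`, hence a quotient of `Z_{l+1} W_{l+1} - Z_{l+2} W_l`. -/
lemma cosh_factor_eq {l : ℕ} (hl : l + 1 < n) :
    1 / (2 * peakonM ζ b (n - l) * peakonM ζ b (n - (l + 1)) * Real.cosh (peakonX ζ b (n - l)) *
      Real.cosh (peakonX ζ b (n - (l + 1))) *
      (Real.tanh (peakonX ζ b (n - l)) - Real.tanh (peakonX ζ b (n - (l + 1))))) =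
    U ζ b l * U ζ b (l + 2) / U ζ b (l + 1) ^ 2 := by
  have h1 := peakonM_mul_exp_neg hζ hmono hb (m := l) (by omega)
  have h2 := peakonM_mul_exp hζ hmono hb (m := l) (by omega)
  have h3 := peakonM_mul_exp_neg hζ hmono hb hl
  have h4 := peakonM_mul_exp hζ hmono hb hl
  have hU := U_pos ζ b hζ hmono hb (m := l) (by omega)
  have hU1 := U_succ_pos hζ hmono hb (m := l) (by omega)
  have hU2 := U_succ_pos hζ hmono hb hl
  have h := Z_mul_W_sub_of_lt hζ hmono hb hl
  push_cast at h3 h4 hU2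
  rw [show (l : ℤ) + 1 + 1 = l + 2 by ring] at h3 h4 hU2
  generalize peakonX ζ b (n - l) = x at *
  generalize peakonX ζ b (n - (l + 1)) = y at *
  generalize peakonM ζ b (n - l) = M at *
  generalize peakonM ζ b (n - (l + 1)) = N at *
  have e : 2 * M * N * Real.cosh x * Real.cosh y * (Real.tanh x - Real.tanh y) =
      (M * Real.exp x) * (N * Real.exp (-y)) - (M * Real.exp (-x)) * (N * Real.exp y) := by
    have hx := (Real.cosh_pos x).ne'
    have hy := (Real.cosh_pos y).ne'
    rw [Real.tanh_eq_sinh_div_cosh, Real.tanh_eq_sinh_div_cosh]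
    have : 2 * M * N * Real.cosh x * Real.cosh y *
        (Real.sinh x / Real.cosh x - Real.sinh y / Real.cosh y) =
        2 * M * N * (Real.sinh x * Real.cosh y - Real.cosh x * Real.sinh y) := by field_simp
    rw [this, Real.sinh_eq, Real.sinh_eq, Real.cosh_eq, Real.cosh_eq]
    ring
  rw [e, h1, h2, h3, h4]
  have e2 : Z ζ b (l + 1) / (U ζ b (l + 1) * U ζ b l) *
      (W ζ b (l + 1) / (U ζ b (l + 2) * U ζ b (l + 1))) -
      W ζ b l / (U ζ b (l + 1) * U ζ b l) * (Z ζ b (l + 2) / (U ζ b (l + 2) * U ζ b (l + 1))) =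
      (Z ζ b (l + 1) * W ζ b (l + 1) - Z ζ b (l + 2) * W ζ b l) /
        (U ζ b l * U ζ b (l + 2) * U ζ b (l + 1) ^ 2) := by
    field_simp
  rw [e2, h]
  field_simp

lemma todaR_eq_rMap {m : ℕ} (hm : m < n) :
    todaR ζ b (m + 1) = rMap n (peakonX ζ b) (peakonM ζ b) (m + 1) := by
  rw [rMap, add_sub_cancel_right, prod_Icc_one_int]
  induction m with
  | zero =>
    have h := peakonM_mul_exp_neg hζ hmono hb hm
    have hM := peakonM_pos hζ hmono hb hm
    have hU := U_succ_pos hζ hmono hb hm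
    simp only [Nat.cast_zero, sub_zero, zero_add, W_zero, U_zero, mul_one] at h hM hU
    rw [Real.exp_neg] at h
    simp only [range_zero, prod_empty, mul_one, Nat.cast_zero, zero_add, todaR, sub_self, U_zero,
      div_one]
    have hx := (Real.exp_pos (peakonX ζ b n)).ne'
    field_simp at h ⊢
    exact h
  | succ m ih =>
    have hU := U_pos ζ b hζ hmono hb (m := m) (by omega)
    have hU1 := U_succ_pos hζ hmono hb (m := m) (by omega)
    rw [prod_range_succ, ← mul_assoc, ← ih (by omega)]
    rw [show (n : ℤ) + 1 - (m + 1) = n - m by ring, show (n : ℤ) - m - 1 = n - (m + 1) by ring,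
      cosh_factor_eq hζ hmono hb hm, todaR, todaR]
    push_cast
    rw [add_sub_cancel_right, add_sub_cancel_right, show (m : ℤ) + 1 + 1 = m + 2 by ring]
    field_simp

/-- The peakons on the right of `x_{n-m}` contribute the increments of `s_l`, `l < m`, and the
others the increments of `T_{l+1} / U_l`, `l ≥ m`. -/
lemma peakonProfile_peakonX {m : ℕ} (hm : m < n) :
    peakonProfile n (peakonX ζ b) (peakonM ζ b) (peakonX ζ b (n - m)) =
      Real.exp (peakonX ζ b (n - m)) * (V ζ b (m - 1) / U ζ b m) +
        Real.exp (-peakonX ζ b (n - m)) * (T ζ b (m + 1) / U ζ b m) := by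
  set x := peakonX ζ b (n - m) with hx
  have hord := peakonX_strictMonoOn hζ hmono hb
  rw [peakonProfile, sum_Icc_one_int_reflect]
  -- both kinds of increments are differences of a single sequence, cut off at `m`
  have h := sum_range_sub (fun l : ℕ => Real.exp x * todaS ζ b (min l m : ℕ) -
    Real.exp (-x) * (T ζ b ((max l m : ℕ) + 1) / U ζ b (max l m : ℕ))) n
  rw [min_eq_right hm.le, max_eq_left hm.le, min_eq_left (Nat.zero_le m),
    max_eq_right (Nat.zero_le m), T, spectralSum_eq_zero_of_lt ζ b (-1) (by omega), Nat.cast_zero,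
    todaS_zero] at h
  rw [show Real.exp x * (V ζ b (m - 1) / U ζ b m) + Real.exp (-x) * (T ζ b (m + 1) / U ζ b m) =
    Real.exp x * todaS ζ b m - Real.exp (-x) * (0 / U ζ b n) - (Real.exp x * 0 -
      Real.exp (-x) * (T ζ b (m + 1) / U ζ b m)) by rw [todaS]; ring, ← h]
  refine sum_congr rfl fun l hl => ?_
  rw [mem_range] at hl
  rcases lt_or_ge l m with hlm | hlm
  · have hlt : x < peakonX ζ b (n - l) :=
      hord ⟨by omega, by omega⟩ ⟨by omega, by omega⟩ (by omega)
    rw [min_eq_left hlm, min_eq_left hlm.le, max_eq_right hlm, max_eq_right hlm.le,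
      abs_of_neg (by linarith), neg_neg, sub_eq_add_neg x, Real.exp_add, mul_left_comm,
      peakonM_mul_exp_neg hζ hmono hb hl, ← todaS_succ_sub hζ hmono hb hl, Nat.cast_succ]
    ring
  · have hle : peakonX ζ b (n - l) ≤ x :=
      hord.monotoneOn ⟨by omega, by omega⟩ ⟨by omega, by omega⟩ (by omega)
    rw [min_eq_right (by omega : m ≤ l + 1), min_eq_right hlm, max_eq_left (by omega : m ≤ l + 1),
      max_eq_left hlm, abs_of_nonneg (by linarith), neg_sub, sub_eq_add_neg _ x, Real.exp_add,
      ← mul_assoc, peakonM_mul_exp hζ hmono hb hl, ← T_div_U_sub hζ hmono hb hl, Nat.cast_succ]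
    ring

/-- The same telescoping for the average of the one-sided derivatives, to which the peakon at
`x_{n-m}` itself does not contribute. -/
lemma sum_sign_peakonX {m : ℕ} (hm : m < n) :
    ∑ k ∈ Icc (1 : ℤ) n, peakonM ζ b k * (-SignType.sign (peakonX ζ b (n - m) - peakonX ζ b k) *
        Real.exp (-|peakonX ζ b (n - m) - peakonX ζ b k|)) =
      Real.exp (peakonX ζ b (n - m)) * (V ζ b (m - 1) / U ζ b m) -
        Real.exp (-peakonX ζ b (n - m)) * (T ζ b (m + 2) / U ζ b (m + 1)) := by
  set x := peakonX ζ b (n - m) with hx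
  have hord := peakonX_strictMonoOn hζ hmono hb
  rw [sum_Icc_one_int_reflect]
  have h := sum_range_sub (fun l : ℕ => Real.exp x * todaS ζ b (min l m : ℕ) +
    Real.exp (-x) * (T ζ b ((max l (m + 1) : ℕ) + 1) / U ζ b (max l (m + 1) : ℕ))) n
  rw [min_eq_right hm.le, max_eq_left (by omega : m + 1 ≤ n), min_eq_left (Nat.zero_le m),
    max_eq_right (Nat.zero_le (m + 1)), T, spectralSum_eq_zero_of_lt ζ b (-1) (by omega),
    Nat.cast_zero, todaS_zero] at h
  rw [show Real.exp x * (V ζ b (m - 1) / U ζ b m) - Real.exp (-x) *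
    (T ζ b (m + 2) / U ζ b (m + 1)) =
    Real.exp x * todaS ζ b m + Real.exp (-x) * (0 / U ζ b n) - (Real.exp x * 0 +
      Real.exp (-x) * (T ζ b ((m + 1 : ℕ) + 1) / U ζ b (m + 1 : ℕ))) by
    rw [todaS, show ((m + 1 : ℕ) + 1 : ℤ) = m + 2 by push_cast; ring]; push_cast; ring, ← h]
  refine sum_congr rfl fun l hl => ?_
  rw [mem_range] at hl
  rcases lt_trichotomy l m with hlm | rfl | hlm
  · have hlt : x < peakonX ζ b (n - l) :=
      hord ⟨by omega, by omega⟩ ⟨by omega, by omega⟩ (by omega)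
    rw [min_eq_left hlm, min_eq_left hlm.le, max_eq_right (by omega : l + 1 ≤ m + 1),
      max_eq_right (by omega : l ≤ m + 1), sign_neg (by linarith),
      abs_of_neg (by linarith), neg_neg, sub_eq_add_neg x, Real.exp_add]
    have h1 := peakonM_mul_exp_neg hζ hmono hb hl
    rw [← todaS_succ_sub hζ hmono hb hl] at h1
    simp only [SignType.coe_neg, SignType.coe_one]
    push_cast
    linear_combination Real.exp x * h1
  · rw [min_eq_right (by omega : l ≤ l + 1), min_self, max_self,
      max_eq_right (by omega : l ≤ l + 1), hx]
    simp
  · have hlt : peakonX ζ b (n - l) < x :=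
      hord ⟨by omega, by omega⟩ ⟨by omega, by omega⟩ (by omega)
    rw [min_eq_right (by omega : m ≤ l + 1), min_eq_right hlm.le,
      max_eq_left (by omega : m + 1 ≤ l + 1), max_eq_left (by omega : m + 1 ≤ l),
      sign_pos (by linarith), abs_of_pos (by linarith), neg_sub, sub_eq_add_neg _ x, Real.exp_add]
    have h1 := peakonM_mul_exp hζ hmono hb hl
    rw [← T_div_U_sub hζ hmono hb hl] at h1
    simp only [SignType.coe_one]
    push_cast
    linear_combination -Real.exp (-x) * h1

end

end Static

/-! ### One-sided derivatives of the profile -/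

section Average

lemma hasDerivAt_exp_neg_abs_of_lt {y c : ℝ} (h : c < y) :
    HasDerivAt (fun z => Real.exp (-|z - c|)) (-1 * Real.exp (-|y - c|)) y := by
  have h1 : HasDerivAt (fun z => Real.exp (-(z - c))) (Real.exp (-(y - c)) * -1) y :=
    ((hasDerivAt_id y).sub_const c).neg.exp
  rw [abs_of_pos (by linarith), mul_comm]
  refine h1.congr_of_eventuallyEq ?_
  filter_upwards [lt_mem_nhds h] with z hz
  rw [abs_of_pos (by linarith)]

lemma hasDerivAt_exp_neg_abs_of_gt {y c : ℝ} (h : y < c) :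
    HasDerivAt (fun z => Real.exp (-|z - c|)) (1 * Real.exp (-|y - c|)) y := by
  have h1 : HasDerivAt (fun z => Real.exp (z - c)) (Real.exp (y - c) * 1) y :=
    ((hasDerivAt_id y).sub_const c).exp
  rw [abs_of_neg (by linarith), neg_neg, mul_comm]
  refine h1.congr_of_eventuallyEq ?_
  filter_upwards [gt_mem_nhds h] with z hz
  rw [abs_of_neg (by linarith), neg_neg]

lemma tendsto_deriv_peakonProfile {n : ℕ} {x m : ℤ → ℝ} {p : ℝ} {F : Filter ℝ} (hF : F ≤ 𝓝 p)
    {σ : ℤ → ℝ} (h : ∀ k ∈ Icc (1 : ℤ) n, ∀ᶠ y in F,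
      HasDerivAt (fun z => Real.exp (-|z - x k|)) (σ k * Real.exp (-|y - x k|)) y) :
    Filter.Tendsto (deriv (peakonProfile n x m)) F
      (𝓝 (∑ k ∈ Icc (1 : ℤ) n, m k * (σ k * Real.exp (-|p - x k|)))) := by
  have h1 : Filter.Tendsto (fun y => ∑ k ∈ Icc (1 : ℤ) n, m k * (σ k * Real.exp (-|y - x k|))) F
      (𝓝 (∑ k ∈ Icc (1 : ℤ) n, m k * (σ k * Real.exp (-|p - x k|)))) := by
    have : Continuous fun y => ∑ k ∈ Icc (1 : ℤ) n, m k * (σ k * Real.exp (-|y - x k|)) := by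
      fun_prop
    exact (this.tendsto p).mono_left hF
  refine h1.congr' ?_
  filter_upwards [(Filter.eventually_all_finset _).mpr h] with y hy
  have h2 : HasDerivAt (peakonProfile n x m)
      (∑ k ∈ Icc (1 : ℤ) n, m k * (σ k * Real.exp (-|y - x k|))) y :=
    HasDerivAt.fun_sum fun k hk => (hy k hk).const_mul (m k)
  exact h2.deriv.symm

/-- The sign of `p - x k`, which is `0` at a peak, is the average of its one-sided limits. -/
lemma isAverageAt_deriv_peakonProfile (n : ℕ) (x m : ℤ → ℝ) (p : ℝ) :
    IsAverageAt (deriv (peakonProfile n x m)) p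
      (∑ k ∈ Icc (1 : ℤ) n, m k * (-SignType.sign (p - x k) * Real.exp (-|p - x k|))) := by
  refine ⟨_, _, tendsto_deriv_peakonProfile (σ := fun k => if x k < p then -1 else 1)
    nhdsWithin_le_nhds fun k _ => ?_, tendsto_deriv_peakonProfile
    (σ := fun k => if x k ≤ p then -1 else 1) nhdsWithin_le_nhds fun k _ => ?_, ?_⟩
  · split_ifs with hk
    · filter_upwards [nhdsWithin_le_nhds (lt_mem_nhds hk)] with y hy
      exact hasDerivAt_exp_neg_abs_of_lt hy
    · filter_upwards [self_mem_nhdsWithin] with y hy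
      exact hasDerivAt_exp_neg_abs_of_gt (lt_of_lt_of_le hy (not_lt.mp hk))
  · split_ifs with hk
    · filter_upwards [self_mem_nhdsWithin] with y hy
      exact hasDerivAt_exp_neg_abs_of_lt (lt_of_le_of_lt hk hy)
    · filter_upwards [nhdsWithin_le_nhds (gt_mem_nhds (not_le.mp hk))] with y hy
      exact hasDerivAt_exp_neg_abs_of_gt hy
  · rw [← sum_add_distrib, sum_div]
    refine sum_congr rfl fun k _ => ?_
    rcases lt_trichotomy (x k) p with hk | hk | hk
    · rw [if_pos hk, if_pos hk.le, sign_pos (by linarith), SignType.coe_one]; ring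
    · rw [if_neg hk.not_lt, if_pos hk.le, hk, sub_self]; simp
    · rw [if_neg hk.not_gt, if_neg hk.not_ge, sign_neg (by linarith), SignType.coe_neg,
        SignType.coe_one]; ring

end Average

/-! ### The two flows -/

section Flows

lemma pos_of_hasDerivAt_mul_self {f : ℝ → ℝ} {c : ℝ} (h : ∀ t, HasDerivAt f (f t * c) t)
    (h0 : 0 < f 0) (t : ℝ) : 0 < f t := by
  -- `f t * exp (-c t)` is constant
  have h1 : ∀ t, HasDerivAt (fun τ => f τ * Real.exp (-(c * τ))) 0 t := fun t => by
    have h2 : HasDerivAt (fun τ => Real.exp (-(c * τ))) (Real.exp (-(c * t)) * (-(c * 1))) t :=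
      ((hasDerivAt_id t).const_mul c).neg.exp
    exact hasDerivAt_of_eq ((h t).mul h2) (fun _ => rfl) (by ring)
  have h2 := is_const_of_deriv_eq_zero (fun τ => (h1 τ).differentiableAt)
    (fun τ => (h1 τ).deriv) t 0
  simp only [mul_zero, neg_zero, Real.exp_zero, mul_one] at h2
  rw [← h2] at h0
  exact pos_of_mul_pos_left h0 (Real.exp_pos _).le

lemma eq_of_hasDerivAt_zero {n : ℕ} {ζ : ℝ → Fin n → ℝ}
    (h : ∀ t j, HasDerivAt (fun τ => ζ τ j) 0 t) (t : ℝ) : ζ t = ζ 0 := by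
  funext j
  exact is_const_of_deriv_eq_zero (fun τ => (h τ j).differentiableAt) (fun τ => (h τ j).deriv) t 0

variable {n : ℕ} {ζ : Fin n → ℝ} {b : ℝ → Fin n → ℝ}

section Negative

variable (hζ : ∀ i, 0 < ζ i) (hmono : StrictMono ζ) (hb : ∀ t i, 0 < b t i)
  (hflow : ∀ t j, HasDerivAt (fun τ => b τ j) (b t j * ζ j ^ (-1 : ℤ)) t)

include hζ hmono hb

lemma peakonProfile_eq_div {m : ℕ} (hm : m < n) (t : ℝ) :
    peakonProfile n (peakonX ζ (b t)) (peakonM ζ (b t)) (peakonX ζ (b t) (n - m)) =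
      Real.exp (-peakonX ζ (b t) (n - m)) *
        (T ζ (b t) (m + 1) * V ζ (b t) m - T ζ (b t) (m + 2) * V ζ (b t) (m - 1)) /
          W ζ (b t) m := by
  have hE := exp_peakonX_sq hζ hmono (hb t) hm
  have hW := W_pos ζ (b t) hζ hmono (hb t) hm.le
  have hU := U_pos ζ (b t) hζ hmono (hb t) hm.le
  rw [peakonProfile_peakonX hζ hmono (hb t) hm]
  generalize peakonX ζ (b t) (n - m) = x at *
  have hx : Real.exp x = Real.exp (-x) * (Z ζ (b t) (m + 1) / W ζ (b t) m) := by
    rw [← hE, sq, ← mul_assoc, ← Real.exp_add, neg_add_cancel, Real.exp_zero, one_mul]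
  rw [hx]
  field_simp
  rw [Z, W, add_sub_cancel_right, show (m : ℤ) + 1 + 1 = m + 2 by ring]
  ring

include hflow

lemma hasDerivAt_peakonX {m : ℕ} (hm : m < n) (t : ℝ) :
    HasDerivAt (fun τ => peakonX ζ (b τ) (n - m))
      (peakonProfile n (peakonX ζ (b t)) (peakonM ζ (b t)) (peakonX ζ (b t) (n - m)) ^ 2) t := by
  have hE := exp_peakonX_sq hζ hmono (hb t) hm
  have hW : ∀ τ, 0 < W ζ (b τ) m := fun τ => W_pos ζ (b τ) hζ hmono (hb τ) hm.le
  have hZ := Z_pos ζ (b t) hζ hmono (hb t) hm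
  have h := ((hasDerivAt_Z_div_W (t := t) m hζ (hflow t) fun τ => (hW τ).ne').log
    (div_pos hZ (hW t)).ne').const_mul (1 / 2)
  refine hasDerivAt_of_eq h (fun τ => peakonX_sub ζ (b τ) m) ?_
  rw [peakonProfile_eq_div hζ hmono hb hm, ← hE, Real.exp_neg]
  have := (hW t).ne'
  field_simp

/-- The momentum is `e^x W_m / (U_{m+1} U_m)`, and the derivative of `x` is `u²`; the equation says
that `u (u + ⟨u_x⟩)` is the logarithmic derivative of `U_{m+1} U_m / W_m`. -/
lemma hasDerivAt_peakonM {m : ℕ} (hm : m < n) (t : ℝ) :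
    HasDerivAt (fun τ => peakonM ζ (b τ) (n - m))
      (-(peakonM ζ (b t) (n - m)) *
        peakonProfile n (peakonX ζ (b t)) (peakonM ζ (b t)) (peakonX ζ (b t) (n - m)) *
        (Real.exp (peakonX ζ (b t) (n - m)) * (V ζ (b t) (m - 1) / U ζ (b t) m) -
          Real.exp (-peakonX ζ (b t) (n - m)) *
            (T ζ (b t) (m + 2) / U ζ (b t) (m + 1)))) t := by
  have hE := exp_peakonX_sq hζ hmono (hb t) hm
  have hW : ∀ τ, 0 < W ζ (b τ) m := fun τ => W_pos ζ (b τ) hζ hmono (hb τ) hm.le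
  have hU : ∀ τ, 0 < U ζ (b τ) m := fun τ => U_pos ζ (b τ) hζ hmono (hb τ) hm.le
  have hU' : ∀ τ, 0 < U ζ (b τ) (m + 1) := fun τ => U_succ_pos hζ hmono (hb τ) hm
  have h := (hasDerivAt_peakonX hζ hmono hb hflow hm t).exp.div
    (hasDerivAt_U_mul_div_W (t := t) m hζ (hflow t) fun τ => (hW τ).ne')
    (div_pos (mul_pos (hU' t) (hU t)) (hW t)).ne'
  refine hasDerivAt_of_eq h (fun τ => ?_) ?_
  · rw [peakonM_eq_exp_mul hζ hmono (hb τ) hm, Pi.div_apply, div_div_eq_mul_div, mul_div_assoc]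
  · have hp := peakonProfile_peakonX hζ hmono (hb t) hm
    have hp' := peakonProfile_eq_div hζ hmono hb hm t
    rw [peakonM_eq_exp_mul hζ hmono (hb t) hm]
    generalize
      peakonProfile n (peakonX ζ (b t)) (peakonM ζ (b t)) (peakonX ζ (b t) (n - m)) = u at *
    generalize peakonX ζ (b t) (n - m) = x at *
    have hexp : Real.exp (-x) * Real.exp x = 1 := by
      rw [← Real.exp_add, neg_add_cancel, Real.exp_zero]
    have h1 := (hW t).ne'
    have h2 := (hU t).ne'
    have h3 := (hU' t).ne'
    have hTZ : T ζ (b t) (m + 2) / U ζ (b t) (m + 1) = T ζ (b t) (m + 1) / U ζ (b t) m -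
        Z ζ (b t) (m + 1) / (U ζ (b t) (m + 1) * U ζ (b t) m) := by
      have := T_div_U_sub hζ hmono (hb t) hm
      rw [show (m : ℤ) + 1 + 1 = m + 2 by ring] at this
      linarith
    have hZ' : Real.exp (-x) * Z ζ (b t) (m + 1) = Real.exp x * W ζ (b t) m := by
      have : Z ζ (b t) (m + 1) = Real.exp x ^ 2 * W ζ (b t) m := by rw [hE]; field_simp
      rw [this]; linear_combination Real.exp x * W ζ (b t) m * hexp
    have hWdef : W ζ (b t) m = V ζ (b t) m * U ζ (b t) m - V ζ (b t) (m - 1) * U ζ (b t) (m + 1) :=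
      rfl
    generalize hY : T ζ (b t) (m + 1) * V ζ (b t) m - T ζ (b t) (m + 2) * V ζ (b t) (m - 1) = Y at *
    have hu : Real.exp x * u = Y / W ζ (b t) m := by
      rw [hp']; linear_combination Y / W ζ (b t) m * hexp
    rw [hTZ]
    have hsum : u + (Real.exp x * (V ζ (b t) (m - 1) / U ζ (b t) m) - Real.exp (-x) *
        (T ζ (b t) (m + 1) / U ζ (b t) m - Z ζ (b t) (m + 1) /
          (U ζ (b t) (m + 1) * U ζ (b t) m))) = Real.exp x *
        ((V ζ (b t) m * U ζ (b t) m + V ζ (b t) (m - 1) * U ζ (b t) (m + 1)) /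
          (U ζ (b t) (m + 1) * U ζ (b t) m)) := by
      rw [hp]
      field_simp
      linear_combination hZ' + Real.exp x * hWdef
    generalize (Real.exp x * (V ζ (b t) (m - 1) / U ζ (b t) m) - Real.exp (-x) *
        (T ζ (b t) (m + 1) / U ζ (b t) m - Z ζ (b t) (m + 1) /
          (U ζ (b t) (m + 1) * U ζ (b t) m))) = a at *
    rw [eq_sub_of_add_eq' hsum, eq_div_of_mul_eq (Real.exp_pos x).ne' ((mul_comm _ _).trans hu)]
    field_simp
    ring

end Negative

/-- `N_k = V_k U_{k-1} - V_{k-2} U_{k+1}`; under the positive flow `ṡ_k = -N_k / U_k²`. -/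
noncomputable def sNumerator (ζ b : Fin n → ℝ) (k : ℤ) : ℝ :=
  V ζ b k * U ζ b (k - 1) - V ζ b (k - 2) * U ζ b (k + 1)

section Positive

variable (hζ : ∀ i, 0 < ζ i) (hmono : StrictMono ζ) (hb : ∀ t i, 0 < b t i)
  (hflow : ∀ t j, HasDerivAt (fun τ => b τ j) (b t j * ζ j ^ (1 : ℤ)) t)

include hζ hmono hb hflow

lemma hasDerivAt_U_sq_div_W_succ {m : ℕ} (hm : m < n) (t : ℝ) :
    HasDerivAt (fun τ => U ζ (b τ) (m + 1) ^ 2 / W ζ (b τ) m)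
      (2 * (U ζ (b t) (m + 1) * U ζ (b t) m) * sNumerator ζ (b t) (m + 1) / W ζ (b t) m ^ 2) t := by
  have h := hasDerivAt_U_sq_div_W (t := t) m hζ (hflow t)
    fun τ => (W_pos ζ (b τ) hζ hmono (hb τ) hm.le).ne'
  rwa [show V ζ (b t) (m + 1) * U ζ (b t) m - V ζ (b t) (m - 1) * U ζ (b t) (m + 2) =
    sNumerator ζ (b t) (m + 1) by rw [sNumerator, add_sub_cancel_right, add_assoc,
      one_add_one_eq_two, show (m : ℤ) + 1 - 2 = m - 1 by ring]] at h

/-- `r_{m+1}` is `√(A / B)` for `A = U_{m+1}² / W_m` and `B = U_m² / W_m`. -/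
lemma hasDerivAt_todaR {m : ℕ} (hm : m < n) (t : ℝ) :
    HasDerivAt (fun τ => todaR ζ (b τ) (m + 1))
      (todaR ζ (b t) (m + 1) * (U ζ (b t) (m + 1) * U ζ (b t) m / W ζ (b t) m *
        (sNumerator ζ (b t) (m + 1) / U ζ (b t) (m + 1) ^ 2 +
          sNumerator ζ (b t) m / U ζ (b t) m ^ 2))) t := by
  have hW : ∀ τ, 0 < W ζ (b τ) m := fun τ => W_pos ζ (b τ) hζ hmono (hb τ) hm.le
  have hU : ∀ τ, 0 < U ζ (b τ) m := fun τ => U_pos ζ (b τ) hζ hmono (hb τ) hm.le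
  have hU' : ∀ τ, 0 < U ζ (b τ) (m + 1) := fun τ => U_succ_pos hζ hmono (hb τ) hm
  have hA := hasDerivAt_U_sq_div_W_succ hζ hmono hb hflow hm t
  have hB := hasDerivAt_U_sq_div_W_self (t := t) m hζ (hflow t) fun τ => (hW τ).ne'
  rw [show V ζ (b t) m * U ζ (b t) (m - 1) - V ζ (b t) (m - 2) * U ζ (b t) (m + 1) =
    sNumerator ζ (b t) m from rfl] at hB
  have hW0 := hW t
  have hU0 := hU t
  have hU0' := hU' t
  have e : ∀ τ, todaR ζ (b τ) (m + 1) = Real.sqrt ((U ζ (b τ) (m + 1) ^ 2 / W ζ (b τ) m) /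
      (U ζ (b τ) m ^ 2 / W ζ (b τ) m)) := fun τ => by
    have := hW τ
    have := hU τ
    have := hU' τ
    rw [div_div_div_cancel_right₀ (hW τ).ne', ← div_pow, Real.sqrt_sq (by positivity), todaR,
      add_sub_cancel_right]
  refine hasDerivAt_of_eq ((hA.div hB (by positivity)).sqrt
    (by simp only [Pi.div_apply]; positivity)) e ?_
  simp only [Pi.div_apply]
  rw [← e, todaR, add_sub_cancel_right]
  field_simp
  ring

/-- The increment of `s` is `1 / √(A B)` for `A = U_{m+1}² / W_m` and `B = U_m² / W_m`. -/
lemma hasDerivAt_todaS_succ_sub {m : ℕ} (hm : m < n) (t : ℝ) :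
    HasDerivAt (fun τ => todaS ζ (b τ) (m + 1) - todaS ζ (b τ) m)
      (-(sNumerator ζ (b t) (m + 1) / U ζ (b t) (m + 1) ^ 2) +
          sNumerator ζ (b t) m / U ζ (b t) m ^ 2) t := by
  have hW : ∀ τ, 0 < W ζ (b τ) m := fun τ => W_pos ζ (b τ) hζ hmono (hb τ) hm.le
  have hU : ∀ τ, 0 < U ζ (b τ) m := fun τ => U_pos ζ (b τ) hζ hmono (hb τ) hm.le
  have hU' : ∀ τ, 0 < U ζ (b τ) (m + 1) := fun τ => U_succ_pos hζ hmono (hb τ) hm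
  have hA := hasDerivAt_U_sq_div_W_succ hζ hmono hb hflow hm t
  have hB := hasDerivAt_U_sq_div_W_self (t := t) m hζ (hflow t) fun τ => (hW τ).ne'
  rw [show V ζ (b t) m * U ζ (b t) (m - 1) - V ζ (b t) (m - 2) * U ζ (b t) (m + 1) =
    sNumerator ζ (b t) m from rfl] at hB
  have hW0 := hW t
  have hU0 := hU t
  have hU0' := hU' t
  have e : ∀ τ, todaS ζ (b τ) (m + 1) - todaS ζ (b τ) m =
      (Real.sqrt ((U ζ (b τ) (m + 1) ^ 2 / W ζ (b τ) m) * (U ζ (b τ) m ^ 2 / W ζ (b τ) m)))⁻¹ :=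
    fun τ => by
    have := hW τ
    have := hU τ
    have := hU' τ
    rw [todaS_succ_sub hζ hmono (hb τ) hm, div_mul_div_comm, ← mul_pow, ← sq, ← div_pow,
      Real.sqrt_sq (by positivity), inv_div]
  refine hasDerivAt_of_eq (((hA.mul hB).sqrt (by simp only [Pi.mul_apply]; positivity)).inv
    (by simp only [Pi.mul_apply]; positivity)) e ?_
  simp only [Pi.mul_apply]
  have e' := inv_injective ((e t).symm.trans ((todaS_succ_sub hζ hmono (hb t) hm).trans
    (inv_div _ _).symm))
  rw [e']
  field_simp
  ring

lemma hasDerivAt_todaS {k : ℕ} (hk : k ≤ n) (t : ℝ) :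
    HasDerivAt (fun τ => todaS ζ (b τ) k) (-(sNumerator ζ (b t) k / U ζ (b t) k ^ 2)) t := by
  induction k with
  | zero =>
    refine hasDerivAt_of_eq (hasDerivAt_const t (0 : ℝ)) (fun τ => todaS_zero ζ (b τ)) ?_
    rw [sNumerator, Nat.cast_zero, V_neg ζ _ (by norm_num : (0 : ℤ) - 2 < 0), U,
      U, spectralSum_eq_zero_of_neg _ _ _ (by norm_num : (0 : ℤ) - 1 < 0)]
    simp
  | succ k ih =>
    refine hasDerivAt_of_eq ((ih (by omega)).add
      (hasDerivAt_todaS_succ_sub hζ hmono hb hflow (m := k) (by omega) t)) (fun τ => ?_) ?_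
    · simp
    · push_cast; ring

end Positive

end Flows

end NovikovBToda

open NovikovBToda in
theorem mainTheorem6 (n : ℕ) (ζ₀ b₀ : Fin n → ℝ)
    (hζ_pos : ∀ j, 0 < ζ₀ j) (hζ_mono : StrictMono ζ₀) (hb_pos : ∀ j, 0 < b₀ j) :
    -- the negative flow gives Novikov peakons (well defined, positive and ordered at all times)
    (∀ ζ b : ℝ → Fin n → ℝ, ζ 0 = ζ₀ → b 0 = b₀ → IsNegativeFlow ζ b →
      (∀ t : ℝ, ∀ k ∈ Finset.Icc (1 : ℤ) n,
        0 < Z (ζ t) (b t) k ∧ 0 < W (ζ t) (b t) (k - 1) ∧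
        0 < U (ζ t) (b t) k ∧ 0 < U (ζ t) (b t) (k - 1)) ∧
      (∀ t : ℝ, StrictMonoOn (peakonX (ζ t) (b t)) (Set.Icc (1 : ℤ) n)) ∧
      (∀ t : ℝ, ∀ k ∈ Finset.Icc (1 : ℤ) n, 0 < peakonM (ζ t) (b t) k) ∧
      IsNovikovPeakon n (fun t => peakonX (ζ t) (b t)) (fun t => peakonM (ζ t) (b t))) ∧
    -- the positive flow gives the finite modified B-Toda lattice
    (∀ ζ b : ℝ → Fin n → ℝ, ζ 0 = ζ₀ → b 0 = b₀ → IsPositiveFlow ζ b →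
      (∀ t : ℝ, ∀ k ∈ Finset.Icc (0 : ℤ) n, 0 < U (ζ t) (b t) k) ∧
      IsModifiedBToda n (fun t => todaR (ζ t) (b t)) (fun t => todaS (ζ t) (b t))
        (fun t => todaBoundary (ζ t) (b t))) ∧
    -- the explicit map between the initial data
    (∀ k ∈ Finset.Icc (1 : ℤ) n,
      todaR ζ₀ b₀ k = rMap n (peakonX ζ₀ b₀) (peakonM ζ₀ b₀) k ∧
      todaS ζ₀ b₀ k = sMap n (peakonX ζ₀ b₀) (peakonM ζ₀ b₀) k) := by
  have hidx : ∀ k ∈ Finset.Icc (1 : ℤ) n, ∃ m : ℕ, m < n ∧ k = m + 1 := by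
    intro k hk
    rw [Finset.mem_Icc] at hk
    exact ⟨(k - 1).toNat, by omega, by omega⟩
  have hidx' : ∀ k ∈ Finset.Icc (1 : ℤ) n, ∃ m : ℕ, m < n ∧ k = n - m := by
    intro k hk
    rw [Finset.mem_Icc] at hk
    exact ⟨(n - k).toNat, by omega, by omega⟩
  refine ⟨fun ζ b hζ0 hb0 hflow => ?_, fun ζ b hζ0 hb0 hflow => ?_, fun k hk => ?_⟩
  -- along both flows `ζ` is constant and `b` stays positive
  · have hζ : ∀ t, ζ t = ζ₀ := fun t =>
      (eq_of_hasDerivAt_zero (fun t j => (hflow t j).1) t).trans hζ0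
    have hflow' : ∀ t j, HasDerivAt (fun τ => b τ j) (b t j * ζ₀ j ^ (-1 : ℤ)) t := fun t j => by
      have h := (hflow t j).2
      rwa [hζ, div_eq_mul_inv, ← zpow_neg_one] at h
    have hb : ∀ t j, 0 < b t j := fun t j =>
      pos_of_hasDerivAt_mul_self (fun t => hflow' t j) (by rw [hb0]; exact hb_pos j) t
    simp only [hζ]
    refine ⟨fun t k hk => ?_, fun t => peakonX_strictMonoOn hζ_pos hζ_mono (hb t),
      fun t k hk => ?_, fun t k hk => ?_⟩
    · obtain ⟨m, hm, rfl⟩ := hidx k hk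
      rw [add_sub_cancel_right]
      exact ⟨Z_pos ζ₀ (b t) hζ_pos hζ_mono (hb t) hm, W_pos ζ₀ (b t) hζ_pos hζ_mono (hb t) hm.le,
        U_succ_pos hζ_pos hζ_mono (hb t) hm, U_pos ζ₀ (b t) hζ_pos hζ_mono (hb t) hm.le⟩
    · obtain ⟨m, hm, rfl⟩ := hidx' k hk
      exact peakonM_pos hζ_pos hζ_mono (hb t) hm
    · obtain ⟨m, hm, rfl⟩ := hidx' k hk
      refine ⟨hasDerivAt_peakonX hζ_pos hζ_mono hb hflow' hm t, _,
        isAverageAt_deriv_peakonProfile _ _ _ _, ?_⟩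
      rw [sum_sign_peakonX hζ_pos hζ_mono (hb t) hm]
      exact hasDerivAt_peakonM hζ_pos hζ_mono hb hflow' hm t
  · have hζ : ∀ t, ζ t = ζ₀ := fun t =>
      (eq_of_hasDerivAt_zero (fun t j => (hflow t j).1) t).trans hζ0
    have hflow' : ∀ t j, HasDerivAt (fun τ => b τ j) (b t j * ζ₀ j ^ (1 : ℤ)) t := fun t j => by
      have h := (hflow t j).2
      rwa [hζ, mul_comm, ← zpow_one (ζ₀ j)] at h
    have hb : ∀ t j, 0 < b t j := fun t j =>
      pos_of_hasDerivAt_mul_self (fun t => hflow' t j) (by rw [hb0]; exact hb_pos j) t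
    have hU : ∀ t (m : ℕ), m ≤ n → 0 < U ζ₀ (b t) m := fun t m hm =>
      U_pos ζ₀ (b t) hζ_pos hζ_mono (hb t) hm
    have hU' : ∀ t (m : ℕ), m < n → 0 < U ζ₀ (b t) (m + 1) := fun t m hm =>
      U_succ_pos hζ_pos hζ_mono (hb t) hm
    have hS := fun k (hk : k ≤ n) t => hasDerivAt_todaS hζ_pos hζ_mono hb hflow' hk t
    have hsub : ∀ t (m : ℕ), m < n → todaS ζ₀ (b t) m - todaS ζ₀ (b t) (m + 1) =
        -(W ζ₀ (b t) m / (U ζ₀ (b t) (m + 1) * U ζ₀ (b t) m)) := fun t m hm => by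
      rw [← todaS_succ_sub hζ_pos hζ_mono (hb t) hm, neg_sub]
    simp only [hζ]
    refine ⟨fun t k hk => ?_, fun t => todaS_zero _ _, fun t => ?_, fun t => ?_, fun t k hk => ?_,
      fun t k hk => ?_, fun t k hk => ?_, fun t k hk hkn => ?_, fun t hn => ?_⟩
    · rw [Finset.mem_Icc] at hk
      obtain ⟨m, rfl⟩ := Int.eq_ofNat_of_zero_le hk.1
      exact hU t m (by omega)
    · simp [todaR, U_eq_zero_of_lt]
    · exact (div_pos (spectralSum_pos ζ₀ (b t) hζ_pos hζ_mono (hb t) 1 le_rfl)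
        (hU t n le_rfl)).ne'
    · obtain ⟨m, hm, rfl⟩ := hidx k hk
      rw [todaR, add_sub_cancel_right]
      exact (div_pos (hU' t m hm) (hU t m hm.le)).ne'
    · obtain ⟨m, hm, rfl⟩ := hidx k hk
      rw [add_sub_cancel_right, hsub t m hm]
      exact neg_ne_zero.mpr (div_pos (W_pos ζ₀ (b t) hζ_pos hζ_mono (hb t) hm.le)
        (mul_pos (hU' t m hm) (hU t m hm.le))).ne'
    · obtain ⟨m, hm, rfl⟩ := hidx k hk
      have h1 := (hS m hm.le t).deriv
      have h2 := (hS (m + 1) hm t).deriv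
      push_cast at h2
      refine hasDerivAt_of_eq (hasDerivAt_todaR hζ_pos hζ_mono hb hflow' hm t) (fun _ => rfl) ?_
      simp only [add_sub_cancel_right]
      rw [h1, h2, hsub t m hm]
      have := hU t m hm.le
      have := hU' t m hm
      have := W_pos ζ₀ (b t) hζ_pos hζ_mono (hb t) hm.le
      field_simp
      ring
    · obtain ⟨m, hm, rfl⟩ := hidx k hk
      have h2 := hS (m + 1) hm t
      push_cast at h2
      refine hasDerivAt_of_eq h2 (fun _ => rfl) ?_
      have := hU t m hm.le
      have := hU' t m hm
      have h3 := hU' t (m + 1) (by omega)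
      push_cast at h3
      simp only [todaR, todaS, sNumerator, add_sub_cancel_right]
      rw [show (m : ℤ) + 1 - 2 = m - 1 by ring]
      field_simp
      ring
    · obtain ⟨m, rfl⟩ := Nat.exists_eq_add_of_le' hn
      refine hasDerivAt_of_eq (hS (m + 1) le_rfl t) (fun _ => rfl) ?_
      have := hU t m (by omega)
      have := hU' t m (by omega)
      simp only [todaR, todaS, todaBoundary, sNumerator, Nat.cast_succ, add_sub_cancel_right]
      rw [U_eq_zero_of_lt ζ₀ (b t) (k := (m : ℤ) + 1 + 1) (by push_cast; omega)]
      field_simp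
      ring
  · obtain ⟨m, hm, rfl⟩ := hidx k hk
    refine ⟨todaR_eq_rMap hζ_pos hζ_mono hb_pos hm, ?_⟩
    have h := todaS_eq_sMap hζ_pos hζ_mono hb_pos (k := m + 1) hm
    exact_mod_cast h
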